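/- **Lemma (alignment of singularities of Fuchsian systems).** A *Fuchsian system* of dimension $n$ is a linear system $\dot X=A(t)X$ with $A(t)=\sum_j \frac{A_j}{t-t_j}$, a finite sum over distinct points $t_j\in\mathbb C$ with residues $0\ne A_j\in\mathrm{Mat}_{n\times n}(\mathbb C)$; its residue at infinity is $A_\infty=-\sum_j A_j$, and $t=\infty$ is singular iff $A_\infty\neq0$. Its polar locus is $\Sigma=\{t_j\}$, and its height is $\sum_j\|A_j\|+\|A_\infty\|$, where $\|\cdot\|$ is the operator norm on matrices induced by the maximum norm on $\mathbb C^n$. It belongs to the class $\mathcal F(n,m,r)$, $n,m,r\in\mathbb N$, if it has at most $m$ singular points in $\mathbb CP^1$ (including $\infty$) and height at most $r$. For a germ $X$ of a fundamental matrix solution at a nonsingular point, $\mathbb C(X)$ is the field of germs of meromorphic functions generated over $\mathbb C$ by $t$ and the entries $x_{ij}(t)$ of $X$ (the Picard–Vessiot field of the system). An element $f\in\mathbb C(X)$ has degree $\le d$ if $f=g/h$, where $h\not\equiv0$ and $g,h$ are values, at $t$ and the $x_{ij}$, of polynomials with complex coefficients of total degree $\le d$. The system satisfies the *simple-loop spectral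 condition* if for every simple closed curve $\gamma$ in $\mathbb C\setminus\Sigma$ all eigenvalues of the monodromy factor $M_\gamma$ (defined by $\Delta_\gamma X=XM_\gamma$, where $\Delta_\gamma$ is analytic continuation along $\gamma$) have modulus $1$. There exist primitive recursive functions $D,N,M,R:\mathbb N^3\to\mathbb N$ such that for all $n,m,r\in\mathbb N$ and every Fuchsian system in $\mathcal F(n,m,r)$ with polar locus $\Sigma$ there exist a nonconstant rational map $\varphi\in\mathbb C(t)$ and a Fuchsian system of some dimension $n'$, with polar locus $\Sigma'$, with the following properties. 1. Let $b\in\mathbb C\setminus\Sigma'$, $a\in\mathbb C\setminus\Sigma$, let $\psi$ be any germ at $b$ of a holomorphic branch of $\varphi^{-1}$ with $\psi(b)=a$, and let $X$ and $Y$ be any germs, at $a$ and $b$ respectively, of fundamental matrix solutions of the first and of the second system. Then $\psi^*\mathbb C(X)=\mathbb C(\psi^*X)\subseteq\mathbb C(Y)$, where $\psi^*f=f\circ\psi$ and $\mathbb C(\psi^*X)$ is the field generated over $\mathbb C$ by $\psi$ and the functions $x_{ij}\circ\psi$. 2. In the situation of 1, if $f\in\mathbb C(X)$ has degree $\le d$,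 then $\psi^*f$ has degree $\le d$ as an element of $\mathbb C(Y)$. 3. All singular points of the second system are finite and real (in particular, $\infty$ is nonsingular), and all its residue matrices are real. 4. $\deg\varphi\le D(n,m,r)$, $n'\le N(n,m,r)$, and the second system has at most $M(n,m,r)$ singular points and height at most $R(n,m,r)$. 5. If the first system satisfies the simple-loop spectral condition, then so does the second. -/

import Mathlib

open Filter Topology

noncomputable section

/-- An `n × n` Fuchsian system `dX/dt = (∑ⱼ Aⱼ / (t - tⱼ)) X` on the Riemann sphere, given by its
finitely many finite residue matrices: `residue t` is the residue of the coefficient matrix at `t`,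
and the finite singular points are exactly the points with a nonzero residue. -/
structure FuchsianSystem (n : ℕ) where
  residue : ℂ →₀ Matrix (Fin n) (Fin n) ℂ

namespace FuchsianSystem

variable {n : ℕ}

/-- The finite singular points (the polar locus). -/
def poles (S : FuchsianSystem n) : Finset ℂ := S.residue.support

/-- The coefficient matrix `A(t) = ∑ⱼ Aⱼ / (t - tⱼ)`. -/
def coeff (S : FuchsianSystem n) (t : ℂ) : Matrix (Fin n) (Fin n) ℂ :=
  ∑ a ∈ S.poles, (t - a)⁻¹ • S.residue a

/-- The residue at infinity, `-(A₁ + ⋯ + Aₘ)`. -/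
def residueInfty (S : FuchsianSystem n) : Matrix (Fin n) (Fin n) ℂ :=
  -∑ a ∈ S.poles, S.residue a

open Classical in
/-- The number of singular points on the Riemann sphere, the point at infinity included. -/
def numSingular (S : FuchsianSystem n) : ℕ :=
  S.poles.card + if S.residueInfty = 0 then 0 else 1

section Height

attribute [local instance] Matrix.linftyOpNormedAddCommGroup

/-- The height: the sum of the norms of all residues, that at infinity included. The norm is the
operator norm on matrices induced by the maximum norm on `ℂⁿ`. -/
def height (S : FuchsianSystem n) : ℝ :=
  ∑ a ∈ S.poles, ‖S.residue a‖ + ‖S.residueInfty‖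

end Height

/-- Membership in the Fuchsian class with parameters `(n, m, r)`: at most `m` singular points on
the sphere (including infinity) and height at most `r`. -/
def InClass (S : FuchsianSystem n) (m r : ℕ) : Prop :=
  S.numSingular ≤ m ∧ S.height ≤ r

/-- The matrix function `X` satisfies `dX/dt = A(t) X` in a neighbourhood of `b`. -/
def IsSolutionNear (S : FuchsianSystem n) (b : ℂ) (X : ℂ → Matrix (Fin n) (Fin n) ℂ) : Prop :=
  ∀ᶠ t in 𝓝 b, ∀ i j, HasDerivAt (fun u => X u i j) ((S.coeff t * X t) i j) t

/-- `X` represents the germ at `b` of a fundamental matrix solution. -/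
def IsFundamentalAt (S : FuchsianSystem n) (b : ℂ) (X : ℂ → Matrix (Fin n) (Fin n) ℂ) : Prop :=
  S.IsSolutionNear b X ∧ (X b).det ≠ 0

/-- `Z` is the analytic continuation of a matrix solution along the path `γ : [0,1] → ℂ`:
locally along the path, `Z s` is the value at `γ s` of a holomorphic matrix solution. -/
def IsContinuationAlong (S : FuchsianSystem n) (γ : ℝ → ℂ)
    (Z : ℝ → Matrix (Fin n) (Fin n) ℂ) : Prop :=
  ∀ s ∈ Set.Icc (0 : ℝ) 1, ∃ F : ℂ → Matrix (Fin n) (Fin n) ℂ,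
    S.IsSolutionNear (γ s) F ∧ ∀ᶠ s' in 𝓝[Set.Icc (0 : ℝ) 1] s, Z s' = F (γ s')

/-- `M` is the monodromy factor, along the closed path `γ`, of some fundamental solution:
continuation along `γ` transforms `X` into `X M`. -/
def IsMonodromyFactor (S : FuchsianSystem n) (γ : ℝ → ℂ) (M : Matrix (Fin n) (Fin n) ℂ) : Prop :=
  ∃ Z : ℝ → Matrix (Fin n) (Fin n) ℂ,
    S.IsContinuationAlong γ Z ∧ (Z 0).det ≠ 0 ∧ Z 1 = Z 0 * M

end FuchsianSystem

/-- A simple loop: a closed non-selfintersecting continuous curve `γ : [0,1] → ℂ`. -/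
def IsSimpleLoop (γ : ℝ → ℂ) : Prop :=
  ContinuousOn γ (Set.Icc 0 1) ∧ γ 0 = γ 1 ∧ Set.InjOn γ (Set.Ico 0 1)

/-- The simple-loop spectral condition: the eigenvalues of the monodromy factors along all simple
loops avoiding the finite singular points lie on the unit circle. -/
def FuchsianSystem.SpectralCondition {n : ℕ} (S : FuchsianSystem n) : Prop :=
  ∀ γ : ℝ → ℂ, IsSimpleLoop γ → (∀ s ∈ Set.Icc (0 : ℝ) 1, γ s ∉ S.poles) →
    ∀ M : Matrix (Fin n) (Fin n) ℂ, S.IsMonodromyFactor γ M → ∀ μ ∈ spectrum ℂ M, ‖μ‖ = 1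

/-- Germs at `b` of functions on punctured neighbourhoods of `b`; the field of germs at `b` of
meromorphic functions is a subring of it. -/
abbrev PuncturedGerm (b : ℂ) : Type := Germ (𝓝[≠] b) ℂ

namespace PuncturedGerm

variable {ι : Type} {b : ℂ}

/-- The embedding of the constants `ℂ` into the germs. -/
def constHom (b : ℂ) : ℂ →+* PuncturedGerm b :=
  (Germ.coeRingHom (𝓝[≠] b)).comp (Pi.constRingHom ℂ ℂ)

/-- The value of a polynomial with complex coefficients at a family of germs. -/
def evalPoly (g : ι → PuncturedGerm b) (P : MvPolynomial ι ℂ) : PuncturedGerm b :=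
  MvPolynomial.eval₂ (constHom b) g P

/-- `f` is a quotient of two polynomials of degree at most `d` in the generators `g`. -/
def DegreeLE (g : ι → PuncturedGerm b) (d : ℕ) (f : PuncturedGerm b) : Prop :=
  ∃ P Q : MvPolynomial ι ℂ, P.totalDegree ≤ d ∧ Q.totalDegree ≤ d ∧
    evalPoly g Q ≠ 0 ∧ f = evalPoly g P / evalPoly g Q

/-- The field of all rational combinations, with coefficients in `ℂ`, of the generators `g`. -/
def generatedField (g : ι → PuncturedGerm b) : Set (PuncturedGerm b) :=
  {f | ∃ d, DegreeLE g d f}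

end PuncturedGerm

/-- The generators of `ℂ(X)` as germs at `b`: the independent variable `t` (index `none`) and the
entries of the matrix `X`. -/
def pvGenerators {n : ℕ} (X : ℂ → Matrix (Fin n) (Fin n) ℂ) (b : ℂ) :
    Option (Fin n × Fin n) → PuncturedGerm b
  | none => ((fun t : ℂ => t) : ℂ → ℂ)
  | some ij => ((fun t : ℂ => X t ij.1 ij.2) : ℂ → ℂ)

/-- The Picard–Vessiot field `ℂ(X)`, realized by germs at `b`. -/
def pvField {n : ℕ} (X : ℂ → Matrix (Fin n) (Fin n) ℂ) (b : ℂ) : Set (PuncturedGerm b) :=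
  PuncturedGerm.generatedField (pvGenerators X b)

/-- The degree of `f`, as an element of `ℂ(X)` realized by germs at `b`, is at most `d`. -/
def PVDegreeLE {n : ℕ} (X : ℂ → Matrix (Fin n) (Fin n) ℂ) (b : ℂ) (d : ℕ)
    (f : PuncturedGerm b) : Prop :=
  PuncturedGerm.DegreeLE (pvGenerators X b) d f

/-- The degree of a rational map of the Riemann sphere. -/
def ratMapDegree (φ : RatFunc ℂ) : ℕ := max φ.num.natDegree φ.denom.natDegree

/-- `ψ` is (a representative of) a germ at `b`, with value `a`, of a branch of the inverse of the
rational map `φ`. -/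
structure IsInverseBranch (φ : RatFunc ℂ) (ψ : ℂ → ℂ) (b a : ℂ) : Prop where
  analyticAt : AnalyticAt ℂ ψ b
  map_base : ψ b = a
  right_inverse : ∀ᶠ z in 𝓝 b,
    φ.denom.eval (ψ z) ≠ 0 ∧ φ.eval (RingHom.id ℂ) (ψ z) = z

theorem IsInverseBranch.tendsto {φ : RatFunc ℂ} {ψ : ℂ → ℂ} {b a : ℂ}
    (h : IsInverseBranch φ ψ b a) : Tendsto ψ (𝓝[≠] b) (𝓝[≠] a) := by
  have hb := h.right_inverse.self_of_nhds.2
  rw [h.map_base] at hb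
  refine tendsto_nhdsWithin_iff.2 ⟨?_, ?_⟩
  · have := h.analyticAt.continuousAt.tendsto
    rw [h.map_base] at this
    exact this.mono_left nhdsWithin_le_nhds
  · filter_upwards [h.right_inverse.filter_mono nhdsWithin_le_nhds, self_mem_nhdsWithin]
      with z hz hzb hza
    rw [Set.mem_singleton_iff] at hza
    rw [hza, hb] at hz
    exact hzb hz.2.symm

/-- The pullback `ψ*f = f ∘ ψ` of germs. -/
def IsInverseBranch.pullback {φ : RatFunc ℂ} {ψ : ℂ → ℂ} {b a : ℂ}
    (h : IsInverseBranch φ ψ b a) (f : PuncturedGerm a) : PuncturedGerm b :=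
  f.compTendsto ψ h.tendsto

end

/-!
One system dominates another through a map `φ` if, locally, the solutions of the dominated system
and the independent variable are ratios, with a common denominator, of affine combinations of `φ`
and of solutions of the dominating system composed with `φ`. Clearing the denominators turns a
polynomial expression of degree `d` into one of degree `d`, so domination gives the inclusion of
Picard–Vessiot fields without increase of degrees; and it is transitive.

If `p` is a nonreal singular point and `c = p.re`, the map `t ↦ (t - c) ^ 2` sends `p` and all real
singular points to the real line. With `z = s ^ 2`, the sum of `x(c + s)` and `x(c - s)` and their
difference multiplied by `s ρ(z)` satisfy a Fuchsian system in `z`. The absolute values of the zeros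
and poles of the rational function `ρ` interlace those of the singular points in `z`, which keeps
the residues bounded however different these absolute values are. At most `m` such folds make all
singular points real. A map `z ↦ 1 / (z - c)` with `c` real and nonsingular then makes infinity
nonsingular, and splitting solutions into real and imaginary parts makes the residues real. The
composition of all these maps is `1 / q` for a polynomial `q` of degree `2 ^ m`.

A simple loop avoiding the singular points of the folded system lifts under squaring either to a
simple loop or to half of a centrally symmetric simple loop, and in the second case the eigenvalue
along the whole loop is the square of the one along its half. Hence the eigenvalues keep modulus
one.
-/

open scoped Matrix

section PolarPart

variable {E F : Type*} [AddCommGroup E] [Module ℂ E] [AddCommGroup F] [Module ℂ F]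

/-- The rational function `∑ₐ (t - a)⁻¹ • R a` of `t` with residues `R`, as a linear function of
the residues. -/
noncomputable def polarPart : (ℂ →₀ E) →ₗ[ℂ] (ℂ → E) :=
  Finsupp.lsum ℂ fun a => LinearMap.pi fun t => (t - a)⁻¹ • LinearMap.id

theorem polarPart_eq_sum {s : Finset ℂ} {R : ℂ →₀ E} (h : R.support ⊆ s) (t : ℂ) :
    polarPart R t = ∑ a ∈ s, (t - a)⁻¹ • R a := by
  rw [polarPart, Finsupp.lsum_apply, Finsupp.sum_of_support_subset _ h _ (by simp)]
  simp

@[simp]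
theorem polarPart_single (a : ℂ) (M : E) (t : ℂ) :
    polarPart (Finsupp.single a M) t = (t - a)⁻¹ • M := by
  simp [polarPart]

theorem polarPart_mapRange (T : E →ₗ[ℂ] F) (R : ℂ →₀ E) (t : ℂ) :
    polarPart (R.mapRange T T.map_zero) t = T (polarPart R t) := by
  rw [polarPart_eq_sum Finsupp.support_mapRange, polarPart_eq_sum subset_rfl, map_sum]
  simp

theorem analyticAt_polarPart {E : Type*} [NormedAddCommGroup E] [NormedSpace ℂ E]
    {R : ℂ →₀ E} {b : ℂ} (hb : b ∉ R.support) : AnalyticAt ℂ (polarPart R) b := by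
  rw [funext (polarPart_eq_sum (subset_refl R.support))]
  refine Finset.analyticAt_fun_sum _ fun a ha => ?_
  have hba : b - a ≠ 0 := sub_ne_zero.2 fun h => hb (h ▸ ha)
  exact ((analyticAt_id.sub analyticAt_const).inv hba).smul analyticAt_const

end PolarPart

section Uniqueness

variable {E : Type*} [NormedAddCommGroup E] [NormedSpace ℂ E]

theorem eventually_eq_zero_of_norm_deriv_le {x x' : ℂ → E} {b : ℂ} {K : ℝ}
    (hx : ∀ᶠ t in 𝓝 b, HasDerivAt x (x' t) t) (hK : ∀ᶠ t in 𝓝 b, ‖x' t‖ ≤ K * ‖x t‖)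
    (h0 : x b = 0) : ∀ᶠ t in 𝓝 b, x t = 0 := by
  obtain ⟨δ, hδ, hball⟩ := Metric.eventually_nhds_iff_ball.1 (hx.and hK)
  filter_upwards [Metric.ball_mem_nhds b hδ] with t ht
  have hsegment : ∀ s ∈ Set.Icc (0 : ℝ) 1, b + s * (t - b) ∈ Metric.ball b δ := by
    intro s hs
    rw [mem_ball_iff_norm] at ht ⊢
    rw [add_sub_cancel_left, norm_mul, Complex.norm_real, Real.norm_of_nonneg hs.1]
    exact (mul_le_of_le_one_left (norm_nonneg _) hs.2).trans_lt ht
  have hderiv : ∀ s ∈ Set.Icc (0 : ℝ) 1, HasDerivAt (fun s : ℝ => x (b + s * (t - b)))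
      ((t - b) • x' (b + s * (t - b))) s := by
    intro s hs
    have hline : HasDerivAt (fun s : ℝ => b + (s : ℂ) * (t - b)) (t - b) s := by
      simpa using ((Complex.ofRealCLM.hasDerivAt (x := s)).mul_const (t - b)).const_add b
    exact (hball _ (hsegment s hs)).1.scomp s hline
  have hzero := eq_zero_of_abs_deriv_le_mul_abs_self_of_eq_zero_right (K := ‖t - b‖ * K)
    (fun s hs => (hderiv s hs).continuousAt.continuousWithinAt)
    (fun s hs => (hderiv s ⟨hs.1, hs.2.le⟩).hasDerivWithinAt) (by simpa using h0)
    (fun s hs => by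
      rw [norm_smul, mul_assoc]
      gcongr
      exact (hball _ (hsegment s ⟨hs.1, hs.2.le⟩)).2)
  simpa using hzero 1 (by simp)

end Uniqueness

section PowerSeries

variable {E : Type*} [NormedAddCommGroup E] [NormedSpace ℂ E] {a : ℕ → E} {b t : ℂ} {C L : ℝ}

theorem norm_pow_smul_le_of_norm_le (ha : ∀ k, ‖a k‖ ≤ C * L ^ k) (k : ℕ) :
    ‖(t - b) ^ k • a k‖ ≤ C * (‖t - b‖ * L) ^ k := by
  rw [norm_smul, norm_pow, mul_pow, mul_left_comm]
  gcongr
  exact ha k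

theorem summable_norm_pow_smul_of_norm_le (ha : ∀ k, ‖a k‖ ≤ C * L ^ k) (hL : 0 ≤ L)
    (ht : ‖t - b‖ * L < 1) : Summable fun k => ‖(t - b) ^ k • a k‖ :=
  .of_nonneg_of_le (fun _ => norm_nonneg _) (norm_pow_smul_le_of_norm_le ha)
    ((summable_geometric_of_lt_one (by positivity) ht).mul_left C)

theorem norm_natCast_mul_pow_smul_le {r : ℝ} (ha : ∀ k, ‖a k‖ ≤ C * L ^ k) (hC : 0 ≤ C)
    (hL : 0 ≤ L) (ht : ‖t - b‖ * L ≤ r) (k : ℕ) :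
    ‖((k : ℂ) * (t - b) ^ (k - 1)) • a k‖ ≤ C * L * (k * r ^ (k - 1)) := by
  rcases k with _ | k
  · simp
  rw [norm_smul, norm_mul, norm_pow, Complex.norm_natCast, Nat.add_sub_cancel]
  calc ((k + 1 : ℕ) : ℝ) * ‖t - b‖ ^ k * ‖a (k + 1)‖
      ≤ ((k + 1 : ℕ) : ℝ) * ‖t - b‖ ^ k * (C * L ^ (k + 1)) := by gcongr; exact ha _
    _ = C * L * ((k + 1 : ℕ) * (‖t - b‖ * L) ^ k) := by ring
    _ ≤ C * L * ((k + 1 : ℕ) * r ^ k) := by gcongr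

theorem hasDerivAt_tsum_pow_smul [CompleteSpace E] (ha : ∀ k, ‖a k‖ ≤ C * L ^ k) (hL : 0 < L)
    (ht : ‖t - b‖ * L < 1) :
    HasDerivAt (fun t => ∑' k, (t - b) ^ k • a k)
      (∑' k, (t - b) ^ k • ((k + 1 : ℕ) : ℂ) • a (k + 1)) t := by
  have hC : 0 ≤ C := by simpa using (norm_nonneg _).trans (ha 0)
  obtain ⟨r, hr, hr1⟩ := exists_between ht
  have hr0 : 0 ≤ r := (by positivity : 0 ≤ ‖t - b‖ * L).trans hr.le
  have hball : ∀ y, y ∈ Metric.ball b (r / L) ↔ ‖y - b‖ * L < r := fun y => by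
    rw [mem_ball_iff_norm, lt_div_iff₀ hL]
  have hsum : Summable fun k : ℕ => C * L * (k * r ^ (k - 1)) := by
    refine .mul_left _ ((summable_nat_add_iff 1).1 ?_)
    have hpow := summable_pow_mul_geometric_of_norm_lt_one 1
      (show ‖r‖ < 1 by rwa [Real.norm_of_nonneg hr0])
    simpa [add_mul] using hpow.add (summable_geometric_of_lt_one hr0 hr1)
  have hderiv := hasDerivAt_tsum_of_isPreconnected hsum (t := Metric.ball b (r / L))
    (g := fun k y => (y - b) ^ k • a k) (g' := fun k y => ((k : ℂ) * (y - b) ^ (k - 1)) • a k)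
    Metric.isOpen_ball (convex_ball _ _).isPreconnected
    (fun k y _ => by simpa using (((hasDerivAt_id y).sub_const b).pow k).smul_const (a k))
    (fun k y hy => norm_natCast_mul_pow_smul_le ha hC hL.le ((hball y).1 hy).le k)
    ((hball t).2 hr) (summable_norm_pow_smul_of_norm_le ha hL.le ht).of_norm ((hball t).2 hr)
  convert hderiv using 1
  rw [Summable.tsum_eq_zero_add (.of_norm_bounded hsum
    (norm_natCast_mul_pow_smul_le ha hC hL.le hr.le))]
  simp only [Nat.cast_zero, zero_mul, zero_smul, zero_add, Nat.add_sub_cancel]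
  exact tsum_congr fun k => by rw [mul_comm, mul_smul]

theorem exists_hasSum_pow_smul_of_analyticAt {f : ℂ → E} (hf : AnalyticAt ℂ f b) :
    ∃ (a : ℕ → E) (C L : ℝ), 0 < C ∧ 0 < L ∧ (∀ k, ‖a k‖ ≤ C * L ^ k) ∧
      ∀ t, ‖t - b‖ * L < 1 → HasSum (fun k => (t - b) ^ k • a k) (f t) := by
  obtain ⟨p, R, hp⟩ := hf
  obtain ⟨r, hr0, hr⟩ := ENNReal.lt_iff_exists_nnreal_btwn.1 hp.r_pos
  have hr0 : (0 : ℝ) < r := by exact_mod_cast hr0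
  obtain ⟨C, hC, hbound⟩ := p.norm_mul_pow_le_of_lt_radius (hr.trans_le hp.r_le)
  refine ⟨p.coeff, C, (r : ℝ)⁻¹, hC, by positivity, fun k => ?_, fun t ht => ?_⟩
  · rw [← p.norm_apply_eq_norm_coef, inv_pow, ← div_eq_mul_inv, le_div_iff₀ (by positivity)]
    exact hbound k
  · rw [← div_eq_mul_inv, div_lt_one hr0] at ht
    have hmem : t ∈ Metric.eball b R := by
      refine lt_trans ?_ hr
      rw [edist_dist, dist_eq_norm]
      exact (ENNReal.ofReal_lt_iff_lt_toReal (norm_nonneg _) (by simp)).2 (by simpa using ht)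
    simpa using hp.hasSum_sub hmem

end PowerSeries

section LocalExistence

variable {𝔸 : Type*} [NormedRing 𝔸] [NormedAlgebra ℂ 𝔸]

/-- The Taylor coefficients of the solution of `X' = A X`, `X(b) = 1`, in terms of those of `A`. -/
noncomputable def odeCoeff (a : ℕ → 𝔸) : ℕ → 𝔸
  | 0 => 1
  | k + 1 => ((k + 1 : ℂ)⁻¹) • ∑ i : Fin (k + 1), a (k - i) * odeCoeff a i

theorem smul_odeCoeff_succ (a : ℕ → 𝔸) (k : ℕ) :
    ((k + 1 : ℕ) : ℂ) • odeCoeff a (k + 1) =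
      ∑ p ∈ Finset.HasAntidiagonal.antidiagonal k, a p.1 * odeCoeff a p.2 := by
  rw [odeCoeff, smul_smul, Nat.cast_succ, mul_inv_cancel₀ (Nat.cast_add_one_ne_zero k), one_smul,
    Fin.sum_univ_eq_sum_range (fun i => a (k - i) * odeCoeff a i) (k + 1),
    ← Finset.Nat.sum_antidiagonal_swap, Finset.Nat.sum_antidiagonal_eq_sum_range_succ_mk]
  rfl

theorem norm_odeCoeff_le {a : ℕ → 𝔸} {C K L : ℝ} (hK : 0 ≤ K) (hKL : K ≤ L) (hCL : C ≤ L)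
    (ha : ∀ i, ‖a i‖ ≤ C * K ^ i) (k : ℕ) : ‖odeCoeff a k‖ ≤ ‖(1 : 𝔸)‖ * L ^ k := by
  have hC : 0 ≤ C := by simpa using (norm_nonneg _).trans (ha 0)
  have hL : 0 ≤ L := hK.trans hKL
  induction k using Nat.strong_induction_on with
  | _ k ih =>
    rcases k with _ | k
    · simp [odeCoeff]
    have hterm : ∀ p ∈ Finset.HasAntidiagonal.antidiagonal k,
        ‖a p.1 * odeCoeff a p.2‖ ≤ ‖(1 : 𝔸)‖ * L ^ (k + 1) := by
      intro p hp
      rw [Finset.HasAntidiagonal.mem_antidiagonal] at hp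
      calc ‖a p.1 * odeCoeff a p.2‖ ≤ ‖a p.1‖ * ‖odeCoeff a p.2‖ := norm_mul_le _ _
        _ ≤ (C * K ^ p.1) * (‖(1 : 𝔸)‖ * L ^ p.2) := by
            gcongr
            · exact ha _
            · exact ih _ (by lia)
        _ ≤ (L * L ^ p.1) * (‖(1 : 𝔸)‖ * L ^ p.2) := by gcongr
        _ = ‖(1 : 𝔸)‖ * L ^ (k + 1) := by rw [← hp]; ring
    have hsum : (k + 1 : ℕ) * ‖odeCoeff a (k + 1)‖ ≤
        (k + 1 : ℕ) * (‖(1 : 𝔸)‖ * L ^ (k + 1)) := by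
      rw [← Complex.norm_natCast, ← norm_smul, smul_odeCoeff_succ, Complex.norm_natCast]
      refine (norm_sum_le _ _).trans ((Finset.sum_le_card_nsmul _ _ _ hterm).trans_eq ?_)
      rw [Finset.Nat.card_antidiagonal, nsmul_eq_mul]
    exact le_of_mul_le_mul_left hsum (by positivity)

variable [CompleteSpace 𝔸]

theorem hasDerivAt_tsum_pow_smul_odeCoeff {A : ℂ → 𝔸} {a : ℕ → 𝔸} {b t : ℂ} {C K L : ℝ}
    (hK : 0 ≤ K) (hL : 0 < L) (hKL : K ≤ L) (hCL : C ≤ L) (ha : ∀ k, ‖a k‖ ≤ C * K ^ k)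
    (hA : HasSum (fun k => (t - b) ^ k • a k) (A t)) (ht : ‖t - b‖ * L < 1) :
    HasDerivAt (fun t => ∑' k, (t - b) ^ k • odeCoeff a k)
      (A t * ∑' k, (t - b) ^ k • odeCoeff a k) t := by
  have hX := norm_odeCoeff_le hK hKL hCL ha
  have htK : ‖t - b‖ * K < 1 := lt_of_le_of_lt (by gcongr) ht
  refine (hasDerivAt_tsum_pow_smul hX hL ht).congr_deriv ?_
  have hsumA : Summable fun k => ‖(t - b) ^ k • a k‖ :=
    summable_norm_pow_smul_of_norm_le ha hK htK
  have hsumX : Summable fun k => ‖(t - b) ^ k • odeCoeff a k‖ :=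
    summable_norm_pow_smul_of_norm_le hX hL.le ht
  rw [← hA.tsum_eq, tsum_mul_tsum_eq_tsum_sum_antidiagonal_of_summable_norm hsumA hsumX]
  refine tsum_congr fun k => ?_
  rw [smul_odeCoeff_succ, Finset.smul_sum]
  refine Finset.sum_congr rfl fun p hp => ?_
  rw [smul_mul_smul_comm, ← pow_add, Finset.HasAntidiagonal.mem_antidiagonal.1 hp]

theorem exists_hasDerivAt_eq_mul {A : ℂ → 𝔸} {b : ℂ} (hA : AnalyticAt ℂ A b) :
    ∃ X : ℂ → 𝔸, X b = 1 ∧ ∀ᶠ t in 𝓝 b, HasDerivAt X (A t * X t) t := by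
  obtain ⟨a, C, K, hC, hK, ha, hAsum⟩ := exists_hasSum_pow_smul_of_analyticAt hA
  have hL : 0 < C + K := by positivity
  refine ⟨fun t => ∑' k, (t - b) ^ k • odeCoeff a k, ?_, ?_⟩
  · change ∑' k, (b - b) ^ k • odeCoeff a k = 1
    rw [tsum_eq_single 0 fun k hk => by simp [hk]]
    simp [odeCoeff]
  filter_upwards [Metric.ball_mem_nhds b (inv_pos.2 hL)] with t ht
  have htL : ‖t - b‖ * (C + K) < 1 := by
    rwa [mem_ball_iff_norm, ← one_div, lt_div_iff₀ hL] at ht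
  have htK : ‖t - b‖ * K < 1 := lt_of_le_of_lt (by gcongr; linarith) htL
  exact hasDerivAt_tsum_pow_smul_odeCoeff hK.le hL (by linarith) (by linarith) ha
    (hAsum t htK) htL

end LocalExistence

section Solutions

variable {ι κ : Type*} [Fintype ι] [Fintype κ] {R : ℂ →₀ Matrix ι ι ℂ}
  {R' : ℂ →₀ Matrix κ κ ℂ} {b : ℂ} {x y : ℂ → ι → ℂ}

/-- `x` is a vector solution of the Fuchsian system with residues `R` in a neighbourhood of `b`. -/
def IsVecSolution (R : ℂ →₀ Matrix ι ι ℂ) (b : ℂ) (x : ℂ → ι → ℂ) : Prop :=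
  ∀ᶠ t in 𝓝 b, HasDerivAt x (polarPart R t *ᵥ x t) t

theorem IsVecSolution.continuousAt (h : IsVecSolution R b x) : ContinuousAt x b :=
  h.self_of_nhds.continuousAt

theorem IsVecSolution.sub (hx : IsVecSolution R b x) (hy : IsVecSolution R b y) :
    IsVecSolution R b (x - y) := by
  filter_upwards [hx, hy] with t htx hty
  simpa [Matrix.mulVec_sub] using htx.sub hty

section
attribute [local instance] Matrix.linftyOpNormedAddCommGroup Matrix.linftyOpNormedSpace

theorem IsVecSolution.eventually_eq_zero (hx : IsVecSolution R b x) (hb : b ∉ R.support)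
    (h0 : x b = 0) : ∀ᶠ t in 𝓝 b, x t = 0 := by
  have hbounded : ∀ᶠ t in 𝓝 b, ‖polarPart R t‖ < ‖polarPart R b‖ + 1 :=
    (analyticAt_polarPart hb).continuousAt.norm.tendsto.eventually_lt_const (by simp)
  refine eventually_eq_zero_of_norm_deriv_le (K := ‖polarPart R b‖ + 1) hx
    (hbounded.mono fun t ht => ?_) h0
  exact (Matrix.linfty_opNorm_mulVec _ _).trans (by gcongr)

end

theorem IsVecSolution.eventually_eq (hx : IsVecSolution R b x) (hy : IsVecSolution R b y)
    (hb : b ∉ R.support) (h0 : x b = y b) : ∀ᶠ t in 𝓝 b, x t = y t := by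
  filter_upwards [(hx.sub hy).eventually_eq_zero hb (by simp [h0])] with t ht
  simpa [sub_eq_zero] using ht

variable {T : (ι → ℂ) →ₗ[ℂ] (κ → ℂ)}

theorem map_polarPart_mulVec (hT : ∀ a v, T (R a *ᵥ v) = R' a *ᵥ T v) (t : ℂ) (v : ι → ℂ) :
    T (polarPart R t *ᵥ v) = polarPart R' t *ᵥ T v := by
  classical
  rw [polarPart_eq_sum (Finset.subset_union_left (s₂ := R'.support)),
    polarPart_eq_sum (Finset.subset_union_right (s₁ := R.support))]
  simp only [Matrix.sum_mulVec, Matrix.smul_mulVec, map_sum, map_smul, hT]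

theorem IsVecSolution.map (hT : ∀ a v, T (R a *ᵥ v) = R' a *ᵥ T v) (hx : IsVecSolution R b x) :
    IsVecSolution R' b fun t => T (x t) := by
  filter_upwards [hx] with t ht
  rw [← map_polarPart_mulVec hT]
  exact (LinearMap.toContinuousLinearMap T).hasFDerivAt.comp_hasDerivAt t ht

end Solutions

namespace FuchsianSystem

variable {n : ℕ} {S : FuchsianSystem n} {b : ℂ} {X Y : ℂ → Matrix (Fin n) (Fin n) ℂ}

theorem polarPart_residue (S : FuchsianSystem n) : polarPart S.residue = S.coeff :=
  funext fun t => polarPart_eq_sum subset_rfl t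

theorem isSolutionNear_iff_isVecSolution :
    S.IsSolutionNear b X ↔ ∀ j, IsVecSolution S.residue b fun t i => X t i j := by
  simp only [IsSolutionNear, IsVecSolution, polarPart_residue, hasDerivAt_pi]
  rw [← eventually_all]
  exact eventually_congr (.of_forall fun t => forall_comm)

theorem IsSolutionNear.mulVec (hX : S.IsSolutionNear b X) (c : Fin n → ℂ) :
    IsVecSolution S.residue b fun t => X t *ᵥ c := by
  filter_upwards [hX] with t ht
  rw [polarPart_residue, Matrix.mulVec_mulVec]
  refine hasDerivAt_pi.2 fun i => ?_
  simp only [Matrix.mulVec, dotProduct]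
  exact HasDerivAt.fun_sum fun j _ => (ht i j).mul_const (c j)

theorem IsSolutionNear.mul_const (hX : S.IsSolutionNear b X) (C : Matrix (Fin n) (Fin n) ℂ) :
    S.IsSolutionNear b fun t => X t * C :=
  isSolutionNear_iff_isVecSolution.2 fun j => hX.mulVec fun i => C i j

theorem IsSolutionNear.eventually_eq (hX : S.IsSolutionNear b X) (hY : S.IsSolutionNear b Y)
    (hb : b ∉ S.poles) (h0 : X b = Y b) : ∀ᶠ t in 𝓝 b, X t = Y t := by
  rw [isSolutionNear_iff_isVecSolution] at hX hY
  filter_upwards [eventually_all.2 fun j => (hX j).eventually_eq (hY j) hb (by simp [h0])] with t ht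
  ext i j
  exact congr_fun (ht j) i

theorem IsSolutionNear.continuousAt (hX : S.IsSolutionNear b X) : ContinuousAt X b :=
  continuousAt_pi.2 fun i => continuousAt_pi.2 fun j => (hX.self_of_nhds i j).continuousAt

section
attribute [local instance] Matrix.linftyOpNormedRing Matrix.linftyOpNormedAlgebra

theorem exists_isSolutionNear (hb : b ∉ S.poles) : ∃ X, S.IsSolutionNear b X ∧ X b = 1 := by
  obtain ⟨X, hXb, hX⟩ := exists_hasDerivAt_eq_mul (analyticAt_polarPart hb)
  refine ⟨X, ?_, hXb⟩
  filter_upwards [hX] with t ht i j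
  rw [← polarPart_residue]
  exact hasDerivAt_pi.1 (hasDerivAt_pi.1 ht i) j

end

theorem exists_isOpen_isFundamentalAt (hb : b ∉ S.poles) :
    ∃ X, ∃ U : Set ℂ, IsOpen U ∧ b ∈ U ∧ ∀ u ∈ U, S.IsFundamentalAt u X := by
  obtain ⟨X, hX, hXb⟩ := exists_isSolutionNear hb
  have hdet : ∀ᶠ u in 𝓝 b, (X u).det ≠ 0 := by
    have hcont : ContinuousAt (fun u => (X u).det) b :=
      (Continuous.matrix_det continuous_id).continuousAt.comp hX.continuousAt
    exact hcont.eventually_ne (by simp [hXb])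
  obtain ⟨U, hU, hUo, hbU⟩ := eventually_nhds_iff.1 ((eventually_eventually_nhds.2 hX).and hdet)
  exact ⟨X, U, hUo, hbU, hU⟩

/-- `Z` is the analytic continuation of a matrix solution along the part of the path `γ` that is
parametrized by `[0, c]`. -/
def IsContinuationUpTo (S : FuchsianSystem n) (γ : ℝ → ℂ) (c : ℝ)
    (Z : ℝ → Matrix (Fin n) (Fin n) ℂ) : Prop :=
  ∀ s ∈ Set.Icc 0 c, ∃ F, S.IsSolutionNear (γ s) F ∧ ∀ᶠ u in 𝓝[Set.Icc 0 c] s, Z u = F (γ u)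

variable {γ : ℝ → ℂ} {c d : ℝ} {Z : ℝ → Matrix (Fin n) (Fin n) ℂ}

theorem IsContinuationUpTo.extend (hZ : S.IsContinuationUpTo γ c Z) (h0c : 0 ≤ c) (hcd : c ≤ d)
    (hγ : ContinuousOn γ (Set.Icc 0 d)) (hc : γ c ∉ S.poles)
    (hX : ∀ s ∈ Set.Icc c d, S.IsFundamentalAt (γ s) X) :
    ∃ W, S.IsContinuationUpTo γ d W ∧ W 0 = Z 0 := by
  have hXc := hX c ⟨le_rfl, hcd⟩
  set C := (X (γ c))⁻¹ * Z c with hC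
  have hXC : X (γ c) * C = Z c := by
    rw [hC, ← mul_assoc, Matrix.mul_nonsing_inv _ (isUnit_iff_ne_zero.2 hXc.2), one_mul]
  refine ⟨fun s => if s ≤ c then Z s else X (γ s) * C, fun s hs => ?_, if_pos h0c⟩
  rcases lt_trichotomy s c with hsc | rfl | hsc
  · obtain ⟨G, hG, hGZ⟩ := hZ s ⟨hs.1, hsc.le⟩
    refine ⟨G, hG, ?_⟩
    rw [eventually_nhdsWithin_iff] at hGZ ⊢
    filter_upwards [hGZ, Iio_mem_nhds hsc] with u hu (huc : u < c) hud
    rw [if_pos huc.le]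
    exact hu ⟨hud.1, huc.le⟩
  · obtain ⟨G, hG, hGZ⟩ := hZ s ⟨hs.1, le_rfl⟩
    refine ⟨G, hG, ?_⟩
    have hZs : Z s = G (γ s) := hGZ.self_of_nhdsWithin ⟨hs.1, le_rfl⟩
    have hGX := (hγ s hs).eventually (hG.eventually_eq (hXc.1.mul_const C) hc (by rw [hXC, hZs]))
    rw [eventually_nhdsWithin_iff] at hGZ hGX ⊢
    filter_upwards [hGZ, hGX] with u hu hu' hud
    split_ifs with hus
    · exact hu ⟨hud.1, hus⟩
    · exact (hu' hud).symm
  · refine ⟨fun u => X u * C, (hX s ⟨hsc.le, hs.2⟩).1.mul_const C, mem_nhdsWithin_of_mem_nhds ?_⟩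
    filter_upwards [Ioi_mem_nhds hsc] with u hu
    exact if_neg (not_le.2 hu)

theorem exists_isContinuationAlong (hγ : ContinuousOn γ (Set.Icc 0 1))
    (hS : ∀ s ∈ Set.Icc (0 : ℝ) 1, γ s ∉ S.poles) :
    ∃ Z, S.IsContinuationAlong γ Z ∧ Z 0 = 1 := by
  choose X U hUo hmemU hXU using fun s : Set.Icc (0 : ℝ) 1 =>
    exists_isOpen_isFundamentalAt (hS s s.2)
  obtain ⟨τ, hτ0, hτmono, ⟨k, hk⟩, hτ⟩ := exists_monotone_Icc_subset_open_cover_unitInterval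
    (c := fun s => (Set.Icc (0 : ℝ) 1).domRestrict γ ⁻¹' U s)
    (fun s => (hUo s).preimage hγ.domRestrict) (fun s _ => Set.mem_iUnion.2 ⟨s, hmemU s⟩)
  have hcontinue : ∀ j : ℕ, ∃ Z, S.IsContinuationUpTo γ (τ j) Z ∧ Z 0 = 1 := by
    intro j
    induction j with
    | zero =>
      obtain ⟨G, hG, hG1⟩ := exists_isSolutionNear (hS 0 (by simp))
      refine ⟨fun s => G (γ s), fun s hs => ⟨G, ?_, .of_forall fun _ => rfl⟩, hG1⟩
      rw [hτ0] at hs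
      rwa [le_antisymm hs.2 hs.1]
    | succ j ih =>
      obtain ⟨Z, hZ, hZ0⟩ := ih
      obtain ⟨p, hp⟩ := hτ j
      obtain ⟨W, hW, hW0⟩ := hZ.extend (X := X p) (τ j).2.1 (hτmono (Nat.le_succ j))
        (hγ.mono (Set.Icc_subset_Icc le_rfl (τ (j + 1)).2.2)) (hS _ (τ j).2) fun s hs =>
          hXU p _ (hp (a := ⟨s, (τ j).2.1.trans hs.1, hs.2.trans (τ (j + 1)).2.2⟩) hs)
      exact ⟨W, hW, hW0.trans hZ0⟩
  obtain ⟨Z, hZ, hZ0⟩ := hcontinue k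
  rw [hk k le_rfl] at hZ
  exact ⟨Z, hZ, hZ0⟩

end FuchsianSystem

section Continuation

variable {ι κ : Type*} [Fintype ι] [Fintype κ] {R : ℂ →₀ Matrix ι ι ℂ} {R' : ℂ →₀ Matrix κ κ ℂ}
  {γ : ℝ → ℂ} {y : ℝ → ι → ℂ} {σ : Finset ℂ}

/-- `y` is the continuation of a vector solution along the path `γ : [0,1] → ℂ`. -/
def IsVecContinuation (R : ℂ →₀ Matrix ι ι ℂ) (γ : ℝ → ℂ) (y : ℝ → ι → ℂ) : Prop :=
  ∀ s ∈ Set.Icc (0 : ℝ) 1, ∃ F : ℂ → ι → ℂ,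
    IsVecSolution R (γ s) F ∧ ∀ᶠ u in 𝓝[Set.Icc (0 : ℝ) 1] s, y u = F (γ u)

theorem eq_of_eventually_eq_Icc {α : Type*} {f : ℝ → α}
    (h : ∀ s ∈ Set.Icc (0 : ℝ) 1, ∀ᶠ u in 𝓝[Set.Icc (0 : ℝ) 1] s, f u = f s) : f 1 = f 0 := by
  have hlc : IsLocallyConstant ((Set.Icc (0 : ℝ) 1).domRestrict f) := by
    rw [IsLocallyConstant.iff_eventually_eq]
    intro s
    have hs := h s s.2
    rwa [nhdsWithin_eq_map_subtype_coe s.2] at hs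
  exact hlc.apply_eq_of_isPreconnected isPreconnected_univ
    (x := ⟨1, by simp⟩) (y := ⟨0, by simp⟩) trivial trivial

theorem IsVecContinuation.eq_zero (hy : IsVecContinuation R γ y)
    (hγ : ContinuousOn γ (Set.Icc 0 1)) (hR : ∀ s ∈ Set.Icc (0 : ℝ) 1, γ s ∉ R.support)
    (h0 : y 0 = 0) : y 1 = 0 := by
  have hzero : (y 1 = 0) = (y 0 = 0) := eq_of_eventually_eq_Icc (f := (y · = 0)) fun s hs => by
    obtain ⟨F, hF, hFy⟩ := hy s hs
    have hys : y s = F (γ s) := hFy.self_of_nhdsWithin hs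
    by_cases hz : y s = 0
    · filter_upwards [hFy, (hγ s hs).eventually (hF.eventually_eq_zero (hR s hs) (hys ▸ hz))]
        with u hu hFu
      simp [hu, hFu, hz]
    · filter_upwards [hFy,
        (hF.continuousAt.comp_continuousWithinAt (hγ s hs)).eventually_ne (hys ▸ hz)] with u hu hFu
      simpa [hu, hz] using hFu
  exact hzero.mpr h0

theorem IsVecContinuation.map {T : (ι → ℂ) →ₗ[ℂ] (κ → ℂ)}
    (hT : ∀ a v, T (R a *ᵥ v) = R' a *ᵥ T v) (hy : IsVecContinuation R γ y) :
    IsVecContinuation R' γ fun s => T (y s) := fun s hs => by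
  obtain ⟨F, hF, hFy⟩ := hy s hs
  exact ⟨_, hF.map hT, hFy.mono fun u hu => congrArg T hu⟩

/-- The simple-loop spectral condition for vector solutions and loops avoiding `σ`. -/
def VecSpectralCondition (R : ℂ →₀ Matrix ι ι ℂ) (σ : Finset ℂ) : Prop :=
  ∀ γ : ℝ → ℂ, IsSimpleLoop γ → (∀ s ∈ Set.Icc (0 : ℝ) 1, γ s ∉ σ) →
    ∀ (μ : ℂ) (y : ℝ → ι → ℂ), IsVecContinuation R γ y → y 0 ≠ 0 → y 1 = μ • y 0 → ‖μ‖ = 1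

theorem VecSpectralCondition.norm_eq_one_of_map {T : (ι → ℂ) →ₗ[ℂ] (κ → ℂ)}
    (h : VecSpectralCondition R' σ) (hT : ∀ a v, T (R a *ᵥ v) = R' a *ᵥ T v)
    (hγ : IsSimpleLoop γ) (hσ : ∀ s ∈ Set.Icc (0 : ℝ) 1, γ s ∉ σ) (hy : IsVecContinuation R γ y)
    {μ : ℂ} (hy0 : T (y 0) ≠ 0) (hy1 : y 1 = μ • y 0) : ‖μ‖ = 1 :=
  h γ hγ hσ μ _ (hy.map hT) hy0 (by rw [hy1, map_smul])

theorem FuchsianSystem.SpectralCondition.vecSpectralCondition {n : ℕ} {S : FuchsianSystem n}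
    (h : S.SpectralCondition) : VecSpectralCondition S.residue S.poles := by
  intro γ hγ hS μ y hy hy0 hy1
  obtain ⟨Z, hZ, hZ0⟩ := FuchsianSystem.exists_isContinuationAlong hγ.1 hS
  refine h γ hγ hS (Z 1) ⟨Z, hZ, by simp [hZ0], by simp [hZ0]⟩ μ ?_
  have hdifference : IsVecContinuation S.residue γ fun s => Z s *ᵥ y 0 - y s := by
    intro s hs
    obtain ⟨F, hF, hFZ⟩ := hZ s hs
    obtain ⟨G, hG, hGy⟩ := hy s hs
    refine ⟨_, (hF.mulVec (y 0)).sub hG, ?_⟩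
    filter_upwards [hFZ, hGy] with u hu hu'
    simp [hu, hu']
  have hZ1 : Z 1 *ᵥ y 0 = μ • y 0 := by
    rw [← hy1, ← sub_eq_zero]
    exact hdifference.eq_zero hγ.1 hS (by simp [hZ0])
  rw [← Matrix.spectrum_toLin', ← Module.End.hasEigenvalue_iff_mem_spectrum]
  exact Module.End.hasEigenvalue_of_hasEigenvector
    (Module.End.hasEigenvector_iff.2 ⟨Module.End.mem_eigenspace_iff.2 (by simpa using hZ1), hy0⟩)

theorem VecSpectralCondition.spectralCondition {n : ℕ} {S : FuchsianSystem n}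
    (h : VecSpectralCondition S.residue S.poles) : S.SpectralCondition := by
  intro γ hγ hS M ⟨Z, hZ, hZ0, hZ1⟩ μ hμ
  rw [← Matrix.spectrum_toLin', ← Module.End.hasEigenvalue_iff_mem_spectrum] at hμ
  obtain ⟨v, hv⟩ := hμ.exists_hasEigenvector
  have hMv : M *ᵥ v = μ • v := by simpa using hv.apply_eq_smul
  refine h γ hγ hS μ (fun s => Z s *ᵥ v) (fun s hs => ?_) (fun h0 => ?_) ?_
  · obtain ⟨F, hF, hFZ⟩ := hZ s hs
    exact ⟨_, hF.mulVec v, hFZ.mono fun u hu => congrArg (· *ᵥ v) hu⟩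
  · exact hv.2 (Matrix.eq_zero_of_mulVec_eq_zero hZ0 h0)
  · simp only [hZ1]
    rw [← Matrix.mulVec_mulVec, hMv, Matrix.mulVec_smul]

end Continuation

section Domination

variable {ι κ ν : Type*} [Fintype ι] [Fintype κ] [Fintype ν] {R : ℂ →₀ Matrix ι ι ℂ}
  {R' : ℂ →₀ Matrix κ κ ℂ} {R'' : ℂ →₀ Matrix ν ν ℂ} {σ σ' σ'' : Finset ℂ} {φ φ' : ℂ → ℂ}

/-- The span of `1`, of the independent variable and of the components of the solutions near `b`. -/
def affineSolutionSpan (R : ℂ →₀ Matrix ι ι ℂ) (b : ℂ) : Submodule ℂ (ℂ → ℂ) :=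
  Submodule.span ℂ ({fun _ => 1, fun z => z} ∪
    {f | ∃ (x : ℂ → ι → ℂ) (i : ι), IsVecSolution R b x ∧ f = fun t => x t i})

theorem one_mem_affineSolutionSpan (R : ℂ →₀ Matrix ι ι ℂ) (b : ℂ) :
    (fun _ => 1) ∈ affineSolutionSpan R b :=
  Submodule.subset_span (by simp)

theorem id_mem_affineSolutionSpan (R : ℂ →₀ Matrix ι ι ℂ) (b : ℂ) :
    (fun z => z) ∈ affineSolutionSpan R b :=
  Submodule.subset_span (by simp)

theorem IsVecSolution.mem_affineSolutionSpan {b : ℂ} {x : ℂ → ι → ℂ} (hx : IsVecSolution R b x)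
    (i : ι) : (fun t => x t i) ∈ affineSolutionSpan R b :=
  Submodule.subset_span (.inr ⟨x, i, hx, rfl⟩)

/-- The system `R'` with singular set `σ'` dominates, through the map `φ`, the system `R` with
singular set `σ`: locally, solutions of `R` are ratios of affine combinations of solutions of `R'`
with a common denominator, and the spectral condition is inherited. -/
structure Dominates (φ : ℂ → ℂ) (R : ℂ →₀ Matrix ι ι ℂ) (σ : Finset ℂ)
    (R' : ℂ →₀ Matrix κ κ ℂ) (σ' : Finset ℂ) : Prop where
  avoid : ∀ a, φ a ∉ σ' → a ∉ σ
  cont : ∀ a, φ a ∉ σ' → ContinuousAt φ a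
  lift : ∀ a, φ a ∉ σ' → ∃ v : ℂ → ℂ, (∀ᶠ t in 𝓝 a, v t ≠ 0) ∧
    ∀ f ∈ affineSolutionSpan R a, ∃ F ∈ affineSolutionSpan R' (φ a),
      ∀ᶠ t in 𝓝 a, F (φ t) = v t * f t
  spec : VecSpectralCondition R σ → VecSpectralCondition R' σ'

theorem forall_mem_affineSolutionSpan {a : ℂ} {v : ℂ → ℂ}
    (hone : ∃ F ∈ affineSolutionSpan R' (φ a), ∀ᶠ t in 𝓝 a, F (φ t) = v t)
    (hid : ∃ F ∈ affineSolutionSpan R' (φ a), ∀ᶠ t in 𝓝 a, F (φ t) = v t * t)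
    (hsol : ∀ x, IsVecSolution R a x → ∀ i, ∃ F ∈ affineSolutionSpan R' (φ a),
      ∀ᶠ t in 𝓝 a, F (φ t) = v t * x t i) :
    ∀ f ∈ affineSolutionSpan R a, ∃ F ∈ affineSolutionSpan R' (φ a),
      ∀ᶠ t in 𝓝 a, F (φ t) = v t * f t := by
  intro f hf
  induction hf using Submodule.span_induction with
  | mem f hf =>
    obtain (rfl | rfl) | ⟨x, i, hx, rfl⟩ := hf
    · simpa using hone
    · exact hid
    · exact hsol x hx i
  | zero => exact ⟨0, zero_mem _, by simp⟩
  | add f g _ _ hf hg =>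
    obtain ⟨F, hF, hFf⟩ := hf
    obtain ⟨G, hG, hGg⟩ := hg
    refine ⟨F + G, add_mem hF hG, ?_⟩
    filter_upwards [hFf, hGg] with t htF htG
    rw [Pi.add_apply, Pi.add_apply, htF, htG, mul_add]
  | smul c f _ hf =>
    obtain ⟨F, hF, hFf⟩ := hf
    refine ⟨c • F, Submodule.smul_mem _ c hF, ?_⟩
    filter_upwards [hFf] with t ht
    rw [Pi.smul_apply, Pi.smul_apply, ht, mul_smul_comm]

theorem Dominates.trans (h : Dominates φ R σ R' σ') (h' : Dominates φ' R' σ' R'' σ'') :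
    Dominates (φ' ∘ φ) R σ R'' σ'' where
  avoid a ha := h.avoid a (h'.avoid _ ha)
  cont a ha := (h'.cont _ ha).comp (h.cont a (h'.avoid _ ha))
  lift a ha := by
    have ha' := h'.avoid _ ha
    obtain ⟨v, hv, hlift⟩ := h.lift a ha'
    obtain ⟨v', hv', hlift'⟩ := h'.lift _ ha
    refine ⟨fun t => v' (φ t) * v t, ?_, fun f hf => ?_⟩
    · filter_upwards [hv, (h.cont a ha').eventually hv'] with t ht ht'
      exact mul_ne_zero ht' ht
    · obtain ⟨F, hF, hFf⟩ := hlift f hf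
      obtain ⟨G, hG, hGF⟩ := hlift' F hF
      refine ⟨G, hG, ?_⟩
      filter_upwards [hFf, (h.cont a ha').eventually hGF] with t ht ht'
      rw [Function.comp_apply, ht', ht, mul_assoc]
  spec hR := h'.spec (h.spec hR)

theorem Dominates.refl (R : ℂ →₀ Matrix ι ι ℂ) (σ : Finset ℂ) : Dominates id R σ R σ where
  avoid _ ha := ha
  cont _ _ := continuousAt_id
  lift _ _ := ⟨fun _ => 1, by simp, fun f hf => ⟨f, hf, by simp⟩⟩
  spec h := h

theorem dominates_id_of_map {T : (ι → ℂ) →ₗ[ℂ] (κ → ℂ)} (hT : ∀ a v, T (R a *ᵥ v) = R' a *ᵥ T v)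
    (hcoord : ∀ i, ∃ k, ∀ v, T v k = v i)
    (hspec : VecSpectralCondition R σ → VecSpectralCondition R' σ) : Dominates id R σ R' σ where
  avoid _ ha := ha
  cont _ _ := continuousAt_id
  lift a _ := by
    refine ⟨fun _ => 1, by simp, forall_mem_affineSolutionSpan
      ⟨_, one_mem_affineSolutionSpan _ _, by simp⟩ ⟨_, id_mem_affineSolutionSpan _ _, by simp⟩
      fun x hx i => ?_⟩
    obtain ⟨k, hk⟩ := hcoord i
    exact ⟨_, (hx.map hT).mem_affineSolutionSpan k, by simp [hk]⟩
  spec := hspec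

theorem dominates_reindex (e : ι ≃ κ) (R : ℂ →₀ Matrix ι ι ℂ) (σ : Finset ℂ) :
    Dominates id R σ (R.mapRange (Matrix.reindexLinearEquiv ℂ ℂ e e) (map_zero _)) σ := by
  refine dominates_id_of_map (T := LinearMap.funLeft ℂ ℂ e.symm) (fun a v => ?_)
    (fun i => ⟨e i, fun v => by simp [LinearMap.funLeft_apply]⟩) fun h γ hγ hσ μ y hy hy0 hy1 => ?_
  · ext k
    simp [LinearMap.funLeft_apply, Matrix.mulVec, dotProduct, ← e.symm.sum_comp]
  · refine h.norm_eq_one_of_map (T := LinearMap.funLeft ℂ ℂ e) (fun a v => ?_) hγ hσ hy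
      (fun h0 => hy0 (funext fun k => ?_)) hy1
    · ext i
      simp [LinearMap.funLeft_apply, Matrix.mulVec, dotProduct, ← e.sum_comp]
    · simpa [LinearMap.funLeft_apply] using congr_fun h0 (e.symm k)

end Domination

section Conjugation

theorem IsSimpleLoop.comp {γ : ℝ → ℂ} (hγ : IsSimpleLoop γ) {f : ℂ → ℂ}
    (hf : ∀ s ∈ Set.Icc (0 : ℝ) 1, ContinuousAt f (γ s)) (hinj : Function.Injective f) :
    IsSimpleLoop (f ∘ γ) :=
  ⟨fun s hs => (hf s hs).comp_continuousWithinAt (hγ.1 s hs), congrArg f hγ.2.1,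
    hinj.comp_injOn hγ.2.2⟩

variable {ι : Type*} {R : ℂ →₀ Matrix ι ι ℂ} {σ : Finset ℂ}

/-- The residues of the system with complex conjugate residue matrices at the same points. -/
noncomputable def conjResidues (R : ℂ →₀ Matrix ι ι ℂ) : ℂ →₀ Matrix ι ι ℂ :=
  R.mapRange (fun M => M.map (starRingEnd ℂ)) (by ext; simp)

theorem polarPart_conj (hR : ∀ z ∈ R.support, z.im = 0) (t : ℂ) :
    polarPart R (starRingEnd ℂ t) = (polarPart (conjResidues R) t).map (starRingEnd ℂ) := by
  rw [polarPart_eq_sum subset_rfl,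
    polarPart_eq_sum (R := conjResidues R) Finsupp.support_mapRange]
  ext i j
  simp only [Matrix.sum_apply, Matrix.smul_apply, Matrix.map_apply, map_sum, smul_eq_mul, map_mul,
    map_inv₀, map_sub, conjResidues, Finsupp.mapRange_apply, Complex.conj_conj]
  refine Finset.sum_congr rfl fun a ha => ?_
  rw [Complex.conj_eq_iff_im.2 (hR a ha)]

variable [Fintype ι]

theorem IsVecSolution.conj {b : ℂ} {x : ℂ → ι → ℂ} (hR : ∀ z ∈ R.support, z.im = 0)
    (hx : IsVecSolution (conjResidues R) b x) :
    IsVecSolution R (starRingEnd ℂ b) fun t i => starRingEnd ℂ (x (starRingEnd ℂ t) i) := by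
  have hconj : Tendsto (starRingEnd ℂ) (𝓝 (starRingEnd ℂ b)) (𝓝 b) := by
    simpa using Complex.continuous_conj.tendsto (starRingEnd ℂ b)
  filter_upwards [hconj.eventually hx] with t ht
  rw [hasDerivAt_pi] at ht ⊢
  intro i
  have hxi := (ht i).conj_conj
  rw [Complex.conj_conj] at hxi
  refine hxi.congr_deriv ?_
  rw [← Complex.conj_conj t, polarPart_conj hR, Complex.conj_conj]
  simp [Matrix.mulVec, dotProduct]

theorem VecSpectralCondition.conj (h : VecSpectralCondition R σ)
    (hR : ∀ z ∈ R.support, z.im = 0) (hσ : ∀ z ∈ σ, z.im = 0) :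
    VecSpectralCondition (conjResidues R) σ := by
  intro γ hγ hγσ μ y hy hy0 hy1
  have hloop : IsSimpleLoop (starRingEnd ℂ ∘ γ) :=
    hγ.comp (fun _ _ => Complex.continuous_conj.continuousAt) (starRingEnd ℂ).injective
  have hμ : ‖starRingEnd ℂ μ‖ = 1 := by
    refine h _ hloop (fun s hs hmem => hγσ s hs ?_) (starRingEnd ℂ μ)
      (fun s i => starRingEnd ℂ (y s i)) (fun s hs => ?_) (fun h0 => hy0 ?_) ?_
    · rwa [← Complex.conj_eq_iff_im.2 (hσ _ hmem), Function.comp_apply, Complex.conj_conj] at hmem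
    · obtain ⟨F, hF, hFy⟩ := hy s hs
      exact ⟨_, hF.conj hR, hFy.mono fun u hu => by simp [hu]⟩
    · exact funext fun i => by simpa using congr_fun h0 i
    · exact funext fun i => by simp [hy1]
  simpa using hμ

end Conjugation

section Realification

variable {ι : Type*}

/-- The realification `[[Re, -Im], [Im, Re]]` of a complex matrix. -/
def realify (M : Matrix ι ι ℂ) : Matrix (ι ⊕ ι) (ι ⊕ ι) ℂ :=
  .fromBlocks (M.map fun z => (z.re : ℂ)) (-M.map fun z => (z.im : ℂ))
    (M.map fun z => (z.im : ℂ)) (M.map fun z => (z.re : ℂ))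

/-- The residues of the realification of a system. -/
noncomputable def realification (R : ℂ →₀ Matrix ι ι ℂ) : ℂ →₀ Matrix (ι ⊕ ι) (ι ⊕ ι) ℂ :=
  R.mapRange realify (by ext (i | i) (j | j) <;> simp [realify])

theorem im_realification (R : ℂ →₀ Matrix ι ι ℂ) (z : ℂ) (i j : ι ⊕ ι) :
    (realification R z i j).im = 0 := by
  rcases i with _ | _ <;> rcases j with _ | _ <;> simp [realification, realify]

theorem norm_realification_le {R : ℂ →₀ Matrix ι ι ℂ} {C : ℝ} (hC : ∀ z i j, ‖R z i j‖ ≤ C)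
    (z : ℂ) (i j : ι ⊕ ι) : ‖realification R z i j‖ ≤ C := by
  have hre : ∀ i j, |(R z i j).re| ≤ C := fun i j => (Complex.abs_re_le_norm _).trans (hC z i j)
  have him : ∀ i j, |(R z i j).im| ≤ C := fun i j => (Complex.abs_im_le_norm _).trans (hC z i j)
  rcases i with i | i <;> rcases j with j | j <;> simp [realification, realify, hre, him]

theorem realify_injective : Function.Injective (realify (ι := ι)) := by
  intro M N h
  ext i j
  have hre := congr_fun₂ h (Sum.inl i) (Sum.inl j)
  have him := congr_fun₂ h (Sum.inr i) (Sum.inl j)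
  simp only [realify, Matrix.fromBlocks_apply₁₁, Matrix.fromBlocks_apply₂₁, Matrix.map_apply,
    Complex.ofReal_inj] at hre him
  exact Complex.ext hre him

theorem support_realification (R : ℂ →₀ Matrix ι ι ℂ) :
    (realification R).support = R.support :=
  Finsupp.support_mapRange_of_injective _ _ realify_injective

theorem realify_sum {α : Type*} (s : Finset α) (M : α → Matrix ι ι ℂ) :
    realify (∑ a ∈ s, M a) = ∑ a ∈ s, realify (M a) := by
  ext (i | i) (j | j) <;> simp [Matrix.sum_apply, realify]

theorem sum_realification {R : ℂ →₀ Matrix ι ι ℂ} (h : ∑ a ∈ R.support, R a = 0) :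
    ∑ a ∈ (realification R).support, realification R a = 0 := by
  rw [support_realification]
  simp only [realification, Finsupp.mapRange_apply, ← realify_sum, h]
  ext (i | i) (j | j) <;> simp [realify]

variable [Fintype ι]

theorem sumElim_mulVec (M : Matrix ι ι ℂ) (v : ι → ℂ) :
    Sum.elim (M *ᵥ v) (-Complex.I • M *ᵥ v) = realify M *ᵥ Sum.elim v (-Complex.I • v) := by
  rw [realify, Matrix.fromBlocks_mulVec]
  ext (i | i) <;>
    simp only [Sum.elim_inl, Sum.elim_inr, Sum.elim_comp_inl, Sum.elim_comp_inr, Matrix.mulVec,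
      dotProduct, Pi.add_apply, Pi.smul_apply, smul_eq_mul, Matrix.map_apply, Matrix.neg_apply,
      Finset.mul_sum, ← Finset.sum_add_distrib] <;>
    refine Finset.sum_congr rfl fun j _ => ?_
  · linear_combination -v j * Complex.re_add_im (M i j)
  · linear_combination Complex.I * v j * Complex.re_add_im (M i j) -
      v j * (M i j).im * Complex.I_sq

theorem realify_mulVec_add (M : Matrix ι ι ℂ) (w : ι ⊕ ι → ℂ) (i : ι) :
    (realify M *ᵥ w) (.inl i) + Complex.I * (realify M *ᵥ w) (.inr i) =
      (M *ᵥ fun j => w (.inl j) + Complex.I * w (.inr j)) i := by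
  simp only [realify, Matrix.fromBlocks_mulVec, Sum.elim_inl, Sum.elim_inr, Pi.add_apply]
  simp only [Matrix.mulVec, dotProduct, Matrix.map_apply, Matrix.neg_apply, Function.comp_apply,
    Finset.mul_sum, ← Finset.sum_add_distrib]
  refine Finset.sum_congr rfl fun j _ => ?_
  linear_combination (w (.inl j) + Complex.I * w (.inr j)) * Complex.re_add_im (M i j) -
    (M i j).im * w (.inr j) * Complex.I_sq

theorem realify_mulVec_sub (M : Matrix ι ι ℂ) (w : ι ⊕ ι → ℂ) (i : ι) :
    (realify M *ᵥ w) (.inl i) - Complex.I * (realify M *ᵥ w) (.inr i) =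
      (M.map (starRingEnd ℂ) *ᵥ fun j => w (.inl j) - Complex.I * w (.inr j)) i := by
  simp only [realify, Matrix.fromBlocks_mulVec, Sum.elim_inl, Sum.elim_inr, Pi.add_apply]
  simp only [Matrix.mulVec, dotProduct, Matrix.map_apply, Matrix.neg_apply, Function.comp_apply,
    Finset.mul_sum, ← Finset.sum_add_distrib, ← Finset.sum_sub_distrib]
  refine Finset.sum_congr rfl fun j _ => ?_
  have hconj : starRingEnd ℂ (M i j) = (M i j).re - (M i j).im * Complex.I := by
    simp [Complex.ext_iff]
  rw [hconj]
  linear_combination -(M i j).im * w (.inr j) * Complex.I_sq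

variable {R : ℂ →₀ Matrix ι ι ℂ} {σ : Finset ℂ}

/- Over `ℂ` the realification of `R` is the direct sum of `R` and its conjugate, so its spectrum is
controlled by the projections `(v, w) ↦ v ± i w`. -/
theorem VecSpectralCondition.realification (h : VecSpectralCondition R σ)
    (hR : ∀ z ∈ R.support, z.im = 0) (hσ : ∀ z ∈ σ, z.im = 0) :
    VecSpectralCondition (realification R) σ := by
  intro γ hγ hγσ μ y hy hy0 hy1
  by_cases hplus : (fun i => y 0 (.inl i) + Complex.I * y 0 (.inr i)) = 0
  · refine (h.conj hR hσ).norm_eq_one_of_map (T := LinearMap.funLeft ℂ ℂ Sum.inl -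
      Complex.I • LinearMap.funLeft ℂ ℂ Sum.inr) (fun a v => funext (realify_mulVec_sub (R a) v))
      hγ hγσ hy (fun hminus => hy0 ?_) hy1
    have hp (i : ι) : y 0 (.inl i) + Complex.I * y 0 (.inr i) = 0 := congr_fun hplus i
    have hm (i : ι) : y 0 (.inl i) - Complex.I * y 0 (.inr i) = 0 := congr_fun hminus i
    refine funext (Sum.rec (fun i => ?_) fun i => ?_) <;> rw [Pi.zero_apply]
    · linear_combination (hp i + hm i) / 2
    · linear_combination -Complex.I * (hp i - hm i) / 2 + y 0 (.inr i) * Complex.I_sq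
  · exact h.norm_eq_one_of_map (T := LinearMap.funLeft ℂ ℂ Sum.inl +
      Complex.I • LinearMap.funLeft ℂ ℂ Sum.inr) (fun a v => funext (realify_mulVec_add (R a) v))
      hγ hγσ hy hplus hy1

theorem dominates_realification (hR : ∀ z ∈ R.support, z.im = 0) (hσ : ∀ z ∈ σ, z.im = 0) :
    Dominates id R σ (realification R) σ := by
  refine dominates_id_of_map (T :=
    { toFun := fun v => Sum.elim v (-Complex.I • v)
      map_add' := fun v w => by rw [smul_add, Sum.elim_add_add]
      map_smul' := fun c v => by ext (i | i) <;> simp [mul_left_comm] })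
    (fun a v => sumElim_mulVec (R a) v) (fun i => ⟨.inl i, fun _ => rfl⟩) fun h => ?_
  exact h.realification hR hσ

end Realification

section Multipliers

theorem hasDerivAt_prod_ratio {𝕜 κ : Type*} [NontriviallyNormedField 𝕜] (s : Finset κ)
    {a b : κ → 𝕜} {z : 𝕜} (ha : ∀ k ∈ s, z ≠ a k) (hb : ∀ k ∈ s, z ≠ b k) :
    HasDerivAt (fun z => ∏ k ∈ s, (z - a k) / (z - b k))
      ((∑ k ∈ s, ((z - a k)⁻¹ - (z - b k)⁻¹)) * ∏ k ∈ s, (z - a k) / (z - b k)) z := by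
  classical
  induction s using Finset.induction_on with
  | empty => simpa using hasDerivAt_const z (1 : 𝕜)
  | insert k s hk ih =>
    have hak : z - a k ≠ 0 := sub_ne_zero.2 (ha k (by simp))
    have hbk : z - b k ≠ 0 := sub_ne_zero.2 (hb k (by simp))
    have hprod := ih (fun j hj => ha j (by simp [hj])) fun j hj => hb j (by simp [hj])
    have hratio := ((hasDerivAt_id z).sub_const (a k)).div ((hasDerivAt_id z).sub_const (b k)) hbk
    simp only [Finset.prod_insert hk, Finset.sum_insert hk]
    refine (hratio.mul hprod).congr_deriv ?_
    simp only [id, Pi.div_apply]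
    field_simp

theorem hasDerivAt_mul_inv_eq_zero {𝕜 : Type*} [NontriviallyNormedField 𝕜] {f g : 𝕜 → 𝕜} {l z : 𝕜}
    (hf : HasDerivAt f (l * f z) z) (hg : HasDerivAt g (l * g z) z) (hz : g z ≠ 0) :
    HasDerivAt (fun t => f t * (g t)⁻¹) 0 z := by
  refine (hf.mul (hg.inv hz)).congr_deriv ?_
  simp only [Pi.inv_apply]
  field_simp
  ring

variable {ι : Type*} [Fintype ι]

theorem IsVecContinuation.norm_multiplier_eq_one {R : ℂ →₀ Matrix ι ι ℂ} {γ : ℝ → ℂ}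
    {y : ℝ → ι → ℂ} (hy : IsVecContinuation R γ y) (hγ : IsSimpleLoop γ) (G : ℂ → ℂ) (i : ι)
    {k : ℕ} (hk : k ≠ 0) (hG : G (γ 0) ≠ 0)
    (hF : ∀ s ∈ Set.Icc (0 : ℝ) 1, ∀ F, IsVecSolution R (γ s) F →
      ∀ᶠ t in 𝓝 (γ s), HasDerivAt (fun t => F t i ^ k * G t) 0 t)
    {μ : ℂ} (hy0 : y 0 i ≠ 0) (hy1 : y 1 = μ • y 0) : ‖μ‖ = 1 := by
  have hloop : y 1 i ^ k * G (γ 1) = y 0 i ^ k * G (γ 0) :=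
    eq_of_eventually_eq_Icc (f := fun s => y s i ^ k * G (γ s)) fun s hs => by
      obtain ⟨F, hFs, hFy⟩ := hy s hs
      have hconst : ∀ᶠ t in 𝓝 (γ s), F t i ^ k * G t - F (γ s) i ^ k * G (γ s) = 0 :=
        eventually_eq_zero_of_norm_deriv_le (K := 0)
          ((hF s hs F hFs).mono fun t ht => ht.sub_const _) (.of_forall fun t => by simp)
          (sub_self _)
      have hys : y s = F (γ s) := hFy.self_of_nhdsWithin hs
      filter_upwards [hFy, (hγ.1 s hs).eventually hconst] with u hu hFu
      rw [hu, hys, ← sub_eq_zero]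
      exact hFu
  have hmul : μ ^ k * (y 0 i ^ k * G (γ 0)) = 1 * (y 0 i ^ k * G (γ 0)) := by
    rw [← hγ.2.1, hy1, Pi.smul_apply, smul_eq_mul] at hloop
    rw [one_mul, ← mul_assoc, ← mul_pow, hloop]
  exact Complex.norm_eq_one_of_pow_eq_one
    (mul_right_cancel₀ (mul_ne_zero (pow_ne_zero k hy0) hG) hmul) hk

end Multipliers

section Mobius

variable {ι : Type*}

theorem norm_single_sub_single_apply_le {a a' : ℂ} {M : Matrix ι ι ℂ} {K : ℝ} {i j : ι}
    (hM : ‖M i j‖ ≤ K) (z : ℂ) :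
    ‖(Finsupp.single a M - Finsupp.single a' M) z i j‖ ≤ 2 * K := by
  have hsingle (a : ℂ) : ‖Finsupp.single a M z i j‖ ≤ K := by
    classical
    rw [Finsupp.single_apply]
    split_ifs
    · exact hM
    · simpa using (norm_nonneg _).trans hM
  calc ‖(Finsupp.single a M - Finsupp.single a' M) z i j‖
      ≤ ‖Finsupp.single a M z i j‖ + ‖Finsupp.single a' M z i j‖ := norm_sub_le _ _
    _ ≤ 2 * K := by linarith [hsingle a, hsingle a']

theorem inv_sub_inv_sub_inv {w u : ℂ} (hw : w ≠ 0) (hu : u ≠ 0) (h : w⁻¹ ≠ u) :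
    (w - u⁻¹)⁻¹ - w⁻¹ = -(w ^ 2)⁻¹ * (w⁻¹ - u)⁻¹ := by
  have hd : 1 - w * u ≠ 0 := fun h0 => h (by field_simp; linear_combination h0)
  have hwu : w - u⁻¹ = -(1 - w * u) / u := by field_simp; ring
  have huw : w⁻¹ - u = (1 - w * u) / w := by field_simp
  rw [hwu, huw]
  field_simp
  ring

/-- The embedding of the matrices into the lower right block. -/
def lowerBlock (ι : Type*) : Matrix ι ι ℂ →ₗ[ℂ] Matrix (Bool ⊕ ι) (Bool ⊕ ι) ℂ where
  toFun M := .fromBlocks 0 0 0 M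
  map_add' M N := by simp [Matrix.fromBlocks_add]
  map_smul' c M := by simp [Matrix.fromBlocks_smul]

theorem lowerBlock_mulVec [Fintype ι] (M : Matrix ι ι ℂ) (y : Bool ⊕ ι → ℂ) :
    lowerBlock ι M *ᵥ y = Sum.elim (0 : Bool → ℂ) (M *ᵥ (y ∘ .inr)) := by
  change Matrix.fromBlocks 0 0 0 M *ᵥ y = _
  simp [Matrix.fromBlocks_mulVec]

/-- The projector to the coordinate `true` of the upper left block. -/
def trueProj (ι : Type*) : Matrix (Bool ⊕ ι) (Bool ⊕ ι) ℂ :=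
  .fromBlocks (.diagonal fun b => if b then 1 else 0) 0 0 0

theorem trueProj_mulVec [Fintype ι] (y : Bool ⊕ ι → ℂ) :
    trueProj ι *ᵥ y = Sum.elim (fun b => if b then y (.inl b) else 0) (0 : ι → ℂ) := by
  ext (b | i)
  · simp [trueProj, Matrix.fromBlocks_mulVec, Matrix.mulVec_diagonal]
  · simp [trueProj, Matrix.fromBlocks_mulVec]

/-- The points, other than the auxiliary one, that are singular after the Möbius map
`w = (z - c)⁻¹`. -/
noncomputable def mobiusPoints (σ : Finset ℂ) (c : ℂ) : Finset ℂ :=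
  insert 0 (σ.image fun p => (p - c)⁻¹)

variable {σ : Finset ℂ} {c e w : ℂ}

theorem zero_mem_mobiusPoints : 0 ∈ mobiusPoints σ c := Finset.mem_insert_self _ _

theorem inv_sub_mem_mobiusPoints {p : ℂ} (hp : p ∈ σ) : (p - c)⁻¹ ∈ mobiusPoints σ c :=
  Finset.mem_insert_of_mem (Finset.mem_image_of_mem _ hp)

theorem card_mobiusPoints_le (σ : Finset ℂ) (c : ℂ) : (mobiusPoints σ c).card ≤ σ.card + 1 :=
  (Finset.card_insert_le _ _).trans (Nat.succ_le_succ Finset.card_image_le)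

theorem ne_zero_of_notMem_insert (hw : w ∉ insert e (mobiusPoints σ c)) : w ≠ 0 := fun h =>
  hw (h ▸ Finset.mem_insert_of_mem zero_mem_mobiusPoints)

theorem sub_ne_zero_of_notMem_insert (hw : w ∉ insert e (mobiusPoints σ c)) : w - e ≠ 0 :=
  sub_ne_zero.2 fun h => hw (h ▸ Finset.mem_insert_self _ _)

theorem eventually_notMem_finset {s : Finset ℂ} (hw : w ∉ s) : ∀ᶠ u in 𝓝 w, u ∉ s :=
  (Finset.isClosed s).isOpen_compl.eventually_mem hw

/-- The product of `(w - p) / (w - e)` over the points `p` of `mobiusPoints σ c`. -/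
noncomputable def mobiusFactor (σ : Finset ℂ) (c e w : ℂ) : ℂ :=
  ∏ p ∈ mobiusPoints σ c, (w - p) / (w - e)

theorem mobiusFactor_ne_zero (hw : w ∉ insert e (mobiusPoints σ c)) : mobiusFactor σ c e w ≠ 0 :=
  Finset.prod_ne_zero_iff.2 fun p hp => div_ne_zero
    (sub_ne_zero.2 fun h => hw (by simp [h, hp])) (sub_ne_zero_of_notMem_insert hw)

theorem hasDerivAt_mobiusFactor (hw : w ∉ insert e (mobiusPoints σ c)) :
    HasDerivAt (mobiusFactor σ c e)
      ((∑ p ∈ mobiusPoints σ c, ((w - p)⁻¹ - (w - e)⁻¹)) * mobiusFactor σ c e w) w :=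
  hasDerivAt_prod_ratio _ (fun p hp h => hw (by simp [h, hp]))
    fun _ _ => sub_ne_zero.1 (sub_ne_zero_of_notMem_insert hw)

theorem hasDerivAt_mobiusFactor_mul (hw : w ∉ insert e (mobiusPoints σ c)) :
    HasDerivAt (fun w => mobiusFactor σ c e w * ((w - e) / w))
      ((∑ p ∈ mobiusPoints σ c, ((w - p)⁻¹ - (w - e)⁻¹) + ((w - e)⁻¹ - w⁻¹)) *
        (mobiusFactor σ c e w * ((w - e) / w))) w := by
  have hw0 := ne_zero_of_notMem_insert hw
  have hwe := sub_ne_zero_of_notMem_insert hw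
  refine ((hasDerivAt_mobiusFactor hw).mul
    (((hasDerivAt_id w).sub_const e).div (hasDerivAt_id w) hw0)).congr_deriv ?_
  simp only [id, Pi.div_apply]
  field_simp

variable [DecidableEq ι] {R : ℂ →₀ Matrix ι ι ℂ}

/-- The residues of the system for `q (w) • (1, (w - e) / w, x)`, where `w = (z - c)⁻¹` and `q` is
the product of `(w - p) / (w - e)` over `mobiusPoints σ c`. The two scalar components make `1` and
`z` ratios of solutions; the factor `q` makes each of these points singular. -/
noncomputable def mobiusSystem (R : ℂ →₀ Matrix ι ι ℂ) (σ : Finset ℂ) (c e : ℂ) :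
    ℂ →₀ Matrix (Bool ⊕ ι) (Bool ⊕ ι) ℂ :=
  ∑ p ∈ σ, (Finsupp.single (p - c)⁻¹ (lowerBlock ι (R p)) - Finsupp.single 0 (lowerBlock ι (R p))) +
    ∑ p ∈ mobiusPoints σ c, (Finsupp.single p 1 - Finsupp.single e 1) +
    (Finsupp.single e (trueProj ι) - Finsupp.single 0 (trueProj ι))

theorem mobiusSystem_apply_false (R : ℂ →₀ Matrix ι ι ℂ) (σ : Finset ℂ) (c e z : ℂ) :
    mobiusSystem R σ c e z (.inl false) (.inl false) =
      (if z ∈ mobiusPoints σ c then 1 else 0) -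
        if z = e then ((mobiusPoints σ c).card : ℂ) else 0 := by
  have hsingle (a : ℂ) (M : Matrix (Bool ⊕ ι) (Bool ⊕ ι) ℂ) :
      Finsupp.single a M z (.inl false) (.inl false) =
        if z = a then M (.inl false) (.inl false) else 0 := by
    rw [Finsupp.single_apply]
    split_ifs <;> simp_all
  simp only [mobiusSystem, Finsupp.add_apply, Matrix.add_apply, Finsupp.finsetSum_apply,
    Matrix.sum_apply, Finsupp.sub_apply, Matrix.sub_apply, hsingle]
  simp [lowerBlock, trueProj, Finset.sum_sub_distrib, Finset.sum_ite_eq]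

theorem mobiusSystem_apply_eq_zero {z : ℂ} (hz : z ∉ insert e (mobiusPoints σ c)) :
    mobiusSystem R σ c e z = 0 := by
  rw [Finset.mem_insert, not_or] at hz
  have hsingle {a : ℂ} (ha : a ≠ z) (M : Matrix (Bool ⊕ ι) (Bool ⊕ ι) ℂ) :
      Finsupp.single a M z = 0 := Finsupp.single_eq_of_ne ha.symm
  have hne {p : ℂ} (hp : p ∈ mobiusPoints σ c) : p ≠ z := fun h => hz.2 (h ▸ hp)
  have h0 : (0 : ℂ) ≠ z := hne zero_mem_mobiusPoints
  simp only [mobiusSystem, Finsupp.add_apply, Finsupp.finsetSum_apply, Finsupp.sub_apply]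
  rw [Finset.sum_eq_zero fun p hp => ?_, Finset.sum_eq_zero fun p hp => ?_, hsingle (Ne.symm hz.1),
    hsingle h0]
  · simp
  · rw [hsingle (hne hp), hsingle (Ne.symm hz.1), sub_zero]
  · rw [hsingle (hne (inv_sub_mem_mobiusPoints hp)), hsingle h0, sub_zero]

theorem support_mobiusSystem (he : e ∉ mobiusPoints σ c) :
    (mobiusSystem R σ c e).support = insert e (mobiusPoints σ c) := by
  ext z
  rw [Finsupp.mem_support_iff]
  refine ⟨fun hz => by_contra fun h => hz (mobiusSystem_apply_eq_zero h), fun hz h0 => ?_⟩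
  have h := mobiusSystem_apply_false R σ c e z
  rw [h0, Matrix.zero_apply] at h
  rcases Finset.mem_insert.1 hz with rfl | hz
  · simp [he, Finset.ne_empty_of_mem zero_mem_mobiusPoints] at h
  · simp [hz, show z ≠ e from fun h' => he (h' ▸ hz)] at h

theorem card_support_mobiusSystem_le (he : e ∉ mobiusPoints σ c) :
    (mobiusSystem R σ c e).support.card ≤ σ.card + 2 := by
  rw [support_mobiusSystem he]
  exact (Finset.card_insert_le _ _).trans (Nat.succ_le_succ (card_mobiusPoints_le σ c))

theorem sum_mobiusSystem (R : ℂ →₀ Matrix ι ι ℂ) (σ : Finset ℂ) (c e : ℂ) :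
    ∑ a ∈ (mobiusSystem R σ c e).support, mobiusSystem R σ c e a = 0 := by
  change Finsupp.liftAddHom (fun _ => AddMonoidHom.id _) (mobiusSystem R σ c e) = 0
  simp only [mobiusSystem, map_add, map_sum, map_sub, Finsupp.liftAddHom_apply_single, sub_self,
    Finset.sum_const_zero, add_zero]

theorem norm_mobiusSystem_le (σ : Finset ℂ) (c e : ℂ) {C : ℝ} (hC : ∀ z i j, ‖R z i j‖ ≤ C)
    (hC0 : 0 ≤ C) (z : ℂ) (i j : Bool ⊕ ι) :
    ‖mobiusSystem R σ c e z i j‖ ≤ σ.card * (2 * C) + (σ.card + 1) * 2 + 2 := by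
  have hblock (p : ℂ) : ‖lowerBlock ι (R p) i j‖ ≤ C := by
    rcases i with i | i <;> rcases j with j | j <;> simp [lowerBlock, hC, hC0]
  have hone : ‖(1 : Matrix (Bool ⊕ ι) (Bool ⊕ ι) ℂ) i j‖ ≤ 1 := by
    rw [Matrix.one_apply]
    split_ifs <;> simp
  have hproj : ‖trueProj ι i j‖ ≤ 1 := by
    rcases i with (_ | _) | i <;> rcases j with (_ | _) | j <;> simp [trueProj]
  have hcard : ((mobiusPoints σ c).card : ℝ) ≤ σ.card + 1 := mod_cast card_mobiusPoints_le σ c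
  simp only [mobiusSystem, Finsupp.add_apply, Matrix.add_apply, Finsupp.finsetSum_apply,
    Matrix.sum_apply]
  refine norm_add₃_le.trans (add_le_add_three ?_ ?_ ?_)
  · rw [← nsmul_eq_mul]
    refine (norm_sum_le _ _).trans (Finset.sum_le_card_nsmul _ _ _ fun p _ => ?_)
    exact norm_single_sub_single_apply_le (hblock p) z
  · refine le_trans ?_ (mul_le_mul_of_nonneg_right hcard zero_le_two)
    rw [← nsmul_eq_mul, ← mul_one (2 : ℝ)]
    refine (norm_sum_le _ _).trans (Finset.sum_le_card_nsmul _ _ _ fun p _ => ?_)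
    exact norm_single_sub_single_apply_le hone z
  · simpa using norm_single_sub_single_apply_le hproj z

theorem polarPart_mobiusSystem (hR : R.support ⊆ σ) (hc : c ∉ σ) (hw : w ∉ mobiusPoints σ c) :
    polarPart (mobiusSystem R σ c e) w =
      lowerBlock ι (-(w ^ 2)⁻¹ • polarPart R (c + w⁻¹)) +
      (∑ p ∈ mobiusPoints σ c, ((w - p)⁻¹ - (w - e)⁻¹)) • 1 +
      ((w - e)⁻¹ - w⁻¹) • trueProj ι := by
  simp only [mobiusSystem, map_add, map_sum, map_sub, Pi.add_apply, Finset.sum_apply, Pi.sub_apply,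
    polarPart_single, polarPart_eq_sum hR, Finset.smul_sum, Finset.sum_smul, sub_zero, sub_smul]
  congr 2
  refine Finset.sum_congr rfl fun p hp => ?_
  have hw0 : w ≠ 0 := fun h => hw (h ▸ zero_mem_mobiusPoints)
  have hpw : w⁻¹ ≠ p - c := fun h => hw (by
    rw [← inv_inv w, h]
    exact inv_sub_mem_mobiusPoints hp)
  have hpc : p - c ≠ 0 := sub_ne_zero.2 fun h => hc (h.symm ▸ hp)
  rw [← sub_smul, inv_sub_inv_sub_inv hw0 hpc hpw, smul_smul, map_smul]
  congr 3
  ring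

variable [Fintype ι]

theorem polarPart_mobiusSystem_mulVec (hR : R.support ⊆ σ) (hc : c ∉ σ)
    (hw : w ∉ mobiusPoints σ c) (y : Bool ⊕ ι → ℂ) :
    polarPart (mobiusSystem R σ c e) w *ᵥ y = Sum.elim
      (fun b => (∑ p ∈ mobiusPoints σ c, ((w - p)⁻¹ - (w - e)⁻¹)) * y (.inl b) +
        (if b then ((w - e)⁻¹ - w⁻¹) * y (.inl b) else 0))
      (fun i => (∑ p ∈ mobiusPoints σ c, ((w - p)⁻¹ - (w - e)⁻¹)) * y (.inr i) -
        (w ^ 2)⁻¹ * (polarPart R (c + w⁻¹) *ᵥ (y ∘ .inr)) i) := by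
  rw [polarPart_mobiusSystem hR hc hw, Matrix.add_mulVec, Matrix.add_mulVec, Matrix.smul_mulVec,
    Matrix.smul_mulVec, Matrix.one_mulVec, lowerBlock_mulVec, trueProj_mulVec, Matrix.smul_mulVec]
  ext (b | i)
  · simp
  · simp only [Pi.add_apply, Sum.elim_inr, Pi.smul_apply, smul_eq_mul, Pi.zero_apply]
    ring

end Mobius

section Mobius

variable {ι : Type*} [DecidableEq ι] [Fintype ι] {R : ℂ →₀ Matrix ι ι ℂ} {σ : Finset ℂ}
  {c e w₀ : ℂ} {F : ℂ → Bool ⊕ ι → ℂ} {γ : ℝ → ℂ} {y : ℝ → Bool ⊕ ι → ℂ}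

theorem IsVecSolution.mobiusSystem (hR : R.support ⊆ σ) (hc : c ∉ σ)
    (hw₀ : w₀ ∉ insert e (mobiusPoints σ c)) {x : ℂ → ι → ℂ}
    (hx : IsVecSolution R (c + w₀⁻¹) x) (α β : ℂ) :
    IsVecSolution (mobiusSystem R σ c e) w₀ fun w => Sum.elim
      (fun b => if b then β * (mobiusFactor σ c e w * ((w - e) / w)) else α * mobiusFactor σ c e w)
      (mobiusFactor σ c e w • x (c + w⁻¹)) := by
  have hback : Tendsto (fun w : ℂ => c + w⁻¹) (𝓝 w₀) (𝓝 (c + w₀⁻¹)) :=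
    continuousAt_const.add (continuousAt_id.inv₀ (ne_zero_of_notMem_insert hw₀))
  filter_upwards [eventually_notMem_finset hw₀, hback.eventually hx] with w hw hxw
  have hq := hasDerivAt_mobiusFactor hw
  rw [polarPart_mobiusSystem_mulVec hR hc fun h => hw (Finset.mem_insert_of_mem h)]
  rw [hasDerivAt_pi]
  rintro ((_ | _) | i)
  · simp only [Sum.elim_inl, Bool.false_eq_true, if_false, add_zero]
    exact (hq.const_mul α).congr_deriv (by ring)
  · simp only [Sum.elim_inl, if_true]
    exact ((hasDerivAt_mobiusFactor_mul hw).const_mul β).congr_deriv (by ring)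
  · have hpull : HasDerivAt (fun w => x (c + w⁻¹) i) _ w :=
      (hasDerivAt_pi.1 hxw i).comp (h₂ := fun u => x u i) w
        ((hasDerivAt_inv (ne_zero_of_notMem_insert hw)).const_add c)
    refine (hq.mul hpull).congr_deriv ?_
    rw [Sum.elim_inr, Sum.elim_inr, Sum.elim_comp_inr, Matrix.mulVec_smul, Pi.smul_apply,
      Pi.smul_apply, smul_eq_mul, smul_eq_mul]
    ring

theorem IsVecSolution.of_mobiusSystem (hR : R.support ⊆ σ) (hc : c ∉ σ)
    (hw₀ : w₀ ∉ insert e (mobiusPoints σ c))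
    (hF : IsVecSolution (_root_.mobiusSystem R σ c e) w₀ F) :
    IsVecSolution R (c + w₀⁻¹)
      fun t => (mobiusFactor σ c e (t - c)⁻¹)⁻¹ • (F (t - c)⁻¹ ∘ .inr) := by
  have hback : Tendsto (fun t : ℂ => (t - c)⁻¹) (𝓝 (c + w₀⁻¹)) (𝓝 w₀) := by
    have hcont : ContinuousAt (fun t : ℂ => (t - c)⁻¹) (c + w₀⁻¹) :=
      (continuousAt_id.sub continuousAt_const).inv₀ (by simpa using ne_zero_of_notMem_insert hw₀)
    simpa [ContinuousAt] using hcont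
  filter_upwards [hback.eventually hF, hback.eventually (eventually_notMem_finset hw₀)]
    with t hFt ht
  have htc : t - c ≠ 0 := fun h => ne_zero_of_notMem_insert ht (by rw [h, inv_zero])
  have hq0 := mobiusFactor_ne_zero ht
  rw [polarPart_mobiusSystem_mulVec hR hc fun h => ht (Finset.mem_insert_of_mem h)] at hFt
  refine hasDerivAt_pi.2 fun i => ?_
  have hFi := hasDerivAt_pi.1 hFt (.inr i)
  rw [Sum.elim_inr] at hFi
  have hinv : HasDerivAt (fun t : ℂ => (t - c)⁻¹) (-1 / (t - c) ^ 2) t :=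
    ((hasDerivAt_id t).sub_const c).inv htc
  have hFinv := hFi.comp (h₂ := fun u => F u (.inr i)) t hinv
  have hq := (hasDerivAt_mobiusFactor ht).comp t hinv
  refine ((hq.inv hq0).mul hFinv).congr_deriv ?_
  rw [Matrix.mulVec_smul, Pi.smul_apply, smul_eq_mul, inv_inv (t - c), add_sub_cancel]
  simp only [Function.comp_apply, Pi.inv_apply]
  field_simp
  ring

theorem IsVecSolution.hasDerivAt_mobius_false (hR : R.support ⊆ σ) (hc : c ∉ σ)
    (hw₀ : w₀ ∉ insert e (mobiusPoints σ c))
    (hF : IsVecSolution (_root_.mobiusSystem R σ c e) w₀ F) :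
    ∀ᶠ w in 𝓝 w₀, HasDerivAt (fun w => F w (.inl false) * (mobiusFactor σ c e w)⁻¹) 0 w := by
  filter_upwards [hF, eventually_notMem_finset hw₀] with w hFw hw
  have hFfalse := hasDerivAt_pi.1 hFw (.inl false)
  rw [polarPart_mobiusSystem_mulVec hR hc fun h => hw (Finset.mem_insert_of_mem h)] at hFfalse
  simp only [Sum.elim_inl, Bool.false_eq_true, if_false, add_zero] at hFfalse
  exact hasDerivAt_mul_inv_eq_zero hFfalse (hasDerivAt_mobiusFactor hw) (mobiusFactor_ne_zero hw)

theorem IsVecSolution.hasDerivAt_mobius_true (hR : R.support ⊆ σ) (hc : c ∉ σ)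
    (hw₀ : w₀ ∉ insert e (mobiusPoints σ c))
    (hF : IsVecSolution (_root_.mobiusSystem R σ c e) w₀ F) :
    ∀ᶠ w in 𝓝 w₀,
      HasDerivAt (fun w => F w (.inl true) * (mobiusFactor σ c e w * ((w - e) / w))⁻¹) 0 w := by
  filter_upwards [hF, eventually_notMem_finset hw₀] with w hFw hw
  have hFtrue := hasDerivAt_pi.1 hFw (.inl true)
  rw [polarPart_mobiusSystem_mulVec hR hc fun h => hw (Finset.mem_insert_of_mem h)] at hFtrue
  simp only [Sum.elim_inl, if_true, ← add_mul] at hFtrue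
  exact hasDerivAt_mul_inv_eq_zero hFtrue (hasDerivAt_mobiusFactor_mul hw)
    (mul_ne_zero (mobiusFactor_ne_zero hw)
      (div_ne_zero (sub_ne_zero_of_notMem_insert hw) (ne_zero_of_notMem_insert hw)))

theorem IsVecContinuation.of_mobiusSystem (hR : R.support ⊆ σ) (hc : c ∉ σ)
    (hγ : ∀ s ∈ Set.Icc (0 : ℝ) 1, γ s ∉ insert e (mobiusPoints σ c))
    (hy : IsVecContinuation (mobiusSystem R σ c e) γ y) :
    IsVecContinuation R (fun s => c + (γ s)⁻¹)
      fun s => (mobiusFactor σ c e (γ s))⁻¹ • (y s ∘ .inr) := by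
  intro s hs
  obtain ⟨F, hF, hFy⟩ := hy s hs
  exact ⟨_, hF.of_mobiusSystem hR hc (hγ s hs), hFy.mono fun u hu => by simp [hu]⟩

theorem VecSpectralCondition.mobiusSystem (hR : R.support ⊆ σ) (hc : c ∉ σ)
    (h : VecSpectralCondition R σ) :
    VecSpectralCondition (mobiusSystem R σ c e) (insert e (mobiusPoints σ c)) := by
  intro γ hγ hγσ μ y hy hy0 hy1
  have h0 := hγσ 0 (by simp)
  have hq0 := mobiusFactor_ne_zero h0
  by_cases hfalse : y 0 (.inl false) ≠ 0
  · exact hy.norm_multiplier_eq_one hγ (fun w => (mobiusFactor σ c e w)⁻¹) (.inl false)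
      one_ne_zero (inv_ne_zero hq0)
      (fun s hs F hF => by simpa using hF.hasDerivAt_mobius_false hR hc (hγσ s hs)) hfalse hy1
  by_cases htrue : y 0 (.inl true) ≠ 0
  · exact hy.norm_multiplier_eq_one hγ (fun w => (mobiusFactor σ c e w * ((w - e) / w))⁻¹)
      (.inl true) one_ne_zero (inv_ne_zero (mul_ne_zero hq0 (div_ne_zero
        (sub_ne_zero_of_notMem_insert h0) (ne_zero_of_notMem_insert h0))))
      (fun s hs F hF => by simpa only [pow_one] using
        hF.hasDerivAt_mobius_true hR hc (hγσ s hs)) htrue hy1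
  have hloop : IsSimpleLoop ((fun w => c + w⁻¹) ∘ γ) :=
    hγ.comp (fun s hs => continuousAt_const.add
      (continuousAt_id.inv₀ (ne_zero_of_notMem_insert (hγσ s hs))))
      fun w w' hww' => inv_injective (add_left_cancel hww')
  refine h _ hloop (fun s hs hmem => hγσ s hs ?_) μ _ (hy.of_mobiusSystem hR hc hγσ)
    (fun hzero => hy0 (funext ?_)) ?_
  · have hpoint := inv_sub_mem_mobiusPoints (c := c) hmem
    rw [Function.comp_apply, add_sub_cancel_left, inv_inv] at hpoint
    exact Finset.mem_insert_of_mem hpoint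
  · have hblock : y 0 ∘ Sum.inr = 0 := (smul_eq_zero_iff_right (inv_ne_zero hq0)).1 hzero
    exact Sum.rec (Bool.rec (not_not.1 hfalse) (not_not.1 htrue)) (congr_fun hblock)
  · rw [hy1, ← hγ.2.1, smul_comm]
    rfl

theorem dominates_mobiusSystem (hR : R.support ⊆ σ) (hc : c ∉ σ) (he : e ∉ mobiusPoints σ c) :
    Dominates (fun z => (z - c)⁻¹) R σ (mobiusSystem R σ c e) (insert e (mobiusPoints σ c)) where
  avoid a ha hmem := ha (Finset.mem_insert_of_mem (inv_sub_mem_mobiusPoints hmem))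
  cont a ha := (continuousAt_id.sub continuousAt_const).inv₀ fun h =>
    ne_zero_of_notMem_insert ha (by simpa using h)
  lift a ha := by
    have he0 : e ≠ 0 := fun h => he (h ▸ zero_mem_mobiusPoints)
    have hcont : ContinuousAt (fun z => (z - c)⁻¹) a :=
      (continuousAt_id.sub continuousAt_const).inv₀ fun h =>
        ne_zero_of_notMem_insert ha (by simpa using h)
    have hev := hcont.eventually (eventually_notMem_finset ha)
    have hback : c + ((a - c)⁻¹)⁻¹ = a := by rw [inv_inv, add_sub_cancel]
    have hscalar := IsVecSolution.mobiusSystem hR hc ha (x := 0) (.of_forall fun t => by simp)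
    have hfalse := (hscalar 1 0).mem_affineSolutionSpan (.inl false)
    have htrue := (hscalar 0 1).mem_affineSolutionSpan (.inl true)
    refine ⟨fun t => mobiusFactor σ c e (t - c)⁻¹, hev.mono fun t ht => mobiusFactor_ne_zero ht,
      forall_mem_affineSolutionSpan (φ := fun z => (z - c)⁻¹) ⟨_, hfalse, by simp⟩
        ⟨_, sub_mem (Submodule.smul_mem _ (c + e⁻¹) hfalse) (Submodule.smul_mem _ e⁻¹ htrue), ?_⟩
        fun x hx i => ⟨_, (IsVecSolution.mobiusSystem hR hc ha (x := x) (hback.symm ▸ hx) 0 0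
          ).mem_affineSolutionSpan (.inr i), .of_forall fun t => by simp⟩⟩
    filter_upwards [hev] with t ht
    have htc : t - c ≠ 0 := fun h => ne_zero_of_notMem_insert ht (by rw [h, inv_zero])
    simp only [Pi.sub_apply, Pi.smul_apply, Sum.elim_inl, smul_eq_mul, if_true, if_false,
      Bool.false_eq_true]
    field_simp
    ring
  spec h := h.mobiusSystem hR hc

end Mobius

theorem exists_continuous_sq_eq {γ : ℝ → ℂ} (hγ : ContinuousOn γ (Set.Icc 0 1))
    (h0 : ∀ s ∈ Set.Icc (0 : ℝ) 1, γ s ≠ 0) :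
    ∃ r : ℝ → ℂ, Continuous r ∧ ∀ s ∈ Set.Icc (0 : ℝ) 1, r s ^ 2 = γ s := by
  have hcov := isCoveringMap_npow (𝕜 := ℂ) 2 (by norm_num)
  obtain ⟨w, hw⟩ := IsAlgClosed.exists_pow_nat_eq (γ 0) zero_lt_two
  have hw0 : w ≠ 0 := fun h => h0 0 (by simp) (by rw [← hw, h]; ring)
  obtain ⟨Γ, hΓ, -⟩ := hcov.exists_path_lifts
    ⟨fun s : unitInterval => ⟨γ s, h0 s s.2⟩, (hγ.domRestrict).subtype_mk _⟩ ⟨w, hw0⟩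
    (Subtype.ext hw.symm)
  refine ⟨Set.IccExtend zero_le_one fun s => (Γ s : ℂ),
    (continuous_subtype_val.comp Γ.continuous).Icc_extend', fun s hs => ?_⟩
  rw [Set.IccExtend_of_mem _ _ hs]
  exact congrArg Subtype.val (congr_fun hΓ ⟨s, hs⟩)

section Concatenation

variable {E : Type*} {f g : ℝ → E} {s : ℝ}

/-- The concatenation of two paths parametrized by `[0, 1]`. The paths are functions on all of `ℝ`,
as in `IsSimpleLoop`, so Mathlib's `Path.trans` does not apply. -/
noncomputable def concatPath (f g : ℝ → E) (s : ℝ) : E :=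
  if s < 1 / 2 then f (2 * s) else g (2 * s - 1)

theorem concatPath_of_lt (hs : s < 1 / 2) : concatPath f g s = f (2 * s) :=
  if_pos hs

theorem concatPath_of_ge (hs : 1 / 2 ≤ s) : concatPath f g s = g (2 * s - 1) :=
  if_neg hs.not_gt

theorem concatPath_of_le (h : f 1 = g 0) (hs : s ≤ 1 / 2) : concatPath f g s = f (2 * s) := by
  obtain hs | rfl := hs.lt_or_eq
  · exact concatPath_of_lt hs
  · rw [concatPath_of_ge le_rfl, mul_one_div_cancel two_ne_zero, sub_self, h]

theorem concatPath_zero : concatPath f g 0 = f 0 := by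
  rw [concatPath_of_lt (by norm_num), mul_zero]

theorem concatPath_one : concatPath f g 1 = g 1 := by
  rw [concatPath_of_ge (by norm_num)]
  norm_num

theorem forall_concatPath {p : E → Prop} (hf : ∀ s ∈ Set.Icc (0 : ℝ) 1, p (f s))
    (hg : ∀ s ∈ Set.Icc (0 : ℝ) 1, p (g s)) : ∀ s ∈ Set.Icc (0 : ℝ) 1, p (concatPath f g s) := by
  rintro s ⟨hs0, hs1⟩
  rcases lt_or_ge s (1 / 2) with hs | hs
  · rw [concatPath_of_lt hs]
    exact hf _ ⟨by linarith, by linarith⟩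
  · rw [concatPath_of_ge hs]
    exact hg _ ⟨by linarith, by linarith⟩

theorem continuous_concatPath [TopologicalSpace E] (hf : Continuous f) (hg : Continuous g)
    (h : f 1 = g 0) : Continuous (concatPath f g) := by
  have hle : concatPath f g = fun s => if s ≤ 1 / 2 then f (2 * s) else g (2 * s - 1) := by
    funext s
    split_ifs with hs
    · exact concatPath_of_le h hs
    · exact concatPath_of_ge (not_le.1 hs).le
  rw [hle]
  exact Continuous.if_le (by fun_prop) (by fun_prop) continuous_id continuous_const
    (by rintro s rfl; norm_num [h])

theorem injOn_concatPath (hf : Set.InjOn f (Set.Ico 0 1)) (hg : Set.InjOn g (Set.Ico 0 1))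
    (hfg : ∀ u ∈ Set.Ico (0 : ℝ) 1, ∀ v ∈ Set.Ico (0 : ℝ) 1, f u ≠ g v) :
    Set.InjOn (concatPath f g) (Set.Ico 0 1) := by
  have hfst {u : ℝ} (hu : u ∈ Set.Ico (0 : ℝ) 1) (h : u < 1 / 2) : 2 * u ∈ Set.Ico (0 : ℝ) 1 :=
    ⟨by linarith [hu.1], by linarith⟩
  have hsnd {u : ℝ} (hu : u ∈ Set.Ico (0 : ℝ) 1) (h : 1 / 2 ≤ u) :
      2 * u - 1 ∈ Set.Ico (0 : ℝ) 1 := ⟨by linarith, by linarith [hu.2]⟩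
  intro u hu v hv h
  rcases lt_or_ge u (1 / 2) with hu2 | hu2 <;> rcases lt_or_ge v (1 / 2) with hv2 | hv2
  · rw [concatPath_of_lt hu2, concatPath_of_lt hv2] at h
    linarith [hf (hfst hu hu2) (hfst hv hv2) h]
  · rw [concatPath_of_lt hu2, concatPath_of_ge hv2] at h
    exact absurd h (hfg _ (hfst hu hu2) _ (hsnd hv hv2))
  · rw [concatPath_of_ge hu2, concatPath_of_lt hv2] at h
    exact absurd h.symm (hfg _ (hfst hv hv2) _ (hsnd hu hu2))
  · rw [concatPath_of_ge hu2, concatPath_of_ge hv2] at h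
    linarith [hg (hsnd hu hu2) (hsnd hv hv2) h]

theorem eventually_concatPath {E' : Type*} {f' g' : ℝ → E'} {p : E → E' → Prop} (h : f 1 = g 0)
    (h' : f' 1 = g' 0) (hfst : ∀ᶠ u in 𝓝[Set.Icc 0 (1 / 2)] s, p (f (2 * u)) (f' (2 * u)))
    (hsnd : ∀ᶠ u in 𝓝[Set.Icc (1 / 2) 1] s, p (g (2 * u - 1)) (g' (2 * u - 1))) :
    ∀ᶠ u in 𝓝[Set.Icc 0 1] s, p (concatPath f g u) (concatPath f' g' u) := by
  rw [← Set.Icc_union_Icc_eq_Icc (show (0 : ℝ) ≤ 1 / 2 by norm_num) (by norm_num),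
    nhdsWithin_union, eventually_sup]
  constructor
  · filter_upwards [hfst, self_mem_nhdsWithin] with u hu hmem
    rwa [concatPath_of_le h hmem.2, concatPath_of_le h' hmem.2]
  · filter_upwards [hsnd, self_mem_nhdsWithin] with u hu hmem
    rwa [concatPath_of_ge hmem.1, concatPath_of_ge hmem.1]

theorem tendsto_two_mul_Icc : Tendsto (fun u : ℝ => 2 * u) (𝓝[Set.Icc 0 (1 / 2)] s)
    (𝓝[Set.Icc 0 1] (2 * s)) :=
  tendsto_nhdsWithin_of_tendsto_nhds_of_eventually_within _
    ((continuous_const_mul 2).continuousWithinAt)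
    (eventually_mem_nhdsWithin.mono fun _ hu => ⟨by linarith [hu.1], by linarith [hu.2]⟩)

theorem tendsto_two_mul_sub_one_Icc : Tendsto (fun u : ℝ => 2 * u - 1) (𝓝[Set.Icc (1 / 2) 1] s)
    (𝓝[Set.Icc 0 1] (2 * s - 1)) :=
  tendsto_nhdsWithin_of_tendsto_nhds_of_eventually_within _
    (((continuous_const_mul 2).sub continuous_const).continuousWithinAt)
    (eventually_mem_nhdsWithin.mono fun _ hu => ⟨by linarith [hu.1], by linarith [hu.2]⟩)

theorem IsSimpleLoop.concatPath_sqrt {γ : ℝ → ℂ} (hγ : IsSimpleLoop γ) {r : ℝ → ℂ} (c : ℂ)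
    (hr : Continuous r) (hsq : ∀ s ∈ Set.Icc (0 : ℝ) 1, r s ^ 2 = γ s)
    (h0 : ∀ s ∈ Set.Icc (0 : ℝ) 1, γ s ≠ 0) (h1 : r 1 = -r 0) :
    IsSimpleLoop (concatPath (fun s => c + r s) fun s => c - r s) := by
  have hinj : ∀ u ∈ Set.Ico (0 : ℝ) 1, ∀ v ∈ Set.Ico (0 : ℝ) 1, r u ^ 2 = r v ^ 2 → u = v := by
    intro u hu v hv h
    rw [hsq u (Set.Ico_subset_Icc_self hu), hsq v (Set.Ico_subset_Icc_self hv)] at h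
    exact hγ.2.2 hu hv h
  have hr0 : ∀ u ∈ Set.Ico (0 : ℝ) 1, r u ≠ 0 := fun u hu h =>
    h0 u (Set.Ico_subset_Icc_self hu)
      (by rw [← hsq u (Set.Ico_subset_Icc_self hu), h, sq, mul_zero])
  refine ⟨(continuous_concatPath (by fun_prop) (by fun_prop) (by rw [h1, sub_eq_add_neg])
    ).continuousOn, by rw [concatPath_zero, concatPath_one, h1, sub_neg_eq_add],
    injOn_concatPath (fun u hu v hv h => ?_) (fun u hu v hv h => ?_) fun u hu v hv h => ?_⟩
  · exact hinj u hu v hv (by rw [add_left_cancel h])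
  · exact hinj u hu v hv (by rw [sub_right_injective h])
  · have hneg : r u = -r v := by linear_combination h
    obtain rfl := hinj u hu v hv (by rw [hneg, neg_sq])
    exact hr0 u hu (self_eq_neg.1 hneg)

variable {ι : Type*} [Fintype ι] {R : ℂ →₀ Matrix ι ι ℂ}

theorem IsVecContinuation.const_smul {γ : ℝ → ℂ} {y : ℝ → ι → ℂ} (h : IsVecContinuation R γ y)
    (c : ℂ) : IsVecContinuation R γ fun s => c • y s :=
  h.map (T := c • LinearMap.id) fun a v => by simp [Matrix.mulVec_smul]

theorem IsVecContinuation.concatPath {γ₁ γ₂ : ℝ → ℂ} {y₁ y₂ : ℝ → ι → ℂ}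
    (h₁ : IsVecContinuation R γ₁ y₁) (h₂ : IsVecContinuation R γ₂ y₂) (hc₁ : Continuous γ₁)
    (hγ : γ₁ 1 = γ₂ 0) (hy : y₁ 1 = y₂ 0) (hR : γ₁ 1 ∉ R.support) :
    IsVecContinuation R (_root_.concatPath γ₁ γ₂) (_root_.concatPath y₁ y₂) := by
  intro s hs
  suffices h : ∃ F, IsVecSolution R (_root_.concatPath γ₁ γ₂ s) F ∧
      (∀ᶠ u in 𝓝[Set.Icc 0 (1 / 2)] s, y₁ (2 * u) = F (γ₁ (2 * u))) ∧
      ∀ᶠ u in 𝓝[Set.Icc (1 / 2) 1] s, y₂ (2 * u - 1) = F (γ₂ (2 * u - 1)) by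
    obtain ⟨F, hF, hfst, hsnd⟩ := h
    exact ⟨F, hF, eventually_concatPath (p := fun v z => v = F z) hy hγ hfst hsnd⟩
  have hbot {a b : ℝ} (h : s ∉ Set.Icc a b) : 𝓝[Set.Icc a b] s = ⊥ :=
    notMem_closure_iff_nhdsWithin_eq_bot.1 (by rwa [closure_Icc])
  rcases lt_trichotomy s (1 / 2) with h | rfl | h
  · obtain ⟨F, hF, hFy⟩ := h₁ (2 * s) ⟨by linarith [hs.1], by linarith⟩
    exact ⟨F, by rwa [concatPath_of_lt h], tendsto_two_mul_Icc.eventually hFy, by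
      rw [hbot fun hmem => h.not_ge hmem.1]
      exact eventually_bot⟩
  · obtain ⟨F, hF, hFy⟩ := h₁ 1 (by simp)
    obtain ⟨G, hG, hGy⟩ := h₂ 0 (by simp)
    have hFG : ∀ᶠ u in 𝓝 (γ₁ 1), F u = G u := hF.eventually_eq (by rwa [hγ]) hR <| by
      rw [← hFy.self_of_nhdsWithin (by simp), hy, hGy.self_of_nhdsWithin (by simp), hγ]
    have hfst : Tendsto (fun u : ℝ => 2 * u) (𝓝[Set.Icc 0 (1 / 2)] (1 / 2)) (𝓝[Set.Icc 0 1] 1) := by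
      simpa using tendsto_two_mul_Icc (s := 1 / 2)
    have hsnd : Tendsto (fun u : ℝ => 2 * u - 1) (𝓝[Set.Icc (1 / 2) 1] (1 / 2))
        (𝓝[Set.Icc 0 1] 0) := by
      simpa using tendsto_two_mul_sub_one_Icc (s := 1 / 2)
    refine ⟨G, by simpa [concatPath_of_ge] using hG, ?_, hsnd.eventually hGy⟩
    exact hfst.eventually (hFy.and ((hc₁.continuousWithinAt).eventually hFG)) |>.mono
      fun u hu => hu.1.trans hu.2
  · obtain ⟨F, hF, hFy⟩ := h₂ (2 * s - 1) ⟨by linarith, by linarith [hs.2]⟩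
    exact ⟨F, by rwa [concatPath_of_ge h.le], by
      rw [hbot fun hmem => h.not_ge hmem.2]
      exact eventually_bot, tendsto_two_mul_sub_one_Icc.eventually hFy⟩

end Concatenation

section ScalarMultiples

variable {E : Type*} [AddCommGroup E] [Module ℂ E]

/-- The residues of the product of the scalar rational function with residues `g` by a constant `M`
with values in a vector space. -/
noncomputable def residueSMul (g : ℂ →₀ ℂ) (M : E) : ℂ →₀ E :=
  g.mapRange (LinearMap.toSpanSingleton ℂ E M) (map_zero _)

@[simp]
theorem residueSMul_apply (g : ℂ →₀ ℂ) (M : E) (z : ℂ) : residueSMul g M z = g z • M :=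
  rfl

@[simp]
theorem polarPart_residueSMul (g : ℂ →₀ ℂ) (M : E) (z : ℂ) :
    polarPart (residueSMul g M) z = polarPart g z • M :=
  polarPart_mapRange _ g z

theorem norm_residueSMul_apply_le {ι κ : Type*} {g : ℂ →₀ ℂ} {M : Matrix ι κ ℂ} {K B : ℝ}
    {i : ι} {j : κ} (hg : ∀ z, ‖g z‖ ≤ K) (hM : ‖M i j‖ ≤ B) (z : ℂ) :
    ‖residueSMul g M z i j‖ ≤ K * B := by
  rw [residueSMul_apply, Matrix.smul_apply, smul_eq_mul, norm_mul]
  exact mul_le_mul (hg z) hM (norm_nonneg _) ((norm_nonneg _).trans (hg z))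

theorem norm_single_apply_apply_le {ι κ : Type*} {M : Matrix ι κ ℂ} {B : ℝ} {i : ι} {j : κ}
    (hM : ‖M i j‖ ≤ B) (a z : ℂ) : ‖Finsupp.single a M z i j‖ ≤ B := by
  classical
  rw [Finsupp.single_apply]
  split_ifs
  · exact hM
  · simpa using (norm_nonneg _).trans hM

end ScalarMultiples

section FoldData

/-- The singular points of the system obtained by folding along `z = t²` a system with singular
points in `T`, when the zeros and poles of the auxiliary function `ρ` are in `E`. -/
noncomputable def foldSing (T E : Finset ℂ) : Finset ℂ :=
  insert 0 (E ∪ T.image fun d => d ^ 2)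

/-- Auxiliary data for folding along `z = t²` a system with singular points in `T`: a rational
function `ρ` of `z` with zeros and poles in `E`, the residues `L` of its logarithmic derivative, and
those of `d ρ / (z - d²)` and `d / (z ρ (z - d²))` for `d ∈ T`. -/
structure FoldData (T : Finset ℂ) where
  ρ : ℂ → ℂ
  E : Finset ℂ
  L : ℂ →₀ ℂ
  f : ℂ → ℂ →₀ ℂ
  h : ℂ → ℂ →₀ ℂ
  ρ_ne_zero : ∀ z ∉ foldSing T E, ρ z ≠ 0
  hasDerivAt_ρ : ∀ z ∉ foldSing T E, HasDerivAt ρ (polarPart L z * ρ z) z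
  polarPart_f : ∀ z ∉ foldSing T E, ∀ d ∈ T, polarPart (f d) z = d * ρ z * (z - d ^ 2)⁻¹
  polarPart_h : ∀ z ∉ foldSing T E, ∀ d ∈ T,
    polarPart (h d) z = d * (z * ρ z)⁻¹ * (z - d ^ 2)⁻¹
  support_L : L.support ⊆ foldSing T E
  support_f : ∀ d ∈ T, (f d).support ⊆ foldSing T E
  support_h : ∀ d ∈ T, (h d).support ⊆ foldSing T E

namespace FoldData

variable {T : Finset ℂ} (D : FoldData T) {z : ℂ}

/-- The singular points of the folded system. -/
noncomputable def sing : Finset ℂ :=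
  foldSing T D.E

variable {D}

theorem ne_zero (hz : z ∉ D.sing) : z ≠ 0 :=
  fun h => hz (h ▸ Finset.mem_insert_self _ _)

theorem ne_sq (hz : z ∉ D.sing) {d : ℂ} (hd : d ∈ T) : z ≠ d ^ 2 :=
  fun h => hz (Finset.mem_insert_of_mem (Finset.mem_union_right _
    (h ▸ Finset.mem_image_of_mem (fun d => d ^ 2) hd)))

theorem sub_ne_zero {c t : ℂ} (ht : (t - c) ^ 2 ∉ D.sing) : t - c ≠ 0 :=
  pow_ne_zero_iff two_ne_zero |>.1 (ne_zero ht)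

theorem ne_sub_sq {σ : Finset ℂ} {c : ℂ} {D : FoldData (σ.image (· - c))} (hz : z ∉ D.sing)
    {p : ℂ} (hp : p ∈ σ) : z ≠ (p - c) ^ 2 :=
  ne_sq hz (Finset.mem_image_of_mem (· - c) hp)

end FoldData

end FoldData

section FoldSystem

variable {ι : Type*} {R : ℂ →₀ Matrix ι ι ℂ} {σ : Finset ℂ} {c t z : ℂ}

/-- A `2 × 2` block matrix, extended by a zero row and a zero column. -/
def foldBlock (A B C D : Matrix ι ι ℂ) : Matrix ((ι ⊕ ι) ⊕ Unit) ((ι ⊕ ι) ⊕ Unit) ℂ :=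
  Matrix.fromBlocks (Matrix.fromBlocks A B C D) 0 0 0

theorem foldBlock_add (A B C D A' B' C' D' : Matrix ι ι ℂ) :
    foldBlock A B C D + foldBlock A' B' C' D' =
      foldBlock (A + A') (B + B') (C + C') (D + D') := by
  simp only [foldBlock, Matrix.fromBlocks_add, add_zero]

theorem smul_foldBlock (x : ℂ) (A B C D : Matrix ι ι ℂ) :
    x • foldBlock A B C D = foldBlock (x • A) (x • B) (x • C) (x • D) := by
  simp only [foldBlock, Matrix.fromBlocks_smul, smul_zero]

theorem sum_foldBlock {α : Type*} (s : Finset α) (A B C D : α → Matrix ι ι ℂ) :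
    ∑ i ∈ s, foldBlock (A i) (B i) (C i) (D i) =
      foldBlock (∑ i ∈ s, A i) (∑ i ∈ s, B i) (∑ i ∈ s, C i) (∑ i ∈ s, D i) := by
  classical
  induction s using Finset.induction_on with
  | empty => simp [foldBlock]
  | insert a s ha ih => simp only [Finset.sum_insert ha, ih, foldBlock_add]

theorem norm_foldBlock_apply_le {A B C D : Matrix ι ι ℂ} {K : ℝ} (hA : ∀ i j, ‖A i j‖ ≤ K)
    (hB : ∀ i j, ‖B i j‖ ≤ K) (hC : ∀ i j, ‖C i j‖ ≤ K) (hD : ∀ i j, ‖D i j‖ ≤ K) (hK : 0 ≤ K)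
    (k l : (ι ⊕ ι) ⊕ Unit) : ‖foldBlock A B C D k l‖ ≤ K := by
  rcases k with (i | i) | i <;> rcases l with (j | j) | j <;>
    simp only [foldBlock, Matrix.fromBlocks_apply₁₁, Matrix.fromBlocks_apply₁₂,
      Matrix.fromBlocks_apply₂₁, Matrix.fromBlocks_apply₂₂, Matrix.zero_apply, norm_zero, *]

/-- The projector to the last coordinate. -/
def lastProj (ι : Type*) : Matrix ((ι ⊕ ι) ⊕ Unit) ((ι ⊕ ι) ⊕ Unit) ℂ :=
  Matrix.fromBlocks 0 0 0 1

/-- The even part of `(2 (t - c))⁻¹ • polarPart R t` under `t - c ↦ c - t`, as a function of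
`z = (t - c)²`. -/
noncomputable def foldEven (R : ℂ →₀ Matrix ι ι ℂ) (σ : Finset ℂ) (c z : ℂ) : Matrix ι ι ℂ :=
  ∑ p ∈ σ, (1 / 2 * (z - (p - c) ^ 2)⁻¹) • R p

/-- The product by `t - c` of the odd part of `(2 (t - c))⁻¹ • polarPart R t` under
`t - c ↦ c - t`, as a function of `z = (t - c)²`. -/
noncomputable def foldOdd (R : ℂ →₀ Matrix ι ι ℂ) (σ : Finset ℂ) (c z : ℂ) : Matrix ι ι ℂ :=
  ∑ p ∈ σ, (1 / 2 * (p - c) * (z - (p - c) ^ 2)⁻¹) • R p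

theorem foldEven_add_foldOdd (hR : R.support ⊆ σ) (ht : t - c ≠ 0)
    (hz : ∀ p ∈ σ, (t - c) ^ 2 ≠ (p - c) ^ 2) :
    foldEven R σ c ((t - c) ^ 2) + (t - c)⁻¹ • foldOdd R σ c ((t - c) ^ 2) =
      (2 * (t - c))⁻¹ • polarPart R t := by
  rw [polarPart_eq_sum hR, foldEven, foldOdd, Finset.smul_sum, Finset.smul_sum,
    ← Finset.sum_add_distrib]
  refine Finset.sum_congr rfl fun p hp => ?_
  rw [smul_smul, smul_smul, ← add_smul]
  congr 1
  have hsq : (t - c) ^ 2 - (p - c) ^ 2 ≠ 0 := sub_ne_zero.2 (hz p hp)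
  have htp : t - p ≠ 0 := fun h => hsq (by linear_combination (t + p - 2 * c) * h)
  field_simp
  ring

theorem foldEven_mulVec_add [Fintype ι] {D : FoldData (σ.image (· - c))} (hR : R.support ⊆ σ)
    (ht : (t - c) ^ 2 ∉ D.sing) (x : ι → ℂ) :
    foldEven R σ c ((t - c) ^ 2) *ᵥ x + (t - c)⁻¹ • foldOdd R σ c ((t - c) ^ 2) *ᵥ x =
      (2 * (t - c))⁻¹ • polarPart R t *ᵥ x := by
  rw [← Matrix.smul_mulVec, ← Matrix.smul_mulVec, ← Matrix.add_mulVec,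
    foldEven_add_foldOdd hR (FoldData.sub_ne_zero ht) fun _ hp => FoldData.ne_sub_sq ht hp]

/-- The residues contributed to the folded system by a singular point with residue `M`, at `d` in
the coordinate `t - c`. -/
noncomputable def foldTerm {T : Finset ℂ} (D : FoldData T) (d : ℂ) (M : Matrix ι ι ℂ) :
    ℂ →₀ Matrix ((ι ⊕ ι) ⊕ Unit) ((ι ⊕ ι) ⊕ Unit) ℂ :=
  Finsupp.single (d ^ 2) (foldBlock ((1 / 2 : ℂ) • M) 0 0 ((1 / 2 : ℂ) • M)) +
  residueSMul (D.h d) (foldBlock 0 ((1 / 2 : ℂ) • M) 0 0) +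
  residueSMul (D.f d) (foldBlock 0 0 ((1 / 2 : ℂ) • M) 0)

theorem polarPart_foldTerm {T : Finset ℂ} {D : FoldData T} (hz : z ∉ D.sing) {d : ℂ} (hd : d ∈ T)
    (M : Matrix ι ι ℂ) :
    polarPart (foldTerm D d M) z = foldBlock
      ((1 / 2 * (z - d ^ 2)⁻¹) • M) ((z * D.ρ z)⁻¹ • (1 / 2 * d * (z - d ^ 2)⁻¹) • M)
      (D.ρ z • (1 / 2 * d * (z - d ^ 2)⁻¹) • M) ((1 / 2 * (z - d ^ 2)⁻¹) • M) := by
  simp only [foldTerm, map_add, Pi.add_apply, polarPart_single, polarPart_residueSMul,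
    D.polarPart_f z hz d hd, D.polarPart_h z hz d hd, smul_foldBlock, foldBlock_add, smul_zero,
    add_zero, zero_add, smul_smul]
  congr 2 <;> ring

theorem foldTerm_apply_eq_zero {T : Finset ℂ} {D : FoldData T} (hz : z ∉ D.sing) {d : ℂ}
    (hd : d ∈ T) (M : Matrix ι ι ℂ) : foldTerm D d M z = 0 := by
  have hf : D.f d z = 0 := Finsupp.notMem_support_iff.1 fun h => hz (D.support_f d hd h)
  have hh : D.h d z = 0 := Finsupp.notMem_support_iff.1 fun h => hz (D.support_h d hd h)
  simp [foldTerm, hf, hh, (FoldData.ne_sq hz hd).symm]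

theorem norm_foldTerm_apply_le {T : Finset ℂ} {D : FoldData T} {M : Matrix ι ι ℂ} {d : ℂ}
    {C K : ℝ} (hM : ∀ i j, ‖M i j‖ ≤ C) (hC : 0 ≤ C) (hf : ∀ z, ‖D.f d z‖ ≤ K)
    (hh : ∀ z, ‖D.h d z‖ ≤ K) (z : ℂ) (k l : (ι ⊕ ι) ⊕ Unit) :
    ‖foldTerm D d M z k l‖ ≤ C + K * C + K * C := by
  have hhalf : ∀ i j, ‖((1 / 2 : ℂ) • M) i j‖ ≤ C := fun i j => by
    rw [Matrix.smul_apply, smul_eq_mul, norm_mul]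
    norm_num
    linarith [hM i j, norm_nonneg (M i j)]
  have hzero : ∀ i j, ‖(0 : Matrix ι ι ℂ) i j‖ ≤ C := fun i j => by simpa
  refine norm_add₃_le.trans (add_le_add_three (norm_single_apply_apply_le ?_ _ _)
    (norm_residueSMul_apply_le hh ?_ z) (norm_residueSMul_apply_le hf ?_ z)) <;>
  apply norm_foldBlock_apply_le <;> assumption

variable [DecidableEq ι]

/-- The residues of the system for `(x, g x, t - c)`, `g = (t - c) ρ(z)`, as functions of
`z = (t - c)²`. -/
noncomputable def foldSystem (R : ℂ →₀ Matrix ι ι ℂ) (σ : Finset ℂ) (c : ℂ)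
    (D : FoldData (σ.image (· - c))) : ℂ →₀ Matrix ((ι ⊕ ι) ⊕ Unit) ((ι ⊕ ι) ⊕ Unit) ℂ :=
  ∑ p ∈ σ, foldTerm D (p - c) (R p) + residueSMul D.L (foldBlock 0 0 0 1) +
    Finsupp.single 0 ((1 / 2 : ℂ) • (foldBlock 0 0 0 1 + lastProj ι))

variable {D : FoldData (σ.image (· - c))}

theorem support_foldSystem_subset : (foldSystem R σ c D).support ⊆ D.sing := by
  intro z hz
  by_contra hmem
  have hL : D.L z = 0 := Finsupp.notMem_support_iff.1 fun h => hmem (D.support_L h)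
  refine Finsupp.mem_support_iff.1 hz ?_
  rw [foldSystem, Finsupp.add_apply, Finsupp.add_apply, Finsupp.finsetSum_apply,
    Finset.sum_eq_zero fun p hp => foldTerm_apply_eq_zero hmem
      (Finset.mem_image_of_mem (· - c) hp) _]
  simp [hL, (FoldData.ne_zero hmem).symm]

theorem norm_foldSystem_le {C K : ℝ} (hR : ∀ z i j, ‖R z i j‖ ≤ C) (hC : 0 ≤ C)
    (hL : ∀ z, ‖D.L z‖ ≤ K) (hf : ∀ d ∈ σ.image (· - c), ∀ z, ‖D.f d z‖ ≤ K)
    (hh : ∀ d ∈ σ.image (· - c), ∀ z, ‖D.h d z‖ ≤ K) (z : ℂ) (k l : (ι ⊕ ι) ⊕ Unit) :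
    ‖foldSystem R σ c D z k l‖ ≤ σ.card * (C + K * C + K * C) + K + 1 := by
  have hzero : ∀ i j, ‖(0 : Matrix ι ι ℂ) i j‖ ≤ 1 := by simp
  have hone : ∀ i j, ‖(1 : Matrix ι ι ℂ) i j‖ ≤ 1 := fun i j => by
    rw [Matrix.one_apply]
    split_ifs <;> simp
  have hblock := norm_foldBlock_apply_le hzero hzero hzero hone zero_le_one k l
  have hlast : ‖lastProj ι k l‖ ≤ 1 := by
    rcases k with k | k <;> rcases l with l | l <;> simp [lastProj]
  have hres : ‖((1 / 2 : ℂ) • (foldBlock 0 0 0 1 + lastProj ι) : Matrix _ _ ℂ) k l‖ ≤ 1 := by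
    rw [Matrix.smul_apply, Matrix.add_apply, norm_smul, norm_div, norm_one, RCLike.norm_ofNat]
    linarith [norm_add_le (foldBlock 0 0 0 1 k l) (lastProj ι k l)]
  rw [foldSystem, Finsupp.add_apply, Finsupp.add_apply, Finsupp.finsetSum_apply, Matrix.add_apply,
    Matrix.add_apply, Matrix.sum_apply]
  refine norm_add₃_le.trans (add_le_add_three ?_ ?_ (norm_single_apply_apply_le hres _ _))
  · rw [← nsmul_eq_mul]
    refine (norm_sum_le _ _).trans (Finset.sum_le_card_nsmul _ _ _ fun p hp => ?_)
    have hmem := Finset.mem_image_of_mem (· - c) hp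
    exact norm_foldTerm_apply_le (hR p) hC (hf _ hmem) (hh _ hmem) z k l
  · simpa using norm_residueSMul_apply_le hL hblock z

theorem polarPart_foldSystem (hz : z ∉ D.sing) :
    polarPart (foldSystem R σ c D) z = foldBlock (foldEven R σ c z)
      ((z * D.ρ z)⁻¹ • foldOdd R σ c z) (D.ρ z • foldOdd R σ c z)
      (foldEven R σ c z + (polarPart D.L z + (2 * z)⁻¹) • 1) + (2 * z)⁻¹ • lastProj ι := by
  have hsum : ∑ p ∈ σ, polarPart (foldTerm D (p - c) (R p)) z = foldBlock (foldEven R σ c z)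
      ((z * D.ρ z)⁻¹ • foldOdd R σ c z) (D.ρ z • foldOdd R σ c z) (foldEven R σ c z) := by
    rw [Finset.sum_congr rfl fun p hp =>
      polarPart_foldTerm hz (Finset.mem_image_of_mem (· - c) hp) (R p), sum_foldBlock,
      ← Finset.smul_sum, ← Finset.smul_sum, foldEven, foldOdd]
  have hscalar : (z - 0)⁻¹ * (1 / 2) = (2 * z)⁻¹ := by rw [sub_zero, mul_inv]; ring
  simp only [foldSystem, map_add, map_sum, Pi.add_apply, Finset.sum_apply, hsum,
    polarPart_residueSMul, polarPart_single, smul_add, smul_foldBlock, smul_zero]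
  simp only [smul_smul, hscalar, ← add_assoc, foldBlock_add, add_zero, add_smul]

variable [Fintype ι]

theorem polarPart_foldSystem_mulVec (hz : z ∉ D.sing) (y : (ι ⊕ ι) ⊕ Unit → ℂ) :
    polarPart (foldSystem R σ c D) z *ᵥ y = Sum.elim (Sum.elim
      (foldEven R σ c z *ᵥ (y ∘ .inl ∘ .inl) +
        (z * D.ρ z)⁻¹ • foldOdd R σ c z *ᵥ (y ∘ .inl ∘ .inr))
      (D.ρ z • foldOdd R σ c z *ᵥ (y ∘ .inl ∘ .inl) + foldEven R σ c z *ᵥ (y ∘ .inl ∘ .inr) +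
        (polarPart D.L z + (2 * z)⁻¹) • y ∘ .inl ∘ .inr))
      ((2 * z)⁻¹ • y ∘ .inr) := by
  rw [polarPart_foldSystem hz, foldBlock, lastProj, Matrix.fromBlocks_smul, Matrix.fromBlocks_add,
    Matrix.fromBlocks_mulVec]
  simp [Matrix.fromBlocks_mulVec, Matrix.smul_mulVec, Matrix.add_mulVec, Function.comp_assoc,
    add_assoc]

end FoldSystem

section FoldSolutions

theorem hasDerivAt_sumElim {ι κ : Type*} {f : ℂ → ι → ℂ}
    {g : ℂ → κ → ℂ} {f' : ι → ℂ} {g' : κ → ℂ} {z : ℂ} (hf : HasDerivAt f f' z)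
    (hg : HasDerivAt g g' z) :
    HasDerivAt (fun z => Sum.elim (f z) (g z)) (Sum.elim f' g') z := by
  rw [hasDerivAt_pi] at *
  rintro (i | i)
  exacts [hf i, hg i]

theorem hasDerivAt_comp_index {ι κ : Type*} {f : ℂ → κ → ℂ} {f' : κ → ℂ}
    {z : ℂ} (hf : HasDerivAt f f' z) (e : ι → κ) : HasDerivAt (fun z => f z ∘ e) (f' ∘ e) z :=
  hasDerivAt_pi.2 fun i => hasDerivAt_pi.1 hf (e i)

theorem hasStrictDerivAt_sub_const_sq (c t : ℂ) :
    HasStrictDerivAt (fun t : ℂ => (t - c) ^ 2) (2 * (t - c)) t :=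
  ((hasStrictDerivAt_pow 2 (t - c)).comp (h := (· - c)) t
    ((hasStrictDerivAt_id t).sub_const c)).congr_deriv (by simp)

theorem exists_local_inverse_sq {a c : ℂ} (ha : a - c ≠ 0) :
    ∃ ψ : ℂ → ℂ, (∀ᶠ t in 𝓝 a, ψ ((t - c) ^ 2) = t) ∧
      ∀ᶠ z in 𝓝 ((a - c) ^ 2), (ψ z - c) ^ 2 = z ∧ ψ z - c ≠ 0 ∧
        HasDerivAt ψ (2 * (ψ z - c))⁻¹ z := by
  have hequiv := (hasStrictDerivAt_sub_const_sq c a).hasStrictFDerivAt_equiv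
    (mul_ne_zero two_ne_zero ha)
  set f := hequiv.toOpenPartialHomeomorph _
  have hfa : (a - c) ^ 2 ∈ f.target := hequiv.image_mem_toOpenPartialHomeomorph_target
  have hf : f.symm ((a - c) ^ 2) = a := f.left_inv hequiv.mem_toOpenPartialHomeomorph_source
  refine ⟨f.symm, f.eventually_left_inverse hequiv.mem_toOpenPartialHomeomorph_source, ?_⟩
  have hne : ∀ᶠ z in 𝓝 ((a - c) ^ 2), f.symm z ≠ c :=
    (f.continuousAt_symm hfa).eventually_ne (by rwa [hf, ← sub_ne_zero])
  filter_upwards [f.eventually_right_inverse hfa, hne, f.open_target.mem_nhds hfa] with z hz hzc hzt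
  have hzc' := sub_ne_zero.2 hzc
  exact ⟨hz, hzc', f.hasDerivAt_symm hzt (mul_ne_zero two_ne_zero hzc')
    (hasStrictDerivAt_sub_const_sq c _).hasDerivAt⟩

variable {ι : Type*} [Fintype ι] {R : ℂ →₀ Matrix ι ι ℂ} {σ : Finset ℂ} {a c : ℂ}
  {D : FoldData (σ.image (· - c))}

/-- The branch of a solution `y` of the folded system that solves the original system, at a point
with `t - c = s`. -/
noncomputable def foldBranch {ι : Type*} {T : Finset ℂ} (D : FoldData T) (s : ℂ)
    (y : (ι ⊕ ι) ⊕ Unit → ℂ) : ι → ℂ :=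
  (1 / 2 : ℂ) • (y ∘ .inl ∘ .inl + (s * D.ρ (s ^ 2))⁻¹ • y ∘ .inl ∘ .inr)

section Solutions

variable [DecidableEq ι]

theorem IsVecSolution.foldSystem (hR : R.support ⊆ σ) (ha : (a - c) ^ 2 ∉ D.sing) {ψ : ℂ → ℂ}
    (hψa : ψ ((a - c) ^ 2) = a) (hψ : ∀ᶠ z in 𝓝 ((a - c) ^ 2), (ψ z - c) ^ 2 = z ∧ ψ z - c ≠ 0 ∧
      HasDerivAt ψ (2 * (ψ z - c))⁻¹ z)
    {x : ℂ → ι → ℂ} (hx : IsVecSolution R a x) (α : ℂ) :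
    IsVecSolution (foldSystem R σ c D) ((a - c) ^ 2) fun z => Sum.elim
      (Sum.elim (x (ψ z)) (((ψ z - c) * D.ρ z) • x (ψ z))) fun _ => α * (ψ z - c) := by
  have hcont : Tendsto ψ (𝓝 ((a - c) ^ 2)) (𝓝 a) := by
    simpa only [hψa] using hψ.self_of_nhds.2.2.continuousAt.tendsto
  filter_upwards [hψ, hcont.eventually hx, eventually_notMem_finset ha] with z ⟨hsq, hs, hd⟩ hxz hz
  have hxd : HasDerivAt (fun z => x (ψ z)) _ z := hxz.scomp z hd
  have hgd := ((hd.sub_const c).mul (D.hasDerivAt_ρ z hz)).smul hxd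
  have hud := hasDerivAt_pi.2 fun _ : Unit => (hd.sub_const c).const_mul α
  refine (hasDerivAt_sumElim (hasDerivAt_sumElim hxd hgd) hud).congr_deriv ?_
  have hEO := foldEven_mulVec_add hR (by rwa [hsq]) (x (ψ z))
  rw [hsq] at hEO
  have hρ := D.ρ_ne_zero z hz
  simp only [polarPart_foldSystem_mulVec hz, ← hEO, ← Function.comp_assoc, Sum.elim_comp_inl,
    Sum.elim_comp_inr, Matrix.mulVec_smul, Pi.mul_apply]
  generalize ψ z = t at *
  subst hsq
  congr 2
  · match_scalars <;> field_simp
  · match_scalars <;> field_simp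
    ring
  · funext
    simp
    field_simp

theorem IsVecSolution.foldBranch (hR : R.support ⊆ σ) (ha : (a - c) ^ 2 ∉ D.sing)
    {F : ℂ → (ι ⊕ ι) ⊕ Unit → ℂ}
    (hF : IsVecSolution (_root_.foldSystem R σ c D) ((a - c) ^ 2) F) :
    IsVecSolution R a fun t => _root_.foldBranch D (t - c) (F ((t - c) ^ 2)) := by
  have hsq (t : ℂ) := (hasStrictDerivAt_sub_const_sq c t).hasDerivAt
  filter_upwards [(hsq a).continuousAt.eventually hF,
    (hsq a).continuousAt.eventually (eventually_notMem_finset ha)] with t hFt ht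
  have hs := FoldData.sub_ne_zero ht
  have hρ := D.ρ_ne_zero _ ht
  have hq := ((hasDerivAt_id t).sub_const c).mul ((D.hasDerivAt_ρ _ ht).comp t (hsq t))
  have hFd := hFt.scomp t (hsq t)
  have hd := ((hasDerivAt_comp_index hFd (.inl ∘ .inl)).add ((hq.inv (mul_ne_zero hs hρ)).smul
    (hasDerivAt_comp_index hFd (.inl ∘ .inr)))).const_smul (1 / 2 : ℂ)
  refine hd.congr_deriv ?_
  have hEO (x : ι → ℂ) := (inv_smul_eq_iff₀ (mul_ne_zero two_ne_zero hs)).1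
    (foldEven_mulVec_add hR ht x).symm
  simp only [_root_.foldBranch, Matrix.mulVec_smul, Matrix.mulVec_add, hEO,
    polarPart_foldSystem_mulVec ht, ← Function.comp_assoc, Sum.elim_comp_inl, Sum.elim_comp_inr,
    Pi.smul_comp]
  simp only [Function.comp_apply, Pi.mul_apply, Pi.inv_apply, id]
  match_scalars <;> field_simp
  ring

end Solutions

end FoldSolutions

section FoldBranch

variable {ι : Type*} {T : Finset ℂ} {D : FoldData T} {s : ℂ}

theorem foldBranch_smul (D : FoldData T) (s μ : ℂ) (y : (ι ⊕ ι) ⊕ Unit → ℂ) :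
    foldBranch D s (μ • y) = μ • foldBranch D s y := by
  simp only [foldBranch, Pi.smul_comp, smul_comm _ μ, ← smul_add]

theorem foldBranch_ne_zero (hs : s ^ 2 ∉ D.sing) {y : (ι ⊕ ι) ⊕ Unit → ℂ} (hu : y (.inr ()) = 0)
    (hy : y ≠ 0) : foldBranch D s y ≠ 0 ∨ foldBranch D (-s) y ≠ 0 := by
  by_contra! h
  have hs0 : s ≠ 0 := pow_ne_zero_iff two_ne_zero |>.1 (FoldData.ne_zero hs)
  have hk : (s * D.ρ (s ^ 2))⁻¹ ≠ 0 := inv_ne_zero (mul_ne_zero hs0 (D.ρ_ne_zero _ hs))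
  obtain ⟨hplus, hminus⟩ := h
  simp only [foldBranch, neg_sq, neg_mul, inv_neg] at hplus hminus
  have hfst : y ∘ .inl ∘ .inl = 0 := by
    linear_combination (norm := module) hplus + hminus
  have hsnd : (s * D.ρ (s ^ 2))⁻¹ • y ∘ .inl ∘ .inr = 0 := by
    linear_combination (norm := module) hplus - hminus
  refine hy (funext ?_)
  rintro ((i | i) | _)
  exacts [congr_fun hfst i, congr_fun ((smul_eq_zero_iff_right hk).1 hsnd) i, hu]

end FoldBranch

section FoldDominates

variable {ι : Type*} [Fintype ι] [DecidableEq ι] {R : ℂ →₀ Matrix ι ι ℂ} {σ : Finset ℂ} {c μ : ℂ}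
  {D : FoldData (σ.image (· - c))} {γ r : ℝ → ℂ} {y : ℝ → (ι ⊕ ι) ⊕ Unit → ℂ}

theorem IsVecContinuation.foldBranch (hR : R.support ⊆ σ) {l : ℝ → ℂ}
    (hy : IsVecContinuation (foldSystem R σ c D) γ y)
    (hγ : ∀ s ∈ Set.Icc (0 : ℝ) 1, γ s ∉ D.sing)
    (hl : ∀ s ∈ Set.Icc (0 : ℝ) 1, (l s - c) ^ 2 = γ s) :
    IsVecContinuation R l fun s => _root_.foldBranch D (l s - c) (y s) := by
  intro s hs
  obtain ⟨F, hF, hFy⟩ := hy s hs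
  have hls := hγ s hs
  rw [← hl s hs] at hF hls
  refine ⟨_, hF.foldBranch hR hls, ?_⟩
  filter_upwards [hFy, self_mem_nhdsWithin] with u hu hu'
  rw [hl u hu', hu]

theorem norm_eq_one_of_closed_lift (hR : R.support ⊆ σ) (h : VecSpectralCondition R σ)
    (hy : IsVecContinuation (foldSystem R σ c D) γ y) (hloop : IsSimpleLoop γ)
    (hγ : ∀ s ∈ Set.Icc (0 : ℝ) 1, γ s ∉ D.sing) (hr : Continuous r)
    (hsq : ∀ s ∈ Set.Icc (0 : ℝ) 1, r s ^ 2 = γ s) (h1 : r 1 = r 0) (hy1 : y 1 = μ • y 0)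
    (h0 : foldBranch D (r 0) (y 0) ≠ 0) : ‖μ‖ = 1 := by
  have hlift : ∀ s ∈ Set.Icc (0 : ℝ) 1, (c + r s - c) ^ 2 = γ s := by simpa using hsq
  have hinj : Set.InjOn (fun s => c + r s) (Set.Ico 0 1) := fun s hs u hu hsu =>
    hloop.2.2 hs hu (by
      rw [← hsq s (Set.Ico_subset_Icc_self hs), ← hsq u (Set.Ico_subset_Icc_self hu),
        add_left_cancel hsu])
  have hcont := hy.foldBranch hR hγ hlift
  simp only [add_sub_cancel_left] at hcont
  refine h _ ⟨(continuous_const.add hr).continuousOn, by simp [h1], hinj⟩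
    (fun s hs hmem => FoldData.ne_sub_sq (hγ s hs) hmem (hlift s hs).symm) μ _ hcont h0 ?_
  simp only [h1, hy1, foldBranch_smul]

theorem norm_eq_one_of_antipodal_lift (hR : R.support ⊆ σ) (h : VecSpectralCondition R σ)
    (hy : IsVecContinuation (foldSystem R σ c D) γ y) (hloop : IsSimpleLoop γ)
    (hγ : ∀ s ∈ Set.Icc (0 : ℝ) 1, γ s ∉ D.sing) (hr : Continuous r)
    (hsq : ∀ s ∈ Set.Icc (0 : ℝ) 1, r s ^ 2 = γ s) (h1 : r 1 = -r 0) (hy1 : y 1 = μ • y 0)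
    (h0 : foldBranch D (r 0) (y 0) ≠ 0) : ‖μ‖ = 1 := by
  have hlift : ∀ s ∈ Set.Icc (0 : ℝ) 1, (c + r s - c) ^ 2 = γ s := by simpa using hsq
  have hlift' : ∀ s ∈ Set.Icc (0 : ℝ) 1, (c - r s - c) ^ 2 = γ s := by simpa using hsq
  have havoid {t : ℂ} (ht : ∃ s ∈ Set.Icc (0 : ℝ) 1, (t - c) ^ 2 = γ s) : t ∉ σ := by
    obtain ⟨s, hs, hts⟩ := ht
    exact fun hmem => FoldData.ne_sub_sq (hγ s hs) hmem hts.symm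
  have hfst := hy.foldBranch hR hγ hlift
  have hsnd := hy.foldBranch hR hγ hlift'
  simp only [add_sub_cancel_left, sub_sub_cancel_left] at hfst hsnd
  have hcat := hfst.concatPath (hsnd.const_smul μ) (continuous_const.add hr)
    (by rw [h1, sub_eq_add_neg]) (by rw [h1, hy1, foldBranch_smul])
    fun hmem => havoid ⟨1, by simp, hlift 1 (by simp)⟩ (hR hmem)
  have hμ := h _ (hloop.concatPath_sqrt c hr hsq (fun s hs => FoldData.ne_zero (hγ s hs)) h1)
    (fun s hs => forall_concatPath (p := (· ∉ σ)) (fun s hs => havoid ⟨s, hs, hlift s hs⟩)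
      (fun s hs => havoid ⟨s, hs, hlift' s hs⟩) s hs) (μ * μ) _ hcat
    (by rwa [concatPath_zero])
    (by simp only [concatPath_zero, concatPath_one, h1, neg_neg, hy1, foldBranch_smul, smul_smul])
  rw [norm_mul] at hμ
  exact (mul_self_eq_one_iff.1 hμ).resolve_right (by linarith [norm_nonneg μ])

theorem norm_eq_one_of_last_ne_zero (hy : IsVecContinuation (foldSystem R σ c D) γ y)
    (hloop : IsSimpleLoop γ) (hγ : ∀ s ∈ Set.Icc (0 : ℝ) 1, γ s ∉ D.sing) (hy1 : y 1 = μ • y 0)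
    (h0 : y 0 (.inr ()) ≠ 0) : ‖μ‖ = 1 := by
  refine hy.norm_multiplier_eq_one hloop (fun z => z⁻¹) (.inr ()) two_ne_zero
    (inv_ne_zero (FoldData.ne_zero (hγ 0 (by simp)))) ?_ h0 hy1
  intro s hs F hF
  filter_upwards [hF, eventually_notMem_finset (hγ s hs)] with z hFz hz
  have hlast := hasDerivAt_pi.1 hFz (.inr ())
  rw [polarPart_foldSystem_mulVec hz] at hlast
  have hz0 := FoldData.ne_zero hz
  refine hasDerivAt_mul_inv_eq_zero (l := z⁻¹) ((hlast.pow 2).congr_deriv ?_)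
    ((hasDerivAt_id z).congr_deriv (inv_mul_cancel₀ hz0).symm) hz0
  simp
  field_simp

theorem VecSpectralCondition.foldSystem (hR : R.support ⊆ σ) (h : VecSpectralCondition R σ) :
    VecSpectralCondition (foldSystem R σ c D) D.sing := by
  intro γ hloop hγ μ y hy hy0 hy1
  by_cases hu : y 0 (.inr ()) = 0
  swap
  · exact norm_eq_one_of_last_ne_zero hy hloop hγ hy1 hu
  suffices hbranch : ∀ r : ℝ → ℂ, Continuous r → (∀ s ∈ Set.Icc (0 : ℝ) 1, r s ^ 2 = γ s) →
      foldBranch D (r 0) (y 0) ≠ 0 → ‖μ‖ = 1 by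
    obtain ⟨r, hr, hsq⟩ := exists_continuous_sq_eq hloop.1 fun s hs => FoldData.ne_zero (hγ s hs)
    have hr0 : r 0 ^ 2 ∉ D.sing := by
      rw [hsq 0 (by simp)]
      exact hγ 0 (by simp)
    rcases foldBranch_ne_zero hr0 hu hy0 with h0 | h0
    · exact hbranch r hr hsq h0
    · exact hbranch (-r) hr.neg (by simpa using hsq) h0
  intro r hr hsq h0
  have hends : r 1 ^ 2 = r 0 ^ 2 := by rw [hsq 1 (by simp), hsq 0 (by simp), hloop.2.1]
  rcases sq_eq_sq_iff_eq_or_eq_neg.1 hends with h1 | h1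
  · exact norm_eq_one_of_closed_lift hR h hy hloop hγ hr hsq h1 hy1 h0
  · exact norm_eq_one_of_antipodal_lift hR h hy hloop hγ hr hsq h1 hy1 h0

theorem dominates_foldSystem (hR : R.support ⊆ σ) :
    Dominates (fun t => (t - c) ^ 2) R σ (foldSystem R σ c D) D.sing where
  avoid a ha hmem := FoldData.ne_sub_sq ha hmem rfl
  cont a _ := by fun_prop
  spec h := h.foldSystem hR
  lift a ha := by
    obtain ⟨ψ, hleft, hψ⟩ := exists_local_inverse_sq (FoldData.sub_ne_zero ha)
    have hψa := hleft.self_of_nhds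
    have hone := one_mem_affineSolutionSpan (foldSystem R σ c D) ((a - c) ^ 2)
    refine ⟨fun _ => 1, by simp, forall_mem_affineSolutionSpan (φ := fun t => (t - c) ^ 2)
      ⟨fun _ => 1, hone, by simp⟩ ?_ fun x hx i => ?_⟩
    · have hzero : IsVecSolution R a fun _ => 0 :=
        Eventually.of_forall fun t => by simpa using hasDerivAt_const t (0 : ι → ℂ)
      have hlast : (fun z => 1 * (ψ z - c)) ∈ affineSolutionSpan (foldSystem R σ c D) _ :=
        (hzero.foldSystem hR ha hψa hψ 1).mem_affineSolutionSpan (.inr ())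
      refine ⟨_, add_mem hlast (Submodule.smul_mem _ c hone), ?_⟩
      filter_upwards [hleft] with t ht
      simp [ht]
    · have hfst : (fun z => x (ψ z) i) ∈ affineSolutionSpan (foldSystem R σ c D) _ :=
        (hx.foldSystem hR ha hψa hψ 0).mem_affineSolutionSpan (.inl (.inl i))
      refine ⟨_, hfst, ?_⟩
      filter_upwards [hleft] with t ht
      simp [ht]

end FoldDominates

section Scale

theorem exists_monotone_enumeration {α : Type*} [LinearOrder α] {N : Finset α} (hN : N.Nonempty) :
    ∃ τ : ℕ → α, Monotone τ ∧ (∀ i, τ i ∈ N) ∧ ∀ x ∈ N, ∃ i < N.card, τ i = x := by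
  have hpos : 0 < N.card := hN.card_pos
  refine ⟨fun i => N.orderEmbOfFin rfl ⟨min i (N.card - 1), by omega⟩, fun i j hij => ?_,
    fun i => N.orderEmbOfFin_mem rfl _, fun x hx => ?_⟩
  · exact (N.orderEmbOfFin rfl).monotone (by simpa using Or.inl hij)
  · obtain ⟨i, rfl⟩ : x ∈ Set.range (N.orderEmbOfFin rfl) := by simpa using hx
    exact ⟨i, i.2, congrArg _ (Fin.ext (by simp; omega))⟩

/-- The distance of `p` and `q` is comparable to their absolute values, with constant `K`. -/
def RelSep (K : ℝ) (p q : ℂ) : Prop :=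
  ‖p‖ ≤ K * ‖p - q‖ ∧ ‖q‖ ≤ K * ‖p - q‖

theorem RelSep.symm {K : ℝ} {p q : ℂ} (h : RelSep K p q) : RelSep K q p := by
  rw [RelSep, norm_sub_rev]
  exact ⟨h.2, h.1⟩

theorem relSep_zero_left {K : ℝ} (hK : 1 ≤ K) (q : ℂ) : RelSep K 0 q := by
  constructor
  · rw [norm_zero]
    positivity
  · simpa using le_mul_of_one_le_left (norm_nonneg q) hK

theorem RelSep.ne {K : ℝ} {p q : ℂ} (h : RelSep K p q) (hq : q ≠ 0) : p ≠ q := by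
  rintro rfl
  simpa [hq] using h.1

theorem RelSep.of_le {L s : ℝ} {p q : ℂ} (hL : 0 ≤ L) (hq : ‖q‖ ≤ L * s) (h : s / 2 ≤ ‖q - p‖) :
    RelSep (2 * L + 1) p q := by
  rw [norm_sub_rev] at h
  have h1 : ‖q‖ ≤ 2 * L * ‖p - q‖ := by nlinarith
  have h2 : ‖p‖ ≤ ‖p - q‖ + ‖q‖ := by simpa using norm_add_le (p - q) q
  constructor <;> linarith [norm_nonneg (p - q)]

/-- By the pigeonhole principle, as two distinct multiples of `s` have distance at least `s`. -/
theorem exists_far_multiple (F : Finset ℂ) {s : ℝ} (hs : 0 < s) {L : ℕ} (hL : F.card < L) :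
    ∃ k : ℕ, 1 ≤ k ∧ k ≤ L ∧ ∀ p ∈ F, s / 2 ≤ ‖-((k : ℂ) * s) - p‖ := by
  by_contra! h
  choose! g hgF hg using h
  obtain ⟨k, hk, k', hk', hne, heq⟩ := Finset.exists_ne_map_eq_of_card_lt_of_maps_to
    (s := Finset.Icc 1 L) (t := F) (f := g) (by simpa using hL) fun k hk =>
      hgF k (Finset.mem_Icc.1 hk).1 (Finset.mem_Icc.1 hk).2
  rw [Finset.mem_Icc] at hk hk'
  have hk1 := hg k hk.1 hk.2
  have hk2 := hg k' hk'.1 hk'.2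
  have hlt : ‖(k : ℂ) - k'‖ * s < s :=
    calc ‖(k : ℂ) - k'‖ * s = ‖(-((k' : ℂ) * s) - g k') - (-((k : ℂ) * s) - g k)‖ := by
          rw [heq, sub_sub_sub_cancel_right, neg_sub_neg, ← sub_mul, norm_mul, Complex.norm_real,
            Real.norm_of_nonneg hs.le]
      _ ≤ _ := norm_sub_le _ _
      _ < s := by linarith
  have hge : (1 : ℝ) ≤ ‖(k : ℂ) - k'‖ := by
    rw [← Int.cast_natCast k, ← Int.cast_natCast k', ← Int.cast_sub, Complex.norm_intCast]
    have hkk : (k : ℤ) - k' ≠ 0 := by omega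
    exact_mod_cast Int.one_le_abs hkk
  nlinarith

theorem exists_relSep (F : Finset ℂ) {s : ℝ} (hs : 0 < s) {L : ℕ} (hL : F.card < L) :
    ∃ x : ℂ, x.im = 0 ∧ s ≤ ‖x‖ ∧ ‖x‖ ≤ L * s ∧ ∀ p ∈ F, RelSep (2 * L + 1) p x := by
  obtain ⟨k, hk1, hkL, hk⟩ := exists_far_multiple F hs hL
  have hnorm : ‖-((k : ℂ) * s)‖ = k * s := by
    rw [norm_neg, norm_mul, Complex.norm_natCast, Complex.norm_real, Real.norm_of_nonneg hs.le]
  have hle : ‖-((k : ℂ) * s)‖ ≤ L * s := by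
    rw [hnorm]
    gcongr
  refine ⟨-((k : ℂ) * s), by simp, ?_, hle, fun p hp => .of_le L.cast_nonneg hle (hk p hp)⟩
  rw [hnorm]
  exact le_mul_of_one_le_left hs.le (by exact_mod_cast hk1)

theorem exists_relSep_sequence (F : Finset ℂ) {s : ℕ → ℝ} (hs : ∀ i, 0 < s i) {L : ℕ} (n : ℕ)
    (hL : F.card + n ≤ L) :
    ∃ x : ℕ → ℂ, ∀ i < n, (x i).im = 0 ∧ s i ≤ ‖x i‖ ∧ ‖x i‖ ≤ L * s i ∧
      (∀ p ∈ F, RelSep (2 * L + 1) p (x i)) ∧ ∀ j < n, i ≠ j → RelSep (2 * L + 1) (x i) (x j) := by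
  induction n with
  | zero => exact ⟨fun _ => 0, by simp⟩
  | succ n ih =>
    obtain ⟨x, hx⟩ := ih (by omega)
    have hcard : (F ∪ (Finset.range n).image x).card < L := by
      have := Finset.card_union_le F ((Finset.range n).image x)
      have : ((Finset.range n).image x).card ≤ n := by
        simpa using Finset.card_image_le (s := Finset.range n) (f := x)
      omega
    obtain ⟨q, him, hle, hge, hq⟩ := exists_relSep _ (hs n) hcard
    have hqx : ∀ i < n, RelSep (2 * L + 1) (x i) q := fun i hi =>
      hq _ (Finset.mem_union_right _ (Finset.mem_image_of_mem _ (Finset.mem_range.2 hi)))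
    refine ⟨Function.update x n q, fun i hi => ?_⟩
    rcases Nat.lt_succ_iff_lt_or_eq.1 hi with hi | rfl
    · obtain ⟨hxim, hxle, hxge, hxF, hxx⟩ := hx i hi
      rw [Function.update_of_ne hi.ne]
      refine ⟨hxim, hxle, hxge, hxF, fun j hj hij => ?_⟩
      rcases Nat.lt_succ_iff_lt_or_eq.1 hj with hj | rfl
      · simpa [hj.ne] using hxx j hj hij
      · simpa using hqx i hi
    · rw [Function.update_self]
      refine ⟨him, hle, hge, fun p hp => hq p (Finset.mem_union_left _ hp), fun j hj hij => ?_⟩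
      rw [Function.update_of_ne hij.symm]
      exact (hqx j (by omega)).symm

/-- Points `a`, `b` on the real axis interlacing, in a logarithmic scale and up to the factor `L`,
the squared absolute values `τ j ^ 2` of the elements of `T`, and relatively separated from each
other and from the squares of the elements of `T`. -/
structure FoldScale (m : ℕ) (L : ℝ) (T : Finset ℂ) where
  τ : ℕ → ℝ
  a : ℕ → ℂ
  b : ℕ → ℂ
  one_le : 1 ≤ L
  mono : Monotone τ
  pos : ∀ i, 0 < τ i
  exists_scale : ∀ d ∈ T, d ≠ 0 → ∃ j ≤ m, τ j = ‖d‖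
  le_norm_a : ∀ l < m, τ l * τ (l + 1) ≤ ‖a l‖
  norm_a_le : ∀ l < m, ‖a l‖ ≤ L * (τ l * τ (l + 1))
  le_norm_b : ∀ l < m, τ l * τ l ≤ ‖b l‖
  norm_b_le : ∀ l < m, ‖b l‖ ≤ L * (τ l * τ l)
  sep_aa : ∀ l < m, ∀ k < m, l ≠ k → RelSep (2 * L + 1) (a l) (a k)
  sep_bb : ∀ l < m, ∀ k < m, l ≠ k → RelSep (2 * L + 1) (b l) (b k)
  sep_ab : ∀ l < m, ∀ k < m, RelSep (2 * L + 1) (a l) (b k)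
  sep_sq_a : ∀ d ∈ T, ∀ l < m, RelSep (2 * L + 1) (d ^ 2) (a l)
  sep_sq_b : ∀ d ∈ T, ∀ l < m, RelSep (2 * L + 1) (d ^ 2) (b l)
  im_a : ∀ l < m, (a l).im = 0
  im_b : ∀ l < m, (b l).im = 0

theorem exists_monotone_norm (T : Finset ℂ) :
    ∃ τ : ℕ → ℝ, Monotone τ ∧ (∀ i, 0 < τ i) ∧ ∀ d ∈ T, d ≠ 0 → ∃ j ≤ T.card, τ j = ‖d‖ := by
  let N : Finset ℝ := insert 1 ((T.filter (· ≠ 0)).image (‖·‖))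
  have hpos : ∀ x ∈ N, 0 < x := by
    intro x hx
    obtain rfl | hx := Finset.mem_insert.1 hx
    · exact one_pos
    · obtain ⟨d, hd, rfl⟩ := Finset.mem_image.1 hx
      exact norm_pos_iff.2 (Finset.mem_filter.1 hd).2
  have hcard : N.card ≤ T.card + 1 := (Finset.card_insert_le _ _).trans
    (Nat.add_le_add_right (Finset.card_image_le.trans (Finset.card_filter_le _ _)) 1)
  obtain ⟨τ, hmono, hmem, hsurj⟩ :=
    exists_monotone_enumeration (N := N) (Finset.insert_nonempty _ _)
  refine ⟨τ, hmono, fun i => hpos _ (hmem i), fun d hd hd0 => ?_⟩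
  obtain ⟨j, hj, hjd⟩ := hsurj ‖d‖ (Finset.mem_insert_of_mem
    (Finset.mem_image_of_mem _ (Finset.mem_filter.2 ⟨hd, hd0⟩)))
  exact ⟨j, by omega, hjd⟩

theorem nonempty_foldScale {m : ℕ} {T : Finset ℂ} (hT : T.card ≤ m) :
    Nonempty (FoldScale m (3 * m + 1 : ℕ) T) := by
  obtain ⟨τ, hmono, hpos, hsurj⟩ := exists_monotone_norm T
  have hcard : (T.image (· ^ 2)).card + 2 * m ≤ 3 * m + 1 := by
    have := Finset.card_image_le (s := T) (f := (· ^ 2))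
    omega
  obtain ⟨x, hx⟩ := exists_relSep_sequence (T.image (· ^ 2))
    (s := fun i => τ (i / 2) * τ ((i + 1) / 2)) (fun i => mul_pos (hpos _) (hpos _)) (2 * m) hcard
  have heven : ∀ l, 2 * l / 2 = l := fun l => by omega
  have hodd : ∀ l, (2 * l + 1) / 2 = l := fun l => by omega
  have heven' : ∀ l, (2 * l + 1 + 1) / 2 = l + 1 := fun l => by omega
  have hb : ∀ l < m, _ := fun l hl => hx (2 * l) (by omega)
  have ha : ∀ l < m, _ := fun l hl => hx (2 * l + 1) (by omega)
  simp only [heven, hodd, heven', Finset.forall_mem_image] at ha hb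
  exact ⟨{
    τ := τ
    a := fun l => x (2 * l + 1)
    b := fun l => x (2 * l)
    one_le := by simp
    mono := hmono
    pos := hpos
    exists_scale := fun d hd hd0 => by
      obtain ⟨i, hi, hid⟩ := hsurj d hd hd0
      exact ⟨i, hi.trans hT, hid⟩
    le_norm_a := fun l hl => (ha l hl).2.1
    norm_a_le := fun l hl => (ha l hl).2.2.1
    le_norm_b := fun l hl => (hb l hl).2.1
    norm_b_le := fun l hl => (hb l hl).2.2.1
    sep_aa := fun l hl k hk hlk => (ha l hl).2.2.2.2 _ (by omega) (by omega)
    sep_bb := fun l hl k hk hlk => (hb l hl).2.2.2.2 _ (by omega) (by omega)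
    sep_ab := fun l hl k hk => (ha l hl).2.2.2.2 _ (by omega) (by omega)
    sep_sq_a := fun d hd l hl => (ha l hl).2.2.2.1 hd
    sep_sq_b := fun d hd l hl => (hb l hl).2.2.2.1 hd
    im_a := fun l hl => (ha l hl).1
    im_b := fun l hl => (hb l hl).1 }⟩

end Scale

section PartialFraction

variable {s : Finset ℂ} {P : Polynomial ℂ}

theorem polarPart_indicator (s : Finset ℂ) (g : ℂ → ℂ) (z : ℂ) :
    polarPart (Finsupp.indicator s fun v _ => g v) z = ∑ v ∈ s, (z - v)⁻¹ * g v := by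
  rw [polarPart_eq_sum (Finsupp.support_indicator_subset ..)]
  exact Finset.sum_congr rfl fun v hv => by rw [Finsupp.indicator_of_mem hv, smul_eq_mul]

theorem norm_indicator_le {g : ℂ → ℂ} {C : ℝ} (hC : 0 ≤ C) (hg : ∀ v ∈ s, ‖g v‖ ≤ C) (z : ℂ) :
    ‖Finsupp.indicator s (fun v _ => g v) z‖ ≤ C := by
  by_cases hz : z ∈ s
  · rw [Finsupp.indicator_of_mem hz]
    exact hg z hz
  · rwa [Finsupp.indicator_of_notMem hz, norm_zero]

/-- The residues of the rational function `P / ∏ v ∈ s, (z - v)`, where `P.degree < s.card`. -/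
noncomputable def partialFraction (s : Finset ℂ) (P : Polynomial ℂ) : ℂ →₀ ℂ :=
  Finsupp.indicator s fun v _ => P.eval v * Lagrange.nodalWeight s id v

theorem support_partialFraction_subset : (partialFraction s P).support ⊆ s :=
  Finsupp.support_indicator_subset ..

theorem norm_partialFraction_le {C : ℝ} (hC : 0 ≤ C)
    (h : ∀ v ∈ s, ‖P.eval v‖ * ‖Lagrange.nodalWeight s id v‖ ≤ C) (z : ℂ) :
    ‖partialFraction s P z‖ ≤ C :=
  norm_indicator_le hC (fun v hv => (norm_mul_le _ _).trans (h v hv)) z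

theorem polarPart_partialFraction (hP : P.degree < s.card) {z : ℂ} (hz : z ∉ s) :
    polarPart (partialFraction s P) z = P.eval z / ∏ v ∈ s, (z - v) := by
  have hne : ∀ v ∈ s, z ≠ id v := fun v hv h => hz (h ▸ hv)
  have hinterp := Lagrange.eval_interpolate_not_at_node (fun v => P.eval (id v)) hne
  rw [← Lagrange.eq_interpolate (v := id) Function.injective_id.injOn hP, Lagrange.eval_nodal]
    at hinterp
  simp only [id_eq] at hinterp hne
  rw [hinterp, mul_div_cancel_left₀ _ (Finset.prod_ne_zero_iff.2 fun v hv =>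
    sub_ne_zero.2 (hne v hv)), partialFraction, polarPart_indicator]
  exact Finset.sum_congr rfl fun v _ => by ring

theorem degree_C_mul_nodal_le {K : Type*} [Field K] (c : K) (s : Finset K) :
    (Polynomial.C c * Lagrange.nodal s id).degree ≤ s.card := by
  refine (Polynomial.degree_mul_le _ _).trans
    ((add_le_add Polynomial.degree_C_le le_rfl).trans ?_)
  rw [zero_add, Lagrange.degree_nodal]

end PartialFraction

section Gap

/-- The distance from `p` to `q`, replaced by the positive value `‖p‖` (or `1`, if `p = 0`) when
`p = q`: residues at simple poles are then expressed by products over all poles. -/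
noncomputable def gap (p q : ℂ) : ℝ :=
  if p = q then (if p = 0 then 1 else ‖p‖) else ‖p - q‖

variable {p q : ℂ}

theorem gap_pos (p q : ℂ) : 0 < gap p q := by
  unfold gap
  split_ifs with h h'
  · exact one_pos
  · exact norm_pos_iff.2 h'
  · exact norm_pos_iff.2 (sub_ne_zero.2 h)

theorem gap_of_ne (h : p ≠ q) : gap p q = ‖p - q‖ :=
  if_neg h

theorem gap_self (h : p ≠ 0) : gap p p = ‖p‖ := by
  simp [gap, h]

theorem gap_zero_right (p : ℂ) : gap p 0 = gap p p := by
  by_cases h : p = 0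
  · rw [h]
  · rw [gap_of_ne h, gap_self h, sub_zero]

theorem gap_le (hq : q ≠ 0) : gap p q ≤ ‖p‖ + ‖q‖ := by
  by_cases h : p = q
  · subst h
    rw [gap_self hq]
    linarith [norm_nonneg p]
  · rw [gap_of_ne h]
    exact norm_sub_le p q

/-- The relation `RelSep` with the diagonal included. -/
def FarOrEq (K : ℝ) (p q : ℂ) : Prop :=
  p = q ∨ RelSep K p q

theorem FarOrEq.norm_le {K : ℝ} (hK : 1 ≤ K) (hq : q ≠ 0) (h : FarOrEq K p q) :
    ‖p‖ ≤ K * gap p q ∧ ‖q‖ ≤ K * gap p q := by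
  by_cases hpq : p = q
  · subst hpq
    rw [gap_self hq]
    constructor <;> nlinarith [norm_nonneg p]
  · rw [gap_of_ne hpq]
    exact h.resolve_left hpq

theorem norm_nodalWeight {s : Finset ℂ} {v : ℂ} (hv : v ∈ s) :
    ‖Lagrange.nodalWeight s id v‖ = gap v v / ∏ q ∈ s, gap v q := by
  rw [← Finset.mul_prod_erase s _ hv, div_mul_eq_div_div, div_self (gap_pos _ _).ne',
    Lagrange.nodalWeight, norm_prod, one_div, ← Finset.prod_inv_distrib]
  refine Finset.prod_congr rfl fun q hq => ?_
  rw [gap_of_ne (Finset.ne_of_mem_erase hq).symm, norm_inv, id, id]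

theorem norm_eval_C_mul_nodal {s : Finset ℂ} (hp : p ∉ s) (c : ℂ) :
    ‖(Polynomial.C c * Lagrange.nodal s id).eval p‖ = ‖c‖ * ∏ q ∈ s, gap p q := by
  rw [Polynomial.eval_mul, Polynomial.eval_C, Lagrange.eval_nodal, norm_mul, norm_prod]
  congr 1
  exact Finset.prod_congr rfl fun q hq => (gap_of_ne (ne_of_mem_of_not_mem hq hp).symm).symm

end Gap

section Cut

theorem prod_range_max_div {τ : ℕ → ℝ} (hτ : ∀ i, 0 < τ i) (c m : ℕ) :
    ∏ l ∈ Finset.range m, τ (max c (l + 1)) / τ (max c l) = τ (max c m) / τ c := by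
  induction m with
  | zero => simp [div_self (hτ c).ne']
  | succ m ih =>
    rw [Finset.prod_range_succ, ih]
    have := (hτ (max c m)).ne'
    have := (hτ c).ne'
    field_simp

theorem le_ratio_mul_and_ratio_mul_le {κ₁ κ₂ A B w w' : ℝ} (hw : 0 < w) (hw' : 0 < w')
    (hκ₁ : 0 < κ₁) (hκ₂ : 0 < κ₂) (hA : 0 < A) (hB : 0 < B) (hAw : A ≤ κ₁ * w) (hwA : w ≤ κ₂ * A)
    (hBw : B ≤ κ₁ * w') (hwB : w' ≤ κ₂ * B) :
    A ≤ κ₁ * κ₂ * (w / w' * B) ∧ w / w' * B ≤ κ₁ * κ₂ * A := by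
  constructor
  · rw [div_mul_eq_mul_div, mul_div_assoc', le_div_iff₀ hw']
    calc A * w' ≤ (κ₁ * w) * (κ₂ * B) := by gcongr
      _ = _ := by ring
  · rw [div_mul_eq_mul_div, div_le_iff₀ hw']
    calc w * B ≤ (κ₂ * A) * (κ₁ * w') := by gcongr
      _ = _ := by ring

namespace FoldScale

variable {m : ℕ} {L : ℝ} {T : Finset ℂ} (F : FoldScale m L T)

theorem a_ne_zero {l : ℕ} (hl : l < m) : F.a l ≠ 0 :=
  norm_pos_iff.1 ((mul_pos (F.pos _) (F.pos _)).trans_le (F.le_norm_a l hl))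

theorem b_ne_zero {l : ℕ} (hl : l < m) : F.b l ≠ 0 :=
  norm_pos_iff.1 ((mul_pos (F.pos _) (F.pos _)).trans_le (F.le_norm_b l hl))

theorem τ_mul_le {i j k l : ℕ} (h : i ≤ k) (h' : j ≤ l) : F.τ i * F.τ j ≤ F.τ k * F.τ l :=
  mul_le_mul (F.mono h) (F.mono h') (F.pos _).le (F.pos _).le

theorem le_mul_of_le (F : FoldScale m L T) {x y : ℝ} (hy : 0 ≤ y) (h : x ≤ y) : x ≤ L * y :=
  h.trans (le_mul_of_one_le_left hy F.one_le)

/-- The point `p` lies, in the logarithmic scale, between `a (c - 1)` and `b c`. -/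
structure IsCut (p : ℂ) (c : ℕ) : Prop where
  le : c ≤ m
  le_norm : ∀ l < m, l < c → F.τ l * F.τ (l + 1) ≤ ‖p‖
  norm_le : ∀ l < m, c ≤ l → ‖p‖ ≤ L * (F.τ l * F.τ l)
  far_a : ∀ l < m, FarOrEq (2 * L + 1) p (F.a l)
  far_b : ∀ l < m, FarOrEq (2 * L + 1) p (F.b l)

theorem isCut_zero : F.IsCut 0 0 where
  le := Nat.zero_le m
  le_norm l _ h := absurd h (Nat.not_lt_zero l)
  norm_le l _ _ := by
    simpa using F.le_mul_of_le (mul_pos (F.pos l) (F.pos l)).le (mul_pos (F.pos l) (F.pos l)).le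
  far_a _ _ := .inr (relSep_zero_left (by linarith [F.one_le]) _)
  far_b _ _ := .inr (relSep_zero_left (by linarith [F.one_le]) _)

theorem isCut_sq {d : ℂ} (hd : d ∈ T) {j : ℕ} (hj : j ≤ m) (hjd : F.τ j = ‖d‖) :
    F.IsCut (d ^ 2) j where
  le := hj
  le_norm l _ h := by
    rw [norm_pow, ← hjd, pow_two]
    exact F.τ_mul_le h.le h
  norm_le l _ h := by
    rw [norm_pow, ← hjd, pow_two]
    exact F.le_mul_of_le (mul_pos (F.pos _) (F.pos _)).le (F.τ_mul_le h h)
  far_a l hl := .inr (F.sep_sq_a d hd l hl)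
  far_b l hl := .inr (F.sep_sq_b d hd l hl)

theorem isCut_b {i : ℕ} (hi : i < m) : F.IsCut (F.b i) i where
  le := hi.le
  le_norm l _ h := (F.τ_mul_le h.le h).trans (F.le_norm_b i hi)
  norm_le l _ h := (F.norm_b_le i hi).trans
    (mul_le_mul_of_nonneg_left (F.τ_mul_le h h) (by linarith [F.one_le]))
  far_a l hl := .inr (F.sep_ab l hl i hi).symm
  far_b l hl := (eq_or_ne i l).imp (congrArg F.b) (F.sep_bb i hi l hl)

theorem isCut_a {i : ℕ} (hi : i < m) : F.IsCut (F.a i) (i + 1) where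
  le := hi
  le_norm l _ h := (F.τ_mul_le (by omega) (by omega)).trans (F.le_norm_a i hi)
  norm_le l _ h := (F.norm_a_le i hi).trans
    (mul_le_mul_of_nonneg_left (F.τ_mul_le (by omega) (by omega)) (by linarith [F.one_le]))
  far_a l hl := (eq_or_ne i l).imp (congrArg F.a) (F.sep_aa i hi l hl)
  far_b l hl := .inr (F.sep_ab i hi l hl)

variable {F}

theorem IsCut.gap_ratio {p : ℂ} {c : ℕ} (h : F.IsCut p c) {l : ℕ} (hl : l < m) :
    gap p (F.a l) ≤ 2 * L * (2 * L + 1) *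
      (F.τ (max c (l + 1)) / F.τ (max c l) * gap p (F.b l)) ∧
    F.τ (max c (l + 1)) / F.τ (max c l) * gap p (F.b l) ≤
      2 * L * (2 * L + 1) * gap p (F.a l) := by
  have hL := F.one_le
  have hK : 1 ≤ 2 * L + 1 := by linarith
  have ha := (h.far_a l hl).norm_le hK (F.a_ne_zero hl)
  have hb := (h.far_b l hl).norm_le hK (F.b_ne_zero hl)
  have ha' := gap_le (p := p) (F.a_ne_zero hl)
  have hb' := gap_le (p := p) (F.b_ne_zero hl)
  have haτ := F.norm_a_le l hl
  have hbτ := F.norm_b_le l hl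
  have hτ := F.pos l
  have hτ' := F.pos (l + 1)
  have hmono : F.τ l * F.τ l ≤ F.τ l * F.τ (l + 1) := F.τ_mul_le le_rfl (Nat.le_succ l)
  rcases lt_or_ge l c with hlc | hlc
  -- Here `‖p‖` dominates, and both gaps are comparable to it.
  · have hlow := h.le_norm l hl hlc
    have hp : 0 < ‖p‖ := (mul_pos hτ hτ').trans_le hlow
    have key := le_ratio_mul_and_ratio_mul_le hp hp (by linarith : 0 < 2 * L) (by linarith)
      (gap_pos p (F.a l)) (gap_pos p (F.b l)) (by nlinarith) ha.1 (by nlinarith) hb.1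
    rw [div_self hp.ne'] at key
    rwa [max_eq_left hlc.le, max_eq_left hlc, div_self (F.pos c).ne']
  · have hupp := h.norm_le l hl hlc
    rw [max_eq_right hlc, max_eq_right (hlc.trans (Nat.le_succ l)), ← mul_div_mul_left _ _ hτ.ne']
    exact le_ratio_mul_and_ratio_mul_le (mul_pos hτ hτ') (mul_pos hτ hτ) (by linarith)
      (by linarith) (gap_pos _ _) (gap_pos _ _) (by nlinarith) ((F.le_norm_a l hl).trans ha.2)
      (by nlinarith) ((F.le_norm_b l hl).trans hb.2)

theorem IsCut.prod_gap_ratio {p : ℂ} {c : ℕ} (h : F.IsCut p c) :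
    ∏ l ∈ Finset.range m, gap p (F.a l) ≤ (2 * L * (2 * L + 1)) ^ m *
      (F.τ m / F.τ c * ∏ l ∈ Finset.range m, gap p (F.b l)) ∧
    F.τ m / F.τ c * ∏ l ∈ Finset.range m, gap p (F.b l) ≤
      (2 * L * (2 * L + 1)) ^ m * ∏ l ∈ Finset.range m, gap p (F.a l) := by
  have hτ := prod_range_max_div F.pos c m
  rw [max_eq_right h.le] at hτ
  have hpow : (2 * L * (2 * L + 1)) ^ m = ∏ _l ∈ Finset.range m, (2 * L * (2 * L + 1)) := by simp
  rw [← hτ, hpow, ← Finset.prod_mul_distrib, ← Finset.prod_mul_distrib, ← Finset.prod_mul_distrib]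
  constructor
  · exact Finset.prod_le_prod (fun l _ => (gap_pos _ _).le)
      fun l hl => (h.gap_ratio (Finset.mem_range.1 hl)).1
  · exact Finset.prod_le_prod
      (fun l _ => mul_nonneg (div_pos (F.pos _) (F.pos _)).le (gap_pos _ _).le)
      fun l hl => (h.gap_ratio (Finset.mem_range.1 hl)).2

end FoldScale

end Cut

section FoldData

namespace FoldScale

variable {m : ℕ} {L : ℝ} {T : Finset ℂ} (F : FoldScale m L T) {d z : ℂ}

theorem injOn_a : Set.InjOn F.a (Finset.range m) := by
  intro i hi j hj h
  simp only [Finset.coe_range, Set.mem_Iio] at hi hj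
  by_contra hij
  exact (F.sep_aa i hi j hj hij).ne (F.a_ne_zero hj) h

theorem injOn_b : Set.InjOn F.b (Finset.range m) := by
  intro i hi j hj h
  simp only [Finset.coe_range, Set.mem_Iio] at hi hj
  by_contra hij
  exact (F.sep_bb i hi j hj hij).ne (F.b_ne_zero hj) h

/-- The zeros `a l` of `rho`. -/
noncomputable def zeros : Finset ℂ :=
  (Finset.range m).image F.a

/-- The poles `b l` of `rho`. -/
noncomputable def poles : Finset ℂ :=
  (Finset.range m).image F.b

theorem forall_mem_zeros {p : ℂ → Prop} : (∀ q ∈ F.zeros, p q) ↔ ∀ l < m, p (F.a l) := by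
  simp [zeros]

theorem forall_mem_poles {p : ℂ → Prop} : (∀ q ∈ F.poles, p q) ↔ ∀ l < m, p (F.b l) := by
  simp [poles]

theorem card_zeros : F.zeros.card = m := by
  rw [zeros, Finset.card_image_of_injOn F.injOn_a, Finset.card_range]

theorem card_poles : F.poles.card = m := by
  rw [poles, Finset.card_image_of_injOn F.injOn_b, Finset.card_range]

theorem zero_notMem_zeros : (0 : ℂ) ∉ F.zeros := fun h =>
  (F.forall_mem_zeros (p := (· ≠ 0))).2 (fun _ => F.a_ne_zero) 0 h rfl

theorem zero_notMem_poles : (0 : ℂ) ∉ F.poles := fun h =>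
  (F.forall_mem_poles (p := (· ≠ 0))).2 (fun _ => F.b_ne_zero) 0 h rfl

theorem zero_notMem_insert_zeros (hd0 : d ≠ 0) : (0 : ℂ) ∉ insert (d ^ 2) F.zeros := by
  simp [F.zero_notMem_zeros, (pow_ne_zero 2 hd0).symm]

theorem sq_notMem_zeros (hd : d ∈ T) : d ^ 2 ∉ F.zeros := fun h =>
  F.forall_mem_zeros.2 (fun l hl => (F.sep_sq_a d hd l hl).ne (F.a_ne_zero hl)) _ h rfl

theorem sq_notMem_poles (hd : d ∈ T) : d ^ 2 ∉ F.poles := fun h =>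
  F.forall_mem_poles.2 (fun l hl => (F.sep_sq_b d hd l hl).ne (F.b_ne_zero hl)) _ h rfl

theorem a_notMem_poles {l : ℕ} (hl : l < m) : F.a l ∉ F.poles := fun h =>
  F.forall_mem_poles.2 (fun k hk => (F.sep_ab l hl k hk).ne (F.b_ne_zero hk)) _ h rfl

theorem b_notMem_zeros {l : ℕ} (hl : l < m) : F.b l ∉ F.zeros := fun h =>
  F.forall_mem_zeros.2 (fun k hk => (F.sep_ab k hk l hl).symm.ne (F.a_ne_zero hk)) _ h rfl

/-- The rational function `τ_m⁻¹ ∏ (z - a l) / (z - b l)`. -/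
noncomputable def rho (z : ℂ) : ℂ :=
  (F.τ m : ℂ)⁻¹ * ((∏ q ∈ F.zeros, (z - q)) / ∏ q ∈ F.poles, (z - q))

theorem rho_ne_zero (ha : z ∉ F.zeros) (hb : z ∉ F.poles) : F.rho z ≠ 0 := by
  refine mul_ne_zero (inv_ne_zero (Complex.ofReal_ne_zero.2 (F.pos m).ne')) (div_ne_zero ?_ ?_)
  · exact Finset.prod_ne_zero_iff.2 fun q hq => sub_ne_zero.2 (ne_of_mem_of_not_mem hq ha).symm
  · exact Finset.prod_ne_zero_iff.2 fun q hq => sub_ne_zero.2 (ne_of_mem_of_not_mem hq hb).symm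

/-- The residues of the logarithmic derivative of `rho`. -/
noncomputable def logPart : ℂ →₀ ℂ :=
  Finsupp.indicator F.zeros (fun _ _ => 1) - Finsupp.indicator F.poles (fun _ _ => 1)

theorem hasDerivAt_rho (ha : z ∉ F.zeros) (hb : z ∉ F.poles) :
    HasDerivAt F.rho (polarPart F.logPart z * F.rho z) z := by
  have hrho : F.rho = fun z => (F.τ m : ℂ)⁻¹ * ∏ l ∈ Finset.range m, (z - F.a l) / (z - F.b l) := by
    funext z
    rw [rho, zeros, poles, Finset.prod_image F.injOn_a, Finset.prod_image F.injOn_b,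
      Finset.prod_div_distrib]
  have hlog : polarPart F.logPart z =
      ∑ l ∈ Finset.range m, ((z - F.a l)⁻¹ - (z - F.b l)⁻¹) := by
    rw [logPart, map_sub, Pi.sub_apply, polarPart_indicator F.zeros fun _ => 1,
      polarPart_indicator F.poles fun _ => 1, zeros, poles, Finset.sum_image F.injOn_a,
      Finset.sum_image F.injOn_b, ← Finset.sum_sub_distrib]
    simp only [mul_one]
  rw [hlog, hrho, mul_left_comm]
  refine (hasDerivAt_prod_ratio (Finset.range m) (fun l hl => ?_) fun l hl => ?_).const_mul _
  · exact (ne_of_mem_of_not_mem (Finset.mem_image_of_mem _ hl) ha).symm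
  · exact (ne_of_mem_of_not_mem (Finset.mem_image_of_mem _ hl) hb).symm

theorem norm_logPart_le (z : ℂ) : ‖F.logPart z‖ ≤ 2 := by
  have ha := norm_indicator_le (s := F.zeros) (g := fun _ => 1) zero_le_one (by simp) z
  have hb := norm_indicator_le (s := F.poles) (g := fun _ => 1) zero_le_one (by simp) z
  rw [logPart, Finsupp.sub_apply]
  linarith [norm_sub_le (Finsupp.indicator F.zeros (fun _ _ => (1 : ℂ)) z)
    (Finsupp.indicator F.poles (fun _ _ => (1 : ℂ)) z)]

theorem support_logPart_subset : F.logPart.support ⊆ F.zeros ∪ F.poles :=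
  Finsupp.support_sub.trans (Finset.union_subset_union (Finsupp.support_indicator_subset ..)
    (Finsupp.support_indicator_subset ..))

/-- The residues of `d ρ / (z - d²)`. -/
noncomputable def fPart (d : ℂ) : ℂ →₀ ℂ :=
  partialFraction (insert (d ^ 2) F.poles)
    (Polynomial.C (d * (F.τ m : ℂ)⁻¹) * Lagrange.nodal F.zeros id)

/-- The residues of `d / (z ρ (z - d²))`. -/
noncomputable def hPart (d : ℂ) : ℂ →₀ ℂ :=
  partialFraction (insert 0 (insert (d ^ 2) F.zeros))
    (Polynomial.C (d * (F.τ m : ℂ)) * Lagrange.nodal F.poles id)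

@[simp]
theorem fPart_zero : F.fPart 0 = 0 := by
  ext z
  simp [fPart, partialFraction, Finsupp.indicator_apply]

@[simp]
theorem hPart_zero : F.hPart 0 = 0 := by
  ext z
  simp [hPart, partialFraction, Finsupp.indicator_apply]

theorem polarPart_fPart (hd : d ∈ T) (hz : z ≠ d ^ 2) (hb : z ∉ F.poles) :
    polarPart (F.fPart d) z = d * F.rho z * (z - d ^ 2)⁻¹ := by
  have hcard : F.zeros.card < (insert (d ^ 2) F.poles).card := by
    rw [Finset.card_insert_of_notMem (F.sq_notMem_poles hd), card_zeros, card_poles]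
    exact m.lt_succ_self
  rw [fPart, polarPart_partialFraction
    ((degree_C_mul_nodal_le _ _).trans_lt (by exact_mod_cast hcard)) (by simp [hz, hb]),
    Finset.prod_insert (F.sq_notMem_poles hd), Polynomial.eval_mul, Polynomial.eval_C,
    Lagrange.eval_nodal, rho]
  simp only [id_eq, div_eq_mul_inv, mul_inv]
  ring

theorem polarPart_hPart (hd : d ∈ T) (hz0 : z ≠ 0) (hz : z ≠ d ^ 2) (ha : z ∉ F.zeros) :
    polarPart (F.hPart d) z = d * (z * F.rho z)⁻¹ * (z - d ^ 2)⁻¹ := by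
  rcases eq_or_ne d 0 with rfl | hd0
  · simp
  have hzero := F.zero_notMem_insert_zeros hd0
  have hcard : F.poles.card < (insert 0 (insert (d ^ 2) F.zeros)).card := by
    rw [Finset.card_insert_of_notMem hzero, Finset.card_insert_of_notMem (F.sq_notMem_zeros hd),
      card_zeros, card_poles]
    omega
  rw [hPart, polarPart_partialFraction
    ((degree_C_mul_nodal_le _ _).trans_lt (by exact_mod_cast hcard)) (by simp [hz0, hz, ha]),
    Finset.prod_insert hzero, Finset.prod_insert (F.sq_notMem_zeros hd), Polynomial.eval_mul,
    Polynomial.eval_C, Lagrange.eval_nodal, rho]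
  simp only [id_eq, div_eq_mul_inv, mul_inv, inv_inv, sub_zero]
  ring

end FoldScale

end FoldData

section FoldBounds

theorem sq_mem_foldSing {T : Finset ℂ} {d : ℂ} (hd : d ∈ T) (E : Finset ℂ) : d ^ 2 ∈ foldSing T E :=
  Finset.mem_insert_of_mem (Finset.mem_union_right _ (Finset.mem_image_of_mem (· ^ 2) hd))

theorem subset_foldSing (T E : Finset ℂ) : E ⊆ foldSing T E :=
  Finset.subset_union_left.trans (Finset.subset_insert _ _)

namespace FoldScale

variable {m : ℕ} {L : ℝ} {T : Finset ℂ} {F : FoldScale m L T} {p d : ℂ} {c : ℕ}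

theorem norm_mul_norm_le (hd0 : d ≠ 0) (hpc : ‖p‖ ≤ L * (F.τ c * F.τ c))
    (hpd : FarOrEq (2 * L + 1) p (d ^ 2)) :
    ‖d‖ * ‖p‖ ≤ L * (2 * L + 1) * (gap p (d ^ 2) * F.τ c) := by
  have hL := F.one_le
  have hK : 1 ≤ 2 * L + 1 := by linarith
  obtain ⟨hp, hd⟩ := hpd.norm_le hK (pow_ne_zero 2 hd0)
  rw [norm_pow] at hd
  have hg := gap_pos p (d ^ 2)
  have hτ := F.pos c
  refine abs_le_of_sq_le_sq' ?_ (by positivity) |>.2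
  calc (‖d‖ * ‖p‖) ^ 2 = ‖d‖ ^ 2 * (‖p‖ * ‖p‖) := by ring
    _ ≤ ((2 * L + 1) * gap p (d ^ 2)) *
        (((2 * L + 1) * gap p (d ^ 2)) * (L * (F.τ c * F.τ c))) := by gcongr
    _ = L * ((2 * L + 1) * (gap p (d ^ 2) * F.τ c)) ^ 2 := by ring
    _ ≤ L ^ 2 * ((2 * L + 1) * (gap p (d ^ 2) * F.τ c)) ^ 2 := by
      gcongr
      nlinarith
    _ = (L * (2 * L + 1) * (gap p (d ^ 2) * F.τ c)) ^ 2 := by ring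

theorem IsCut.norm_fResidue_le (h : F.IsCut p c) (hp0 : p ≠ 0)
    (hpd : ‖d‖ * ‖p‖ ≤ L * (2 * L + 1) * (gap p (d ^ 2) * F.τ c)) :
    ‖d‖ * (F.τ m)⁻¹ * (∏ l ∈ Finset.range m, gap p (F.a l)) *
      (gap p p / (gap p (d ^ 2) * ∏ l ∈ Finset.range m, gap p (F.b l))) ≤
    L * (2 * L + 1) * (2 * L * (2 * L + 1)) ^ m := by
  have hL := F.one_le
  have hr := h.prod_gap_ratio.1
  have hB : 0 < ∏ l ∈ Finset.range m, gap p (F.b l) := Finset.prod_pos fun _ _ => gap_pos _ _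
  have hg := gap_pos p (d ^ 2)
  have hτm := F.pos m
  have hτc := F.pos c
  rw [gap_self hp0]
  set A := ∏ l ∈ Finset.range m, gap p (F.a l)
  set B := ∏ l ∈ Finset.range m, gap p (F.b l)
  set g := gap p (d ^ 2)
  set Q := (2 * L * (2 * L + 1)) ^ m
  calc ‖d‖ * (F.τ m)⁻¹ * A * (‖p‖ / (g * B))
      ≤ ‖d‖ * (F.τ m)⁻¹ * (Q * (F.τ m / F.τ c * B)) * (‖p‖ / (g * B)) := by gcongr
    _ = ((‖d‖ * ‖p‖) / (g * F.τ c)) * Q := by field_simp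
    _ ≤ L * (2 * L + 1) * Q := by
      gcongr
      rwa [div_le_iff₀ (by positivity)]

theorem IsCut.norm_hResidue_le (h : F.IsCut p c)
    (hpd : ‖d‖ * F.τ c ≤ (2 * L + 1) * gap p (d ^ 2)) :
    ‖d‖ * F.τ m * (∏ l ∈ Finset.range m, gap p (F.b l)) *
      (gap p p / (gap p 0 * (gap p (d ^ 2) * ∏ l ∈ Finset.range m, gap p (F.a l)))) ≤
    L * (2 * L + 1) * (2 * L * (2 * L + 1)) ^ m := by
  have hL := F.one_le
  have hr := h.prod_gap_ratio.2
  have hA : 0 < ∏ l ∈ Finset.range m, gap p (F.a l) := Finset.prod_pos fun _ _ => gap_pos _ _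
  have hB : 0 < ∏ l ∈ Finset.range m, gap p (F.b l) := Finset.prod_pos fun _ _ => gap_pos _ _
  have hg := gap_pos p (d ^ 2)
  have hτm := F.pos m
  have hτc := F.pos c
  have hpp := gap_pos p p
  rw [gap_zero_right]
  set A := ∏ l ∈ Finset.range m, gap p (F.a l)
  set B := ∏ l ∈ Finset.range m, gap p (F.b l)
  set g := gap p (d ^ 2)
  set Q := (2 * L * (2 * L + 1)) ^ m
  calc ‖d‖ * F.τ m * B * (gap p p / (gap p p * (g * A)))
      = (‖d‖ * F.τ c) / (A * g) * (F.τ m / F.τ c * B) := by field_simp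
    _ ≤ ((2 * L + 1) * g) / (A * g) * (Q * A) := by gcongr
    _ = (2 * L + 1) * Q := by field_simp
    _ ≤ L * (2 * L + 1) * Q := by
      gcongr
      nlinarith

variable (F)

theorem exists_isCut_of_mem_fNodes (hd : d ∈ T) (hd0 : d ≠ 0) :
    ∀ p ∈ insert (d ^ 2) F.poles, ∃ c, F.IsCut p c ∧ p ≠ 0 ∧ p ∉ F.zeros ∧
      ‖d‖ * ‖p‖ ≤ L * (2 * L + 1) * (gap p (d ^ 2) * F.τ c) := by
  rw [Finset.forall_mem_insert, forall_mem_poles]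
  constructor
  · obtain ⟨j, hj, hjd⟩ := F.exists_scale d hd hd0
    refine ⟨j, F.isCut_sq hd hj hjd, pow_ne_zero 2 hd0, F.sq_notMem_zeros hd,
      norm_mul_norm_le hd0 ?_ (.inl rfl)⟩
    rw [norm_pow, ← hjd, pow_two]
    exact F.le_mul_of_le (mul_pos (F.pos _) (F.pos _)).le le_rfl
  · exact fun i hi => ⟨i, F.isCut_b hi, F.b_ne_zero hi, F.b_notMem_zeros hi,
      norm_mul_norm_le hd0 (F.norm_b_le i hi) (.inr (F.sep_sq_b d hd i hi).symm)⟩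

theorem norm_mul_τ_succ_le_gap_a (hd : d ∈ T) (hd0 : d ≠ 0) {j : ℕ} (hjd : F.τ j = ‖d‖) {i : ℕ}
    (hi : i < m) : ‖d‖ * F.τ (i + 1) ≤ (2 * L + 1) * gap (F.a i) (d ^ 2) := by
  have hL := F.one_le
  have hd' := norm_pos_iff.2 hd0
  obtain ⟨hfar_a, hfar_sq⟩ := FarOrEq.norm_le (by linarith) (pow_ne_zero 2 hd0)
    (.inr (F.sep_sq_a d hd i hi).symm)
  rw [norm_pow] at hfar_sq
  rcases Nat.lt_or_ge i j with hij | hij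
  · have hle : F.τ (i + 1) ≤ ‖d‖ := hjd ▸ F.mono hij
    nlinarith
  · have hle : ‖d‖ ≤ F.τ i := hjd ▸ F.mono hij
    nlinarith [F.le_norm_a i hi, F.pos (i + 1)]

theorem exists_isCut_of_mem_hNodes (hd : d ∈ T) (hd0 : d ≠ 0) :
    ∀ p ∈ insert 0 (insert (d ^ 2) F.zeros), ∃ c, F.IsCut p c ∧ p ∉ F.poles ∧
      ‖d‖ * F.τ c ≤ (2 * L + 1) * gap p (d ^ 2) := by
  have hL := F.one_le
  have hd2 : d ^ 2 ≠ 0 := pow_ne_zero 2 hd0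
  have hd' := norm_pos_iff.2 hd0
  obtain ⟨j, hj, hjd⟩ := F.exists_scale d hd hd0
  rw [Finset.forall_mem_insert, Finset.forall_mem_insert, forall_mem_zeros]
  refine ⟨⟨0, F.isCut_zero, F.zero_notMem_poles, ?_⟩,
    ⟨j, F.isCut_sq hd hj hjd, F.sq_notMem_poles hd, ?_⟩,
    fun i hi => ⟨i + 1, F.isCut_a hi, F.a_notMem_poles hi,
      F.norm_mul_τ_succ_le_gap_a hd hd0 hjd hi⟩⟩
  · have hle : F.τ 0 ≤ ‖d‖ := hjd ▸ F.mono (Nat.zero_le j)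
    rw [gap_of_ne hd2.symm, zero_sub, norm_neg, norm_pow]
    nlinarith
  · rw [gap_self hd2, hjd, norm_pow]
    nlinarith

theorem norm_fPart_le (hd : d ∈ T) (z : ℂ) :
    ‖F.fPart d z‖ ≤ L * (2 * L + 1) * (2 * L * (2 * L + 1)) ^ m := by
  have hL := F.one_le
  have hC : 0 ≤ L * (2 * L + 1) * (2 * L * (2 * L + 1)) ^ m := by positivity
  rcases eq_or_ne d 0 with rfl | hd0
  · simpa using hC
  refine norm_partialFraction_le hC (fun p hp => ?_) z
  obtain ⟨c, hcut, hp0, hpz, hpd⟩ := F.exists_isCut_of_mem_fNodes hd hd0 p hp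
  rw [norm_eval_C_mul_nodal hpz, norm_nodalWeight hp,
    Finset.prod_insert (F.sq_notMem_poles hd), norm_mul, norm_inv, Complex.norm_real,
    Real.norm_of_nonneg (F.pos m).le, zeros, poles, Finset.prod_image F.injOn_a,
    Finset.prod_image F.injOn_b]
  exact hcut.norm_fResidue_le hp0 hpd

theorem norm_hPart_le (hd : d ∈ T) (z : ℂ) :
    ‖F.hPart d z‖ ≤ L * (2 * L + 1) * (2 * L * (2 * L + 1)) ^ m := by
  have hL := F.one_le
  have hC : 0 ≤ L * (2 * L + 1) * (2 * L * (2 * L + 1)) ^ m := by positivity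
  rcases eq_or_ne d 0 with rfl | hd0
  · simpa using hC
  refine norm_partialFraction_le hC (fun p hp => ?_) z
  obtain ⟨c, hcut, hpp, hpd⟩ := F.exists_isCut_of_mem_hNodes hd hd0 p hp
  rw [norm_eval_C_mul_nodal hpp, norm_nodalWeight hp,
    Finset.prod_insert (F.zero_notMem_insert_zeros hd0),
    Finset.prod_insert (F.sq_notMem_zeros hd), norm_mul, Complex.norm_real,
    Real.norm_of_nonneg (F.pos m).le, zeros, poles, Finset.prod_image F.injOn_a,
    Finset.prod_image F.injOn_b]
  exact hcut.norm_hResidue_le hpd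

theorem notMem_foldSing {z : ℂ} (hz : z ∉ foldSing T (F.zeros ∪ F.poles)) :
    z ≠ 0 ∧ z ∉ F.zeros ∧ z ∉ F.poles ∧ ∀ d ∈ T, z ≠ d ^ 2 := by
  simp only [foldSing, Finset.mem_insert, Finset.mem_union, Finset.mem_image, not_or, not_exists,
    not_and] at hz
  exact ⟨hz.1, hz.2.1.1, hz.2.1.2, fun d hd => Ne.symm (hz.2.2 d hd)⟩

/-- The fold data defined by a scale. -/
noncomputable def foldData : FoldData T where
  ρ := F.rho
  E := F.zeros ∪ F.poles
  L := F.logPart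
  f := F.fPart
  h := F.hPart
  ρ_ne_zero _ hz :=
    have ⟨_, ha, hb, _⟩ := F.notMem_foldSing hz
    F.rho_ne_zero ha hb
  hasDerivAt_ρ _ hz :=
    have ⟨_, ha, hb, _⟩ := F.notMem_foldSing hz
    F.hasDerivAt_rho ha hb
  polarPart_f _ hz d hd :=
    have ⟨_, _, hb, hsq⟩ := F.notMem_foldSing hz
    F.polarPart_fPart hd (hsq d hd) hb
  polarPart_h _ hz d hd :=
    have ⟨hz0, ha, _, hsq⟩ := F.notMem_foldSing hz
    F.polarPart_hPart hd hz0 (hsq d hd) ha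
  support_L := F.support_logPart_subset.trans (subset_foldSing _ _)
  support_f _ hd := support_partialFraction_subset.trans (Finset.insert_subset
    (sq_mem_foldSing hd _) (Finset.subset_union_right.trans (subset_foldSing _ _)))
  support_h _ hd := support_partialFraction_subset.trans (Finset.insert_subset
    (Finset.mem_insert_self _ _) (Finset.insert_subset (sq_mem_foldSing hd _)
      (Finset.subset_union_left.trans (subset_foldSing _ _))))

end FoldScale

/-- The bound for the coefficients of the data for folding a system with `m` singular points. -/
def foldConst (m : ℕ) : ℕ :=
  (3 * m + 1) * (2 * (3 * m + 1) + 1) * (2 * (3 * m + 1) * (2 * (3 * m + 1) + 1)) ^ m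

theorem two_le_foldConst (m : ℕ) : 2 ≤ foldConst m :=
  calc 2 ≤ 1 * (2 * 1 + 1) * 1 := by norm_num
    _ ≤ (3 * m + 1) * (2 * (3 * m + 1) + 1) * (2 * (3 * m + 1) * (2 * (3 * m + 1) + 1)) ^ m := by
      gcongr
      · omega
      · omega
      · exact Nat.one_le_pow _ _ (by positivity)

theorem exists_foldData {m : ℕ} {T : Finset ℂ} (hT : T.card ≤ m) :
    ∃ D : FoldData T, (∀ z ∈ D.E, z.im = 0) ∧ D.E.card ≤ 2 * m ∧ (∀ z, ‖D.L z‖ ≤ foldConst m) ∧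
      (∀ d ∈ T, ∀ z, ‖D.f d z‖ ≤ foldConst m) ∧ ∀ d ∈ T, ∀ z, ‖D.h d z‖ ≤ foldConst m := by
  obtain ⟨F⟩ := nonempty_foldScale hT
  refine ⟨F.foldData, fun z hz => ?_, ?_, fun z => ?_, fun d hd z => ?_, fun d hd z => ?_⟩
  · obtain hz | hz := Finset.mem_union.1 hz
    · exact (F.forall_mem_zeros (p := fun q => q.im = 0)).2 F.im_a z hz
    · exact (F.forall_mem_poles (p := fun q => q.im = 0)).2 F.im_b z hz
  · refine (Finset.card_union_le _ _).trans ?_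
    rw [F.card_zeros, F.card_poles, two_mul]
  · exact (F.norm_logPart_le z).trans (by exact_mod_cast two_le_foldConst m)
  · exact_mod_cast F.norm_fPart_le hd z
  · exact_mod_cast F.norm_hPart_le hd z

end FoldBounds

section Realification

variable {ι : Type*} [Fintype ι] {R : ℂ →₀ Matrix ι ι ℂ} {σ : Finset ℂ} {q : ℕ × ℕ × ℕ}

/-- The triple `q` bounds the system `R` with singular points in `σ`: its first component bounds
the size of the residue matrices, its second component the number of points in `σ`, and its third
component the entries of the residue matrices. -/
structure SystemBounds (R : ℂ →₀ Matrix ι ι ℂ) (σ : Finset ℂ) (q : ℕ × ℕ × ℕ) : Prop where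
  dim : Fintype.card ι ≤ q.1
  support : R.support ⊆ σ
  card : σ.card ≤ q.2.1
  norm : ∀ z i j, ‖R z i j‖ ≤ q.2.2

/-- The effect of one fold on the bounds of a system. -/
def foldStep (q : ℕ × ℕ × ℕ) : ℕ × ℕ × ℕ :=
  (2 * q.1 + 1, 3 * q.2.1 + 1,
    q.2.1 * (q.2.2 + foldConst q.2.1 * q.2.2 + foldConst q.2.1 * q.2.2) + foldConst q.2.1 + 1)

theorem FoldData.card_sing_le {T : Finset ℂ} (D : FoldData T) :
    D.sing.card ≤ D.E.card + T.card + 1 :=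
  (Finset.card_insert_le _ _).trans (Nat.succ_le_succ
    ((Finset.card_union_le _ _).trans (Nat.add_le_add_left Finset.card_image_le _)))

theorem SystemBounds.foldSystem [DecidableEq ι] {c : ℂ} {D : FoldData (σ.image (· - c))}
    (hq : SystemBounds R σ q) (hE : D.E.card ≤ 2 * q.2.1) (hL : ∀ z, ‖D.L z‖ ≤ foldConst q.2.1)
    (hf : ∀ d ∈ σ.image (· - c), ∀ z, ‖D.f d z‖ ≤ foldConst q.2.1)
    (hh : ∀ d ∈ σ.image (· - c), ∀ z, ‖D.h d z‖ ≤ foldConst q.2.1) :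
    SystemBounds (foldSystem R σ c D) D.sing (foldStep q) where
  dim := by
    have := hq.dim
    simp only [Fintype.card_sum, Fintype.card_unit, foldStep]
    omega
  support := support_foldSystem_subset
  card := by
    have hT : (σ.image (· - c)).card ≤ q.2.1 := Finset.card_image_le.trans hq.card
    have := D.card_sing_le
    simp only [foldStep]
    omega
  norm z i j := by
    have hσ : (σ.card : ℝ) ≤ q.2.1 := mod_cast hq.card
    refine (norm_foldSystem_le hq.norm (Nat.cast_nonneg _) hL hf hh z i j).trans ?_
    simp only [foldStep]
    push_cast
    gcongr

/-- The nonreal points of a finite set. -/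
noncomputable def nonrealPoints (σ : Finset ℂ) : Finset ℂ := σ.filter fun z => z.im ≠ 0

theorem mem_nonrealPoints {z : ℂ} : z ∈ nonrealPoints σ ↔ z ∈ σ ∧ z.im ≠ 0 :=
  Finset.mem_filter

theorem im_sq_eq_zero {z : ℂ} (h : z.re = 0 ∨ z.im = 0) : (z ^ 2).im = 0 := by
  rw [pow_two, Complex.mul_im]
  rcases h with h | h <;> rw [h] <;> ring

theorem nonrealPoints_image_sq_subset {c : ℂ} (hc : c.im = 0) :
    nonrealPoints (σ.image fun p => (p - c) ^ 2) ⊆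
      ((nonrealPoints σ).filter fun p => p.re ≠ c.re).image fun p => (p - c) ^ 2 := by
  intro z hz
  obtain ⟨hzσ, hz⟩ := mem_nonrealPoints.1 hz
  obtain ⟨p, hp, rfl⟩ := Finset.mem_image.1 hzσ
  have hre : p.re ≠ c.re := fun h => hz (im_sq_eq_zero (.inl (by simp [h])))
  have him : p.im ≠ 0 := fun h => hz (im_sq_eq_zero (.inr (by simp [h, hc])))
  exact Finset.mem_image_of_mem _ (Finset.mem_filter.2 ⟨mem_nonrealPoints.2 ⟨hp, him⟩, hre⟩)

/- With centre `p.re`, squaring maps `p` to a real number and keeps real points real. -/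
theorem exists_card_nonrealPoints_image_sq_le {k : ℕ} (hσ : (nonrealPoints σ).card ≤ k + 1) :
    ∃ c : ℂ, (nonrealPoints (σ.image fun p => (p - c) ^ 2)).card ≤ k := by
  rcases (nonrealPoints σ).eq_empty_or_nonempty with h | ⟨p, hp⟩
  · refine ⟨0, (Finset.card_le_card (nonrealPoints_image_sq_subset rfl)).trans ?_⟩
    simp [h]
  · refine ⟨(p.re : ℂ), (Finset.card_le_card
      (nonrealPoints_image_sq_subset (Complex.ofReal_im _))).trans (Finset.card_image_le.trans ?_)⟩
    have hlt := Finset.card_lt_card (Finset.filter_ssubset (p := fun z => z.re ≠ (p.re : ℂ).re).2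
      ⟨p, hp, by simp⟩)
    omega

theorem FoldData.nonrealPoints_sing_subset {T : Finset ℂ} (D : FoldData T)
    (hE : ∀ z ∈ D.E, z.im = 0) : nonrealPoints D.sing ⊆ nonrealPoints (T.image (· ^ 2)) := by
  intro z hz
  obtain ⟨hzs, hz⟩ := mem_nonrealPoints.1 hz
  refine mem_nonrealPoints.2 ⟨?_, hz⟩
  rcases Finset.mem_insert.1 hzs with rfl | hzs
  · exact absurd rfl hz
  · exact (Finset.mem_union.1 hzs).resolve_left fun hzE => hz (hE z hzE)

theorem SystemBounds.exists_foldSystem [DecidableEq ι] (hq : SystemBounds R σ q) {k : ℕ}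
    (hσ : (nonrealPoints σ).card ≤ k + 1) :
    ∃ (c : ℂ) (D : FoldData (σ.image (· - c))), (nonrealPoints D.sing).card ≤ k ∧
      SystemBounds (_root_.foldSystem R σ c D) D.sing (foldStep q) := by
  obtain ⟨c, hc⟩ := exists_card_nonrealPoints_image_sq_le hσ
  obtain ⟨D, him, hE, hL, hf, hh⟩ := exists_foldData
    (show (σ.image (· - c)).card ≤ q.2.1 from Finset.card_image_le.trans hq.card)
  refine ⟨c, D, (Finset.card_le_card (D.nonrealPoints_sing_subset him)).trans ?_,
    hq.foldSystem hE hL hf hh⟩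
  rwa [Finset.image_image]

theorem exists_dominates_forall_im_eq_zero.{u} (k : ℕ) : ∀ {ι : Type u} [Fintype ι]
    {R : ℂ →₀ Matrix ι ι ℂ} {σ : Finset ℂ} {q : ℕ × ℕ × ℕ}, SystemBounds R σ q →
    (nonrealPoints σ).card ≤ k →
    ∃ (P : Polynomial ℂ) (κ : Type u) (_ : Fintype κ) (R' : ℂ →₀ Matrix κ κ ℂ) (σ' : Finset ℂ),
      P.natDegree = 2 ^ k ∧ Dominates (fun t => P.eval t) R σ R' σ' ∧ (∀ z ∈ σ', z.im = 0) ∧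
      SystemBounds R' σ' (foldStep^[k] q) := by
  classical
  induction k with
  | zero =>
    intro ι _ R σ q hq hσ
    refine ⟨Polynomial.X, ι, inferInstance, R, σ, by simp, ?_, fun z hz => ?_, hq⟩
    · simp only [Polynomial.eval_X]
      exact Dominates.refl R σ
    · by_contra h
      exact Finset.notMem_empty z
        (Finset.card_eq_zero.1 (Nat.le_zero.1 hσ) ▸ mem_nonrealPoints.2 ⟨hz, h⟩)
  | succ k ih =>
    intro ι _ R σ q hq hσ
    obtain ⟨c, D, hnonreal, hbounds⟩ := hq.exists_foldSystem hσ
    obtain ⟨P, κ, _, R', σ', hP, hdom, hreal, hq'⟩ := ih hbounds hnonreal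
    refine ⟨P.comp ((Polynomial.X - Polynomial.C c) ^ 2), κ, inferInstance, R', σ', ?_, ?_, hreal,
      hq'⟩
    · rw [Polynomial.natDegree_comp, hP, Polynomial.natDegree_pow, Polynomial.natDegree_X_sub_C,
        pow_succ, mul_one]
    · convert (dominates_foldSystem hq.support).trans hdom using 1
      funext t
      simp

theorem exists_im_eq_zero_notMem (σ : Finset ℂ) : ∃ c : ℂ, c.im = 0 ∧ c ∉ σ := by
  obtain ⟨x, hx⟩ := Infinite.exists_notMem_finset (σ.image Complex.re)
  exact ⟨x, Complex.ofReal_im x, fun h => hx (Finset.mem_image.2 ⟨x, h, Complex.ofReal_re x⟩)⟩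

theorem im_eq_zero_of_mem_insert_mobiusPoints {c e : ℂ} (hσ : ∀ z ∈ σ, z.im = 0) (hc : c.im = 0)
    (he : e.im = 0) : ∀ z ∈ insert e (mobiusPoints σ c), z.im = 0 := by
  intro z hz
  simp only [mobiusPoints, Finset.mem_insert, Finset.mem_image] at hz
  rcases hz with rfl | rfl | ⟨p, hp, rfl⟩
  · exact he
  · rfl
  · simp [Complex.inv_im, hσ p hp, hc]

/-- The Fuchsian system on `ℂⁿ` given by residue matrices with entries indexed by a set of `n`
elements. -/
noncomputable def fuchsianSystemOfResidue (R : ℂ →₀ Matrix ι ι ℂ) :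
    FuchsianSystem (Fintype.card ι) :=
  ⟨R.mapRange (Matrix.reindexLinearEquiv ℂ ℂ (Fintype.equivFin ι) (Fintype.equivFin ι))
    (map_zero _)⟩

theorem poles_fuchsianSystemOfResidue : (fuchsianSystemOfResidue R).poles = R.support :=
  Finsupp.support_mapRange_of_injective (map_zero _) _ (LinearEquiv.injective _)

theorem residueInfty_fuchsianSystemOfResidue (h : ∑ a ∈ R.support, R a = 0) :
    (fuchsianSystemOfResidue R).residueInfty = 0 := by
  have hmap : ∑ a ∈ R.support, (fuchsianSystemOfResidue R).residue a =
      Matrix.reindexLinearEquiv ℂ ℂ (Fintype.equivFin ι) (Fintype.equivFin ι)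
        (∑ a ∈ R.support, R a) := by
    rw [map_sum]
    rfl
  rw [FuchsianSystem.residueInfty, poles_fuchsianSystemOfResidue, hmap, h, map_zero, neg_zero]

theorem dominates_fuchsianSystemOfResidue (R : ℂ →₀ Matrix ι ι ℂ) (σ : Finset ℂ) :
    Dominates id R σ (fuchsianSystemOfResidue R).residue σ :=
  dominates_reindex _ R σ

/-- The bound for the entries of the residues of the system obtained by a Möbius map from a system
with bounds `q`. -/
def mobiusEntryBound (q : ℕ × ℕ × ℕ) : ℕ := q.2.1 * (2 * q.2.2) + (q.2.1 + 1) * 2 + 2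

theorem SystemBounds.norm_mobiusSystem_le [DecidableEq ι] (hq : SystemBounds R σ q) (c e z : ℂ)
    (i j : Bool ⊕ ι) : ‖mobiusSystem R σ c e z i j‖ ≤ mobiusEntryBound q := by
  have hσ : (σ.card : ℝ) ≤ q.2.1 := mod_cast hq.card
  refine (_root_.norm_mobiusSystem_le σ c e hq.norm (Nat.cast_nonneg _) z i j).trans ?_
  simp only [mobiusEntryBound]
  push_cast
  gcongr

theorem SystemBounds.exists_fuchsianSystem (hq : SystemBounds R σ q) (hσ : ∀ z ∈ σ, z.im = 0) :
    ∃ (c : ℂ) (n' : ℕ) (S' : FuchsianSystem n'),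
      Dominates (fun z => (z - c)⁻¹) R σ S'.residue S'.poles ∧ n' ≤ 2 * (q.1 + 2) ∧
      S'.poles.card ≤ q.2.1 + 2 ∧ (∀ z i j, ‖S'.residue z i j‖ ≤ mobiusEntryBound q) ∧
      (∀ z ∈ S'.poles, z.im = 0) ∧ S'.residueInfty = 0 ∧ ∀ z i j, (S'.residue z i j).im = 0 := by
  classical
  obtain ⟨c, hc0, hc⟩ := exists_im_eq_zero_notMem σ
  obtain ⟨e, he0, he⟩ := exists_im_eq_zero_notMem (mobiusPoints σ c)
  have hsupp := support_mobiusSystem (R := R) he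
  have hreal := im_eq_zero_of_mem_insert_mobiusPoints hσ hc0 he0
  have hpoles : (fuchsianSystemOfResidue (realification (mobiusSystem R σ c e))).poles =
      insert e (mobiusPoints σ c) := by
    rw [poles_fuchsianSystemOfResidue, support_realification, hsupp]
  refine ⟨c, _, fuchsianSystemOfResidue (realification (mobiusSystem R σ c e)), ?_, ?_, ?_,
    fun z i j => ?_, hpoles ▸ hreal,
    residueInfty_fuchsianSystemOfResidue (sum_realification (sum_mobiusSystem R σ c e)),
    fun z i j => im_realification _ z _ _⟩
  · rw [hpoles]
    exact ((dominates_mobiusSystem hq.support hc he).trans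
      (dominates_realification (hsupp ▸ hreal) hreal)).trans
      (dominates_fuchsianSystemOfResidue _ _)
  · have := hq.dim
    simp only [Fintype.card_sum, Fintype.card_bool]
    omega
  · rw [hpoles, ← hsupp]
    exact (card_support_mobiusSystem_le he).trans (Nat.add_le_add_right hq.card 2)
  · exact norm_realification_le (hq.norm_mobiusSystem_le c e) z _ _

end Realification

section Height

attribute [local instance] Matrix.linftyOpNormedAddCommGroup Matrix.linftyOpSeminormedAddCommGroup

variable {l n α : Type*} [Fintype l] [Fintype n]

theorem norm_entry_le_linftyOpNorm [SeminormedAddCommGroup α] (A : Matrix l n α) (i : l) (j : n) :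
    ‖A i j‖ ≤ ‖A‖ := by
  rw [Matrix.linfty_opNorm_def]
  have hrow : ‖A i j‖₊ ≤ ∑ k, ‖A i k‖₊ :=
    Finset.single_le_sum (f := fun k => ‖A i k‖₊) (fun _ _ => zero_le) (Finset.mem_univ j)
  exact NNReal.coe_le_coe.2
    (hrow.trans (Finset.le_sup (f := fun i => ∑ k, ‖A i k‖₊) (Finset.mem_univ i)))

theorem linftyOpNorm_le [SeminormedAddCommGroup α] {A : Matrix l n α} {C : ℝ} (hC : 0 ≤ C)
    (h : ∀ i j, ‖A i j‖ ≤ C) : ‖A‖ ≤ Fintype.card n * C := by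
  lift C to NNReal using hC
  rw [Matrix.linfty_opNorm_def, ← NNReal.coe_natCast, ← NNReal.coe_mul, NNReal.coe_le_coe,
    ← nsmul_eq_mul]
  exact Finset.sup_le fun i _ => Finset.sum_le_card_nsmul _ _ C fun j _ => h i j

namespace FuchsianSystem

variable {n : ℕ} {S : FuchsianSystem n}

theorem norm_residue_le_height (z : ℂ) : ‖S.residue z‖ ≤ S.height := by
  refine le_trans ?_ (le_add_of_nonneg_right (norm_nonneg _))
  by_cases hz : z ∈ S.poles
  · exact Finset.single_le_sum (f := fun a => ‖S.residue a‖) (fun _ _ => norm_nonneg _) hz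
  · rw [Finsupp.notMem_support_iff.1 hz, norm_zero]
    exact Finset.sum_nonneg fun _ _ => norm_nonneg _

theorem InClass.systemBounds {m r : ℕ} (h : S.InClass m r) :
    SystemBounds S.residue S.poles (n, m, r) where
  dim := (Fintype.card_fin n).le
  support := subset_rfl
  card := (Nat.le_add_right _ _).trans h.1
  norm z i j := (norm_entry_le_linftyOpNorm _ i j).trans ((S.norm_residue_le_height z).trans h.2)

theorem inClass_of_bounds {m N C : ℕ} (hm : S.poles.card ≤ m) (hn : n ≤ N)
    (hC : ∀ z i j, ‖S.residue z i j‖ ≤ C) (hinf : S.residueInfty = 0) :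
    S.InClass m (m * (N * C)) := by
  refine ⟨by simpa [numSingular, hinf] using hm, ?_⟩
  have hn' : (n : ℝ) ≤ N := mod_cast hn
  have hm' : (S.poles.card : ℝ) ≤ m := mod_cast hm
  calc S.height = ∑ a ∈ S.poles, ‖S.residue a‖ := by
        rw [height, hinf, norm_zero, add_zero]
    _ ≤ ∑ _a ∈ S.poles, (n * C : ℝ) := Finset.sum_le_sum fun a _ => by
        simpa using linftyOpNorm_le C.cast_nonneg (hC a)
    _ = S.poles.card * (n * C) := by rw [Finset.sum_const, nsmul_eq_mul]
    _ ≤ (m * (N * C) : ℕ) := by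
        push_cast
        gcongr

end FuchsianSystem

end Height

/-- The bounds of a system whose singular points are made real by one fold for each of them. -/
def foldedBounds (q : ℕ × ℕ × ℕ) : ℕ × ℕ × ℕ := foldStep^[q.2.1] q

/-- The bound for the dimension of the real system dominating a system with bounds `q`. -/
def dimBound (q : ℕ × ℕ × ℕ) : ℕ := 2 * ((foldedBounds q).1 + 2)

/-- The bound for the number of singular points of the real system dominating a system with bounds
`q`. -/
def singularBound (q : ℕ × ℕ × ℕ) : ℕ := (foldedBounds q).2.1 + 2

/-- The bound for the height of the real system dominating a system with bounds `q`. -/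
def heightBound (q : ℕ × ℕ × ℕ) : ℕ :=
  singularBound q * (dimBound q * mobiusEntryBound (foldedBounds q))

theorem FuchsianSystem.InClass.exists_dominates {n m r : ℕ} {S : FuchsianSystem n}
    (hS : S.InClass m r) :
    ∃ (q : Polynomial ℂ) (n' : ℕ) (S' : FuchsianSystem n'), q.natDegree = 2 ^ m ∧
      Dominates (fun t => (q.eval t)⁻¹) S.residue S.poles S'.residue S'.poles ∧
      n' ≤ dimBound (n, m, r) ∧ S'.InClass (singularBound (n, m, r)) (heightBound (n, m, r)) ∧
      (∀ z ∈ S'.poles, z.im = 0) ∧ S'.residueInfty = 0 ∧ ∀ z i j, (S'.residue z i j).im = 0 := by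
  have hq := hS.systemBounds
  obtain ⟨P, κ, _, R', σ', hP, hdom, hreal, hq'⟩ :=
    exists_dominates_forall_im_eq_zero m hq ((Finset.card_filter_le _ _).trans hq.card)
  obtain ⟨c, n', S', hdom', hdim, hcard, hnorm, hreal', hinf, him⟩ :=
    hq'.exists_fuchsianSystem hreal
  refine ⟨P - Polynomial.C c, n', S', by rw [Polynomial.natDegree_sub_C, hP], ?_, hdim,
    inClass_of_bounds hcard hdim hnorm hinf, hreal', hinf, him⟩
  simpa only [Polynomial.eval_sub, Polynomial.eval_C, Function.comp_def] using hdom.trans hdom'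

section Primrec

variable {α : Type*} [Primcodable α] {f g : α → ℕ}

theorem primrec_add (hf : Primrec f) (hg : Primrec g) : Primrec fun a => f a + g a :=
  Primrec.nat_add.comp hf hg

theorem primrec_mul (hf : Primrec f) (hg : Primrec g) : Primrec fun a => f a * g a :=
  Primrec.nat_mul.comp hf hg

theorem primrec_pow (hf : Primrec f) (hg : Primrec g) : Primrec fun a => f a ^ g a :=
  (Primrec₂.unpaired'.1 Nat.Primrec.pow).comp hf hg

end Primrec

theorem primrec_foldConst : Primrec foldConst := by
  have hL : Primrec fun m : ℕ => 3 * m + 1 :=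
    primrec_add (primrec_mul (.const 3) .id) (.const 1)
  have hL₂ : Primrec fun m : ℕ => 2 * (3 * m + 1) := primrec_mul (.const 2) hL
  have hK : Primrec fun m : ℕ => 2 * (3 * m + 1) + 1 := primrec_add hL₂ (.const 1)
  exact primrec_mul (primrec_mul hL hK) (primrec_pow (primrec_mul hL₂ hK) .id)

theorem primrec_snd_fst : Primrec fun q : ℕ × ℕ × ℕ => q.2.1 := Primrec.fst.comp .snd

theorem primrec_snd_snd : Primrec fun q : ℕ × ℕ × ℕ => q.2.2 := Primrec.snd.comp .snd

theorem primrec_foldStep : Primrec foldStep := by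
  have hC : Primrec fun q : ℕ × ℕ × ℕ => foldConst q.2.1 := primrec_foldConst.comp primrec_snd_fst
  have hCr := primrec_mul hC primrec_snd_snd
  exact .pair (primrec_add (primrec_mul (.const 2) .fst) (.const 1))
    (.pair (primrec_add (primrec_mul (.const 3) primrec_snd_fst) (.const 1))
      (primrec_add (primrec_add (primrec_mul primrec_snd_fst
        (primrec_add (primrec_add primrec_snd_snd hCr) hCr)) hC) (.const 1)))

theorem primrec_foldedBounds : Primrec foldedBounds :=
  Primrec.nat_iterate primrec_snd_fst .id (primrec_foldStep.comp .snd).to₂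

theorem primrec_mobiusEntryBound : Primrec mobiusEntryBound :=
  primrec_add (primrec_add (primrec_mul primrec_snd_fst (primrec_mul (.const 2) primrec_snd_snd))
    (primrec_mul (primrec_add primrec_snd_fst (.const 1)) (.const 2))) (.const 2)

theorem primrec_dimBound : Primrec dimBound :=
  primrec_mul (.const 2) (primrec_add (Primrec.fst.comp primrec_foldedBounds) (.const 2))

theorem primrec_singularBound : Primrec singularBound :=
  primrec_add (primrec_snd_fst.comp primrec_foldedBounds) (.const 2)

theorem primrec_heightBound : Primrec heightBound :=
  primrec_mul primrec_singularBound (primrec_mul primrec_dimBound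
    (primrec_mobiusEntryBound.comp primrec_foldedBounds))

section Homogenization

variable {ι κ K : Type*} [CommSemiring K] {d : ℕ} {ℓ₁ : MvPolynomial κ K}
  {ℓ : ι → MvPolynomial κ K} {P : MvPolynomial ι K}

/-- The polynomial obtained from a polynomial `P` of degree at most `d` by substituting
`ℓ i / ℓ₁` for the variables and multiplying by `ℓ₁ ^ d`. -/
noncomputable def substHomogeneous (d : ℕ) (ℓ₁ : MvPolynomial κ K) (ℓ : ι → MvPolynomial κ K)
    (P : MvPolynomial ι K) : MvPolynomial κ K :=
  ∑ s ∈ P.support, MvPolynomial.C (P.coeff s) * ℓ₁ ^ (d - s.degree) * s.prod fun i e => ℓ i ^ e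

theorem totalDegree_prod_pow_le (hℓ : ∀ i, (ℓ i).totalDegree ≤ 1) (s : ι →₀ ℕ) :
    (s.prod fun i e => ℓ i ^ e).totalDegree ≤ s.degree :=
  (MvPolynomial.totalDegree_finsetProd _ _).trans <| Finset.sum_le_sum fun i _ =>
    (MvPolynomial.totalDegree_pow _ _).trans (mul_le_of_le_one_right (Nat.zero_le _) (hℓ i))

theorem totalDegree_substHomogeneous_le (hℓ₁ : ℓ₁.totalDegree ≤ 1)
    (hℓ : ∀ i, (ℓ i).totalDegree ≤ 1) (hP : P.totalDegree ≤ d) :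
    (substHomogeneous d ℓ₁ ℓ P).totalDegree ≤ d := by
  refine MvPolynomial.totalDegree_finsetSum_le fun s hs => ?_
  have hs : s.degree ≤ d := (MvPolynomial.le_totalDegree hs).trans hP
  calc (MvPolynomial.C (P.coeff s) * ℓ₁ ^ (d - s.degree) * s.prod fun i e => ℓ i ^ e).totalDegree
      ≤ (MvPolynomial.C (P.coeff s)).totalDegree + (ℓ₁ ^ (d - s.degree)).totalDegree +
        (s.prod fun i e => ℓ i ^ e).totalDegree :=
        (MvPolynomial.totalDegree_mul _ _).trans
          (Nat.add_le_add_right (MvPolynomial.totalDegree_mul _ _) _)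
    _ ≤ 0 + (d - s.degree) * 1 + s.degree := by
        gcongr
        · rw [MvPolynomial.totalDegree_C]
        · exact (MvPolynomial.totalDegree_pow _ _).trans (Nat.mul_le_mul_left _ hℓ₁)
        · exact totalDegree_prod_pow_le hℓ s
    _ = d := by omega

theorem eval₂_substHomogeneous {A : Type*} [CommSemiring A] (f : K →+* A) (hP : P.totalDegree ≤ d)
    {x : κ → A} {y : ι → A} {w : A} (hℓ₁ : ℓ₁.eval₂ f x = w)
    (hℓ : ∀ i, (ℓ i).eval₂ f x = w * y i) :
    (substHomogeneous d ℓ₁ ℓ P).eval₂ f x = w ^ d * P.eval₂ f y := by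
  rw [MvPolynomial.eval₂_eq f y P, substHomogeneous, MvPolynomial.eval₂_sum, Finset.mul_sum]
  refine Finset.sum_congr rfl fun s hs => ?_
  have hs : s.degree ≤ d := (MvPolynomial.le_totalDegree hs).trans hP
  have hprod : (s.prod fun i e => ℓ i ^ e).eval₂ f x =
      w ^ s.degree * ∏ i ∈ s.support, y i ^ s i := by
    simp only [Finsupp.prod, MvPolynomial.eval₂_prod, MvPolynomial.eval₂_pow, hℓ, mul_pow,
      Finset.prod_mul_distrib, Finset.prod_pow_eq_pow_sum, Finsupp.degree_apply]
  rw [MvPolynomial.eval₂_mul, MvPolynomial.eval₂_mul, MvPolynomial.eval₂_C,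
    MvPolynomial.eval₂_pow, hℓ₁, hprod, ← pow_sub_mul_pow w hs]
  ring

end Homogenization

namespace PuncturedGerm

variable {ι κ : Type} {a b : ℂ}

theorem isUnit_coe {v : ℂ → ℂ} (hv : ∀ᶠ z in 𝓝[≠] b, v z ≠ 0) : IsUnit (v : PuncturedGerm b) := by
  refine IsUnit.of_mul_eq_one ((v⁻¹ : ℂ → ℂ) : PuncturedGerm b) (Germ.coe_eq.2 ?_)
  filter_upwards [hv] with z hz using mul_inv_cancel₀ hz

theorem mul_div_mul_left_of_isUnit {w : PuncturedGerm b} (hw : IsUnit w) (f g : PuncturedGerm b) :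
    w * f / (w * g) = f / g := by
  obtain ⟨w', hw'⟩ := isUnit_iff_exists_inv.1 hw
  induction w, w' using Germ.inductionOn₂ with | _ w w'
  induction f, g using Germ.inductionOn₂ with | _ f g
  refine Germ.coe_eq.2 ?_
  filter_upwards [Germ.coe_eq.1 hw'] with z hz
  exact mul_div_mul_left (f z) (g z) (left_ne_zero_of_mul_eq_one hz)

theorem evalPoly_coe (G : ι → ℂ → ℂ) (P : MvPolynomial ι ℂ) :
    evalPoly (fun k => (G k : PuncturedGerm b)) P =
      ((fun t => P.eval fun k => G k t : ℂ → ℂ) : PuncturedGerm b) := by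
  rw [evalPoly]
  induction P using MvPolynomial.induction_on with
  | C c =>
    simp only [MvPolynomial.eval₂_C, MvPolynomial.eval_C]
    rfl
  | add p q hp hq =>
    simp only [MvPolynomial.eval₂_add, map_add, hp, hq]
    rfl
  | mul_X p k hp =>
    simp only [MvPolynomial.eval₂_mul, MvPolynomial.eval₂_X, map_mul, MvPolynomial.eval_X, hp]
    rfl

/- Multiplying numerator and denominator of `f` by `evalPoly y ℓ₁ ^ d` clears the denominators of
`x k = evalPoly y (ℓ k) / evalPoly y ℓ₁`; this is why the `ℓ k` share a denominator. -/
theorem DegreeLE.of_linear {x : ι → PuncturedGerm b} {y : κ → PuncturedGerm b} {d : ℕ}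
    {f : PuncturedGerm b} {ℓ₁ : MvPolynomial κ ℂ} {ℓ : ι → MvPolynomial κ ℂ}
    (hℓ₁ : ℓ₁.totalDegree ≤ 1) (hℓ : ∀ k, (ℓ k).totalDegree ≤ 1) (hunit : IsUnit (evalPoly y ℓ₁))
    (hx : ∀ k, evalPoly y (ℓ k) = evalPoly y ℓ₁ * x k) (hf : DegreeLE x d f) :
    DegreeLE y d f := by
  obtain ⟨P, Q, hP, hQ, hQ0, rfl⟩ := hf
  have heval {A : MvPolynomial ι ℂ} (hA : A.totalDegree ≤ d) :
      evalPoly y (substHomogeneous d ℓ₁ ℓ A) = evalPoly y ℓ₁ ^ d * evalPoly x A :=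
    eval₂_substHomogeneous (constHom b) hA rfl hx
  refine ⟨substHomogeneous d ℓ₁ ℓ P, substHomogeneous d ℓ₁ ℓ Q,
    totalDegree_substHomogeneous_le hℓ₁ hℓ hP, totalDegree_substHomogeneous_le hℓ₁ hℓ hQ, ?_, ?_⟩
  · rwa [heval hQ, Ne, (hunit.pow d).mul_right_eq_zero]
  · rw [heval hP, heval hQ, mul_div_mul_left_of_isUnit (hunit.pow d)]

end PuncturedGerm

section Generators

variable {n : ℕ} {S : FuchsianSystem n} {b : ℂ} {X : ℂ → Matrix (Fin n) (Fin n) ℂ}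

/-- The functions whose germs are the generators of `ℂ(X)`: the independent variable (index `none`)
and the entries of `X`. -/
def pvFun (X : ℂ → Matrix (Fin n) (Fin n) ℂ) : Option (Fin n × Fin n) → ℂ → ℂ
  | none => fun t => t
  | some ij => fun t => X t ij.1 ij.2

theorem pvGenerators_eq_coe_pvFun (X : ℂ → Matrix (Fin n) (Fin n) ℂ) (b : ℂ) :
    pvGenerators X b = fun k => (pvFun X k : PuncturedGerm b) := by
  funext k
  cases k <;> rfl

theorem evalPoly_pvGenerators (X : ℂ → Matrix (Fin n) (Fin n) ℂ) (b : ℂ)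
    (P : MvPolynomial (Option (Fin n × Fin n)) ℂ) :
    PuncturedGerm.evalPoly (pvGenerators X b) P =
      ((fun t => P.eval fun k => pvFun X k t : ℂ → ℂ) : PuncturedGerm b) := by
  rw [pvGenerators_eq_coe_pvFun, PuncturedGerm.evalPoly_coe]

namespace FuchsianSystem

theorem IsSolutionNear.analyticAt_pvFun (hX : S.IsSolutionNear b X)
    (k : Option (Fin n × Fin n)) : AnalyticAt ℂ (pvFun X k) b :=
  match k with
  | none => analyticAt_id
  | some (i, j) => Complex.analyticAt_iff_eventually_differentiableAt.2 <|
      hX.mono fun _ ht => (ht i j).differentiableAt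

theorem IsSolutionNear.pvFun_mem_affineSolutionSpan (hX : S.IsSolutionNear b X)
    (k : Option (Fin n × Fin n)) : pvFun X k ∈ affineSolutionSpan S.residue b :=
  match k with
  | none => id_mem_affineSolutionSpan _ _
  | some (i, j) => (isSolutionNear_iff_isVecSolution.1 hX j).mem_affineSolutionSpan i

theorem IsSolutionNear.eventually_eval_pvFun_ne_zero (hX : S.IsSolutionNear b X)
    {Q : MvPolynomial (Option (Fin n × Fin n)) ℂ}
    (hQ : PuncturedGerm.evalPoly (pvGenerators X b) Q ≠ 0) :
    ∀ᶠ t in 𝓝[≠] b, (Q.eval fun k => pvFun X k t) ≠ 0 := by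
  rw [evalPoly_pvGenerators] at hQ
  have hanalytic : AnalyticAt ℂ (fun t => Q.eval fun k => pvFun X k t) b := by
    simp only [MvPolynomial.eval_eq]
    exact Finset.analyticAt_fun_sum _ fun s _ => analyticAt_const.mul <|
      Finset.analyticAt_fun_prod _ fun k _ => (hX.analyticAt_pvFun k).pow _
  refine hanalytic.eventually_eq_zero_or_eventually_ne_zero.resolve_left fun hzero => hQ ?_
  exact Germ.coe_eq.2 (hzero.filter_mono nhdsWithin_le_nhds)

theorem IsFundamentalAt.exists_eventually_eq_mulVec (hX : S.IsFundamentalAt b X) (hb : b ∉ S.poles)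
    {x : ℂ → Fin n → ℂ} (hx : IsVecSolution S.residue b x) :
    ∃ c : Fin n → ℂ, ∀ᶠ z in 𝓝 b, X z *ᵥ c = x z := by
  refine ⟨(X b)⁻¹ *ᵥ x b, (hX.1.mulVec _).eventually_eq hx hb ?_⟩
  rw [Matrix.mulVec_mulVec, Matrix.mul_nonsing_inv _ hX.2.isUnit, Matrix.one_mulVec]

theorem exists_linear_eval_pvFun_eq_mulVec (X : ℂ → Matrix (Fin n) (Fin n) ℂ) (c : Fin n → ℂ)
    (i : Fin n) : ∃ ℓ : MvPolynomial (Option (Fin n × Fin n)) ℂ, ℓ.totalDegree ≤ 1 ∧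
      ∀ z, (ℓ.eval fun k => pvFun X k z) = (X z *ᵥ c) i := by
  refine ⟨∑ j, MvPolynomial.C (c j) * MvPolynomial.X (some (i, j)),
    MvPolynomial.totalDegree_finsetSum_le fun j _ => ?_, fun z => ?_⟩
  · exact (MvPolynomial.totalDegree_mul _ _).trans (by simp)
  · simp [Matrix.mulVec, dotProduct, pvFun, mul_comm]

theorem IsFundamentalAt.exists_linear (hX : S.IsFundamentalAt b X) (hb : b ∉ S.poles) {F : ℂ → ℂ}
    (hF : F ∈ affineSolutionSpan S.residue b) :
    ∃ ℓ : MvPolynomial (Option (Fin n × Fin n)) ℂ, ℓ.totalDegree ≤ 1 ∧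
      ∀ᶠ z in 𝓝 b, (ℓ.eval fun k => pvFun X k z) = F z := by
  induction hF using Submodule.span_induction with
  | mem F hF =>
    obtain (rfl | rfl) | ⟨x, i, hx, rfl⟩ := hF
    · exact ⟨1, by simp, by simp⟩
    · exact ⟨MvPolynomial.X none, by simp, by simp [pvFun]⟩
    · obtain ⟨c, hc⟩ := hX.exists_eventually_eq_mulVec hb hx
      obtain ⟨ℓ, hdeg, hℓ⟩ := exists_linear_eval_pvFun_eq_mulVec X c i
      exact ⟨ℓ, hdeg, hc.mono fun z hz => by rw [hℓ, hz]⟩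
  | zero => exact ⟨0, by simp, by simp⟩
  | add F G _ _ hF hG =>
    obtain ⟨ℓ, hdeg, hℓ⟩ := hF
    obtain ⟨ℓ', hdeg', hℓ'⟩ := hG
    refine ⟨ℓ + ℓ', (MvPolynomial.totalDegree_add _ _).trans (max_le hdeg hdeg'), ?_⟩
    filter_upwards [hℓ, hℓ'] with z hz hz'
    rw [map_add, hz, hz', Pi.add_apply]
  | smul c F _ hF =>
    obtain ⟨ℓ, hdeg, hℓ⟩ := hF
    refine ⟨c • ℓ, (MvPolynomial.totalDegree_smul_le _ _).trans hdeg, ?_⟩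
    filter_upwards [hℓ] with z hz
    rw [MvPolynomial.smul_eval, hz, Pi.smul_apply, smul_eq_mul]

end FuchsianSystem

end Generators

section Pullback

variable {φ : RatFunc ℂ} {ψ : ℂ → ℂ} {a b : ℂ} {n n' : ℕ} {S : FuchsianSystem n}
  {S' : FuchsianSystem n'} {X : ℂ → Matrix (Fin n) (Fin n) ℂ} {Y : ℂ → Matrix (Fin n') (Fin n') ℂ}
  {Φ : ℂ → ℂ} {f : PuncturedGerm a} {d : ℕ}

namespace IsInverseBranch

theorem pullback_div (hψ : IsInverseBranch φ ψ b a) (f g : PuncturedGerm a) :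
    hψ.pullback (f / g) = hψ.pullback f / hψ.pullback g :=
  Germ.inductionOn₂ f g fun _ _ => rfl

theorem pullback_evalPoly_pvGenerators (hψ : IsInverseBranch φ ψ b a)
    (X : ℂ → Matrix (Fin n) (Fin n) ℂ) (P : MvPolynomial (Option (Fin n × Fin n)) ℂ) :
    hψ.pullback (PuncturedGerm.evalPoly (pvGenerators X a) P) =
      PuncturedGerm.evalPoly (fun k => hψ.pullback (pvGenerators X a k)) P := by
  rw [pvGenerators_eq_coe_pvFun, PuncturedGerm.evalPoly_coe]
  exact (PuncturedGerm.evalPoly_coe (fun k z => pvFun X k (ψ z)) P).symm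

theorem degreeLE_pullback (hψ : IsInverseBranch φ ψ b a) (hX : S.IsSolutionNear a X)
    (hf : PVDegreeLE X a d f) :
    PuncturedGerm.DegreeLE (fun k => hψ.pullback (pvGenerators X a k)) d (hψ.pullback f) := by
  obtain ⟨P, Q, hP, hQ, hQ0, rfl⟩ := hf
  refine ⟨P, Q, hP, hQ, ?_, ?_⟩
  · rw [← hψ.pullback_evalPoly_pvGenerators, evalPoly_pvGenerators]
    exact (PuncturedGerm.isUnit_coe
      (hψ.tendsto.eventually (hX.eventually_eval_pvFun_ne_zero hQ0))).ne_zero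
  · simp only [pullback_div, pullback_evalPoly_pvGenerators]

theorem pullback_pvField (hψ : IsInverseBranch φ ψ b a) (hX : S.IsSolutionNear a X) :
    hψ.pullback '' pvField X a =
      PuncturedGerm.generatedField fun k => hψ.pullback (pvGenerators X a k) := by
  ext g
  constructor
  · rintro ⟨f, ⟨d, hf⟩, rfl⟩
    exact ⟨d, hψ.degreeLE_pullback hX hf⟩
  · rintro ⟨d, P, Q, hP, hQ, hQ0, rfl⟩
    refine ⟨_, ⟨d, P, Q, hP, hQ, fun h => hQ0 ?_, rfl⟩, ?_⟩
    · rw [← hψ.pullback_evalPoly_pvGenerators, h]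
      rfl
    · simp only [pullback_div, pullback_evalPoly_pvGenerators]

end IsInverseBranch

theorem Dominates.exists_linear
    (hdom : Dominates Φ S.residue S.poles S'.residue S'.poles) (hψ : ContinuousAt ψ b)
    (hΦ : ∀ᶠ z in 𝓝 b, Φ (ψ z) = z) (hb : b ∉ S'.poles) (hY : S'.IsFundamentalAt b Y) :
    ∃ v : ℂ → ℂ, (∀ᶠ z in 𝓝 b, v z ≠ 0) ∧ ∀ g ∈ affineSolutionSpan S.residue (ψ b),
      ∃ ℓ : MvPolynomial (Option (Fin n' × Fin n')) ℂ, ℓ.totalDegree ≤ 1 ∧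
        ∀ᶠ z in 𝓝 b, (ℓ.eval fun k => pvFun Y k z) = v z * g (ψ z) := by
  have hbase : Φ (ψ b) = b := hΦ.self_of_nhds
  obtain ⟨v, hv, hlift⟩ := hdom.lift (ψ b) (hbase.symm ▸ hb)
  refine ⟨v ∘ ψ, hψ.eventually hv, fun g hg => ?_⟩
  obtain ⟨F, hF, hFg⟩ := hlift g hg
  rw [hbase] at hF
  obtain ⟨ℓ, hℓ, hℓF⟩ := hY.exists_linear hb hF
  refine ⟨ℓ, hℓ, ?_⟩
  filter_upwards [hℓF, hΦ, hψ.eventually hFg] with z hzℓ hzΦ hzF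
  rw [hzℓ, Function.comp_apply, ← hzF, hzΦ]

theorem Dominates.pvDegreeLE_pullback
    (hdom : Dominates Φ S.residue S.poles S'.residue S'.poles) (hψ : IsInverseBranch φ ψ b a)
    (hΦ : ∀ᶠ z in 𝓝 b, Φ (ψ z) = z) (hb : b ∉ S'.poles) (hX : S.IsSolutionNear a X)
    (hY : S'.IsFundamentalAt b Y) (hf : PVDegreeLE X a d f) :
    PVDegreeLE Y b d (hψ.pullback f) := by
  obtain rfl := hψ.map_base
  obtain ⟨v, hv, hlin⟩ := hdom.exists_linear hψ.analyticAt.continuousAt hΦ hb hY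
  obtain ⟨ℓ₁, hℓ₁, heval₁⟩ := hlin _ (one_mem_affineSolutionSpan _ _)
  choose ℓ hℓ heval using fun k => hlin _ (hX.pvFun_mem_affineSolutionSpan k)
  have hv₁ : PuncturedGerm.evalPoly (pvGenerators Y b) ℓ₁ = (v : PuncturedGerm b) := by
    rw [evalPoly_pvGenerators, Germ.coe_eq]
    filter_upwards [heval₁.filter_mono nhdsWithin_le_nhds] with z hz
    rw [hz, mul_one]
  refine .of_linear hℓ₁ hℓ (hv₁ ▸ PuncturedGerm.isUnit_coe (hv.filter_mono nhdsWithin_le_nhds))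
    (fun k => ?_) (hψ.degreeLE_pullback hX hf)
  rw [hv₁, evalPoly_pvGenerators, pvGenerators_eq_coe_pvFun]
  exact Germ.coe_eq.2 ((heval k).filter_mono nhdsWithin_le_nhds)

end Pullback

section RationalMap

theorem num_inv_algebraMap_mul {K : Type*} [Field K] {q : Polynomial K} (hq : q ≠ 0) :
    ((algebraMap (Polynomial K) (RatFunc K) q)⁻¹).num * q =
      ((algebraMap (Polynomial K) (RatFunc K) q)⁻¹).denom := by
  rw [(RatFunc.num_mul_eq_mul_denom_iff (p := 1) hq).2 (by rw [map_one, one_div]), one_mul]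

variable {q : Polynomial ℂ}

theorem ratMapDegree_inv_algebraMap (hq : q ≠ 0) :
    ratMapDegree (algebraMap (Polynomial ℂ) (RatFunc ℂ) q)⁻¹ = q.natDegree := by
  have hdenom := num_inv_algebraMap_mul hq
  have hnum : IsUnit ((algebraMap (Polynomial ℂ) (RatFunc ℂ) q)⁻¹).num :=
    (RatFunc.isCoprime_num_denom _).isUnit_of_dvd' dvd_rfl ⟨q, hdenom.symm⟩
  rw [ratMapDegree, ← hdenom, Polynomial.natDegree_mul hnum.ne_zero hq,
    Polynomial.natDegree_eq_zero_of_isUnit hnum, zero_add, Nat.zero_max]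

theorem IsInverseBranch.inv_eval (hq : q ≠ 0) {ψ : ℂ → ℂ} {a b : ℂ}
    (hψ : IsInverseBranch (algebraMap (Polynomial ℂ) (RatFunc ℂ) q)⁻¹ ψ b a) :
    ∀ᶠ z in 𝓝 b, (q.eval (ψ z))⁻¹ = z := by
  filter_upwards [hψ.right_inverse] with z ⟨hdenom, heval⟩
  rw [← num_inv_algebraMap_mul hq, Polynomial.eval_mul] at hdenom
  rwa [RatFunc.eval, Polynomial.eval₂_id, Polynomial.eval₂_id, ← num_inv_algebraMap_mul hq,
    Polynomial.eval_mul, div_mul_cancel_left₀ (left_ne_zero_of_mul hdenom)] at heval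

end RationalMap

theorem mainTheorem9 :
    ∃ D N M R : ℕ × ℕ × ℕ → ℕ, Primrec D ∧ Primrec N ∧ Primrec M ∧ Primrec R ∧
      ∀ (n m r : ℕ) (S : FuchsianSystem n), S.InClass m r →
        ∃ (φ : RatFunc ℂ) (n' : ℕ) (S' : FuchsianSystem n'),
          -- `φ` is a nonconstant rational map; its degree and the parameters of the new field
          -- are computably bounded
          1 ≤ ratMapDegree φ ∧ ratMapDegree φ ≤ D (n, m, r) ∧
          n' ≤ N (n, m, r) ∧ S'.InClass (M (n, m, r)) (R (n, m, r)) ∧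
          -- for every branch `ψ` of the inverse of `φ` and all fundamental solutions `X`, `Y`:
          (∀ (b a : ℂ) (ψ : ℂ → ℂ) (hψ : IsInverseBranch φ ψ b a),
            b ∉ S'.poles → a ∉ S.poles →
            ∀ (X : ℂ → Matrix (Fin n) (Fin n) ℂ) (Y : ℂ → Matrix (Fin n') (Fin n') ℂ),
              S.IsFundamentalAt a X → S'.IsFundamentalAt b Y →
              -- `ψ*ℂ(X) = ℂ(ψ*X) ⊆ ℂ(Y)`
              hψ.pullback '' pvField X a =
                PuncturedGerm.generatedField (fun k => hψ.pullback (pvGenerators X a k)) ∧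
              hψ.pullback '' pvField X a ⊆ pvField Y b ∧
              -- degrees do not increase
              ∀ (f : PuncturedGerm a) (d : ℕ),
                PVDegreeLE X a d f → PVDegreeLE Y b d (hψ.pullback f)) ∧
          -- all singular points are finite and real, all residues are real
          (∀ z ∈ S'.poles, z.im = 0) ∧ S'.residueInfty = 0 ∧
          (∀ z ∈ S'.poles, ∀ i j, (S'.residue z i j).im = 0) ∧
          -- the simple-loop spectral condition is preserved
          (S.SpectralCondition → S'.SpectralCondition) := by
  refine ⟨fun q => 2 ^ q.2.1, dimBound, singularBound, heightBound,
    primrec_pow (.const 2) primrec_snd_fst, primrec_dimBound, primrec_singularBound,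
    primrec_heightBound, fun n m r S hS => ?_⟩
  obtain ⟨q, n', S', hdeg, hdom, hdim, hclass, hreal, hinf, him⟩ := hS.exists_dominates
  have hq : q ≠ 0 := by
    rintro rfl
    exact (pow_pos two_pos m).ne (Polynomial.natDegree_zero.symm.trans hdeg)
  have hφ := (ratMapDegree_inv_algebraMap hq).trans hdeg
  refine ⟨(algebraMap (Polynomial ℂ) (RatFunc ℂ) q)⁻¹, n', S', hφ ▸ Nat.one_le_two_pow, hφ.le, hdim,
    hclass, fun b a ψ hψ hb _ X Y hX hY => ?_, hreal, hinf, fun z _ => him z,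
    fun h => (hdom.spec h.vecSpectralCondition).spectralCondition⟩
  have hdegree (f : PuncturedGerm a) (d : ℕ) (hf : PVDegreeLE X a d f) :
      PVDegreeLE Y b d (hψ.pullback f) :=
    hdom.pvDegreeLE_pullback hψ (hψ.inv_eval hq) hb hX.1 hY hf
  have hfield : hψ.pullback '' pvField X a ⊆ pvField Y b := by
    rintro _ ⟨f, ⟨d, hf⟩, rfl⟩
    exact ⟨d, hdegree f d hf⟩
  exact ⟨hψ.pullback_pvField hX.1, hfield, hdegree⟩
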